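/- For $J\in\{0,\tfrac12,1,\dots\}$ let $\mathcal H_J$ be the spin-$J$ space with basis $|J,m\rangle$, $m=-J,\dots,J$, of eigenvectors of the $z$ component of the angular momentum, and let $U_{g,J}$ be the unitary (determined up to a sign when $J$ is a half-integer) that represents the rotation $g\in SO(3)$ on $\mathcal H_J$. Put $|\Phi_J\rangle=(2J+1)^{-1/2}\sum_m|J,m\rangle\otimes|J,m\rangle$ and $|\Phi_{g,J}\rangle=(U_{g,J}\otimes I)|\Phi_J\rangle$, and let $dg$ be the normalized Haar measure on $SO(3)$. For a completely positive map $\mathcal M$ from operators on $\mathcal H_J\otimes\mathcal H_J$ to operators on $\mathcal H_K\otimes\mathcal H_K$ put $$N(\mathcal M)=\int\langle\Phi_{g,K}|\,\mathcal M(|\Phi_{g,J}\rangle\langle\Phi_{g,J}|)\,|\Phi_{g,K}\rangle\,dg,\qquad p_{\rm succ}(\mathcal M)=\int\mathrm{Tr}\,\mathcal M(|\Phi_{g,J}\rangle\langle\Phi_{g,J}|)\,dg .$$ The fidelity of a quantum channel (completely positive trace-preserving map) $\mathcal C$ is $N(\mathcal C)$; the fidelity of a quantum operation (completely positive trace-non-increasing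 map) $\mathcal M$ with $p_{\rm succ}(\mathcal M)>0$ is $N(\mathcal M)/p_{\rm succ}(\mathcal M)$. Let $J,K$ be spins and let $$F=\frac{2J+1}{(2K+1)\,(2|J-K|+1)} .$$ 1. $F$ is the maximum of the fidelity over all quantum channels. It is also the maximum of the fidelity over all quantum operations with positive success probability, and, for every $p\in(0,1]$, over all quantum operations with $p_{\rm succ}=p$. 2. The maximum is attained by the local channel $\mathcal L\otimes\mathcal L$, where $\mathcal L=\mathcal D\circ\mathcal C_{2J\to2K}\circ\mathcal E$. Here $\mathcal E$ is the isometric encoding channel identifying $\mathcal H_J$ with the symmetric subspace of $2J$ qubits ($|J,m\rangle$ is sent to the normalized sum of the computational basis vectors with $J-m$ entries equal to $1$). For $J\le K$, $\mathcal C_{2J\to 2K}$ is universal cloning, $\mathcal C_{2J\to2K}(\rho)=\frac{2J+1}{2K+1}P_{2K}(\rho\otimes I^{\otimes 2(K-J)})P_{2K}$ with $P_{2K}$ the projector on the symmetric subspace of $2K$ qubits; for $J>K$ it is the partial trace over $2(J-K)$ qubits. The map $\mathcal C_{2J\to2K}$ is completely positive, and on operators supported on the symmetric subspace of $2J$ qubits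 it preserves the trace and takes values in the operators supported on the symmetric subspace of $2K$ qubits. Finally $\mathcal D$ is any channel from $2K$ qubits to a spin $K$ that inverts the encoding of $\mathcal H_K$; such a channel exists, and for every such $\mathcal D$ the map $\mathcal L$ is a channel and $\mathcal L\otimes\mathcal L$ is a channel with fidelity $F$. 3. If $J\ne K$ and $K\ne0$, then $F\le\frac34$; if $J=K$ or $K=0$, then $F=1$; if $J=1$ and $K=\frac12$, then $F=\frac34$. -/

import Mathlib

open scoped Matrix Kronecker ComplexOrder
open MeasureTheory

noncomputable section

namespace BellConversion

/-! ### Rotations and their spin representations -/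

/-- The rotation group `SO(3)`. -/
abbrev SO3 : Type := Matrix.specialOrthogonalGroup (Fin 3) ℝ

/-- The Pauli matrices `σ_x, σ_y, σ_z`. -/
def pauli : Fin 3 → Matrix (Fin 2) (Fin 2) ℂ :=
  ![!![0, 1; 1, 0], !![0, -Complex.I; Complex.I, 0], !![1, 0; 0, -1]]

/-- `h` is a spin-1/2 unitary implementing the rotation matrix `g`, i.e. conjugation by `h` sends
`v · σ` to `(g v) · σ` for every vector `v`. -/
def Implements (h : Matrix (Fin 2) (Fin 2) ℂ) (g : Matrix (Fin 3) (Fin 3) ℝ) : Prop :=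
  ∀ k, h * pauli k * hᴴ = ∑ j, (g j k : ℂ) • pauli j

/-- The rotation of angle `t` around the `z` axis. -/
def rotZ (t : ℝ) : Matrix (Fin 3) (Fin 3) ℝ :=
  !![Real.cos t, -Real.sin t, 0; Real.sin t, Real.cos t, 0; 0, 0, 1]

/-- The rotation of angle `t` around the `y` axis. -/
def rotY (t : ℝ) : Matrix (Fin 3) (Fin 3) ℝ :=
  !![Real.cos t, 0, Real.sin t; 0, 1, 0; -Real.sin t, 0, Real.cos t]

theorem implements_mul {h₁ h₂ : Matrix (Fin 2) (Fin 2) ℂ} {g₁ g₂ : Matrix (Fin 3) (Fin 3) ℝ}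
    (H₁ : Implements h₁ g₁) (H₂ : Implements h₂ g₂) : Implements (h₁ * h₂) (g₁ * g₂) := by
  intro k
  have e : h₁ * h₂ * pauli k * (h₁ * h₂)ᴴ = h₁ * (h₂ * pauli k * h₂ᴴ) * h₁ᴴ := by
    simp only [Matrix.conjTranspose_mul, Matrix.mul_assoc]
  rw [e, H₂ k, Matrix.mul_sum, Matrix.sum_mul]
  simp only [Matrix.mul_smul, Matrix.smul_mul, H₁ _, Finset.smul_sum, Matrix.mul_apply,
    Complex.ofReal_sum, Complex.ofReal_mul, Finset.sum_smul, smul_smul]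
  rw [Finset.sum_comm]
  simp only [mul_comm]

theorem exists_implements_rotZ (t : ℝ) :
    ∃ h ∈ Matrix.specialUnitaryGroup (Fin 2) ℂ, Implements h (rotZ t) := by
  have h1 : (Real.cos (t / 2) : ℂ) ^ 2 + (Real.sin (t / 2) : ℂ) ^ 2 = 1 := by
    exact_mod_cast Real.cos_sq_add_sin_sq (t / 2)
  have hc : (Real.cos t : ℂ) = (Real.cos (t / 2) : ℂ) ^ 2 - (Real.sin (t / 2) : ℂ) ^ 2 := by
    have := Real.cos_two_mul' (t / 2)
    rw [mul_div_cancel₀ t two_ne_zero] at this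
    exact_mod_cast this
  have hs : (Real.sin t : ℂ) = 2 * (Real.sin (t / 2) : ℂ) * (Real.cos (t / 2) : ℂ) := by
    have := Real.sin_two_mul (t / 2)
    rw [mul_div_cancel₀ t two_ne_zero] at this
    exact_mod_cast this
  have hI := Complex.I_sq
  generalize hcc : Real.cos (t / 2) = c at *
  generalize hss : Real.sin (t / 2) = s at *
  refine ⟨!![(c : ℂ) - s * Complex.I, 0; 0, (c : ℂ) + s * Complex.I], ?_, ?_⟩
  · rw [Matrix.mem_specialUnitaryGroup_iff, Matrix.mem_unitaryGroup_iff]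
    refine ⟨?_, ?_⟩
    · ext i j
      fin_cases i <;> fin_cases j <;>
        simp [Matrix.mul_apply, Fin.sum_univ_two, Matrix.star_apply] <;> grind
    · rw [Matrix.det_fin_two_of]; grind
  · intro k
    ext i j
    fin_cases k <;> fin_cases i <;> fin_cases j <;>
      simp [pauli, rotZ, Matrix.mul_apply, Fin.sum_univ_two, Fin.sum_univ_three,
        -Complex.ofReal_cos, -Complex.ofReal_sin] <;> grind

theorem exists_implements_rotY (t : ℝ) :
    ∃ h ∈ Matrix.specialUnitaryGroup (Fin 2) ℂ, Implements h (rotY t) := by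
  have h1 : (Real.cos (t / 2) : ℂ) ^ 2 + (Real.sin (t / 2) : ℂ) ^ 2 = 1 := by
    exact_mod_cast Real.cos_sq_add_sin_sq (t / 2)
  have hc : (Real.cos t : ℂ) = (Real.cos (t / 2) : ℂ) ^ 2 - (Real.sin (t / 2) : ℂ) ^ 2 := by
    have := Real.cos_two_mul' (t / 2)
    rw [mul_div_cancel₀ t two_ne_zero] at this
    exact_mod_cast this
  have hs : (Real.sin t : ℂ) = 2 * (Real.sin (t / 2) : ℂ) * (Real.cos (t / 2) : ℂ) := by
    have := Real.sin_two_mul (t / 2)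
    rw [mul_div_cancel₀ t two_ne_zero] at this
    exact_mod_cast this
  have hI := Complex.I_sq
  generalize hcc : Real.cos (t / 2) = c at *
  generalize hss : Real.sin (t / 2) = s at *
  refine ⟨!![(c : ℂ), -(s : ℂ); (s : ℂ), (c : ℂ)], ?_, ?_⟩
  · rw [Matrix.mem_specialUnitaryGroup_iff, Matrix.mem_unitaryGroup_iff]
    refine ⟨?_, ?_⟩
    · ext i j
      fin_cases i <;> fin_cases j <;>
        simp [Matrix.mul_apply, Fin.sum_univ_two, Matrix.star_apply] <;> grind
    · rw [Matrix.det_fin_two_of]; grind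
  · intro k
    ext i j
    fin_cases k <;> fin_cases i <;> fin_cases j <;>
      simp [pauli, rotY, Matrix.mul_apply, Fin.sum_univ_two, Fin.sum_univ_three,
        -Complex.ofReal_cos, -Complex.ofReal_sin] <;> grind

theorem exists_polar (x y : ℝ) :
    ∃ t : ℝ, x = √(x ^ 2 + y ^ 2) * Real.cos t ∧ y = √(x ^ 2 + y ^ 2) * Real.sin t := by
  refine ⟨Complex.arg ⟨x, y⟩, ?_, ?_⟩
  · have := Complex.norm_mul_cos_arg (⟨x, y⟩ : ℂ)
    rw [Complex.norm_eq_sqrt_sq_add_sq] at this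
    exact this.symm
  · have := Complex.norm_mul_sin_arg (⟨x, y⟩ : ℂ)
    rw [Complex.norm_eq_sqrt_sq_add_sq] at this
    exact this.symm

theorem rotZ_transpose_mul (t : ℝ) : (rotZ t)ᵀ * rotZ t = 1 ∧ rotZ t * (rotZ t)ᵀ = 1 := by
  have := Real.cos_sq_add_sin_sq t
  constructor <;> ext i j <;> fin_cases i <;> fin_cases j <;>
    simp [rotZ, Matrix.mul_apply, Fin.sum_univ_three] <;> grind

theorem rotY_transpose_mul (t : ℝ) : (rotY t)ᵀ * rotY t = 1 ∧ rotY t * (rotY t)ᵀ = 1 := by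
  have := Real.cos_sq_add_sin_sq t
  constructor <;> ext i j <;> fin_cases i <;> fin_cases j <;>
    simp [rotY, Matrix.mul_apply, Fin.sum_univ_three] <;> grind

theorem det_rotZ (t : ℝ) : (rotZ t).det = 1 := by
  have := Real.cos_sq_add_sin_sq t
  simp [rotZ, Matrix.det_fin_three]; grind

theorem det_rotY (t : ℝ) : (rotY t).det = 1 := by
  have := Real.cos_sq_add_sin_sq t
  simp [rotY, Matrix.det_fin_three]; grind

/-- A rotation fixing the `z` axis is a rotation around it. -/
theorem exists_rotZ (m : Matrix (Fin 3) (Fin 3) ℝ) (h1 : mᵀ * m = 1) (h2 : m.det = 1)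
    (h02 : m 0 2 = 0) (h12 : m 1 2 = 0) (h22 : m 2 2 = 1) : ∃ c, m = rotZ c := by
  have e : ∀ i j, m 0 i * m 0 j + m 1 i * m 1 j + m 2 i * m 2 j
      = (1 : Matrix (Fin 3) (Fin 3) ℝ) i j := by
    intro i j
    rw [← h1]
    simp [Matrix.mul_apply, Fin.sum_univ_three]
  have e02 := e 0 2
  have e12 := e 1 2
  have e00 := e 0 0
  have e11 := e 1 1
  have h20 : m 2 0 = 0 := by simpa [h02, h12, h22] using e02
  have h21 : m 2 1 = 0 := by simpa [h02, h12, h22] using e12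
  simp [h20, h21] at e00 e11
  rw [Matrix.det_fin_three] at h2
  simp [h02, h12, h22, h20, h21] at h2
  have hd : (m 1 1 - m 0 0) ^ 2 + (m 0 1 + m 1 0) ^ 2 = 0 := by linear_combination e00 + e11 - 2 * h2
  have hx : m 1 1 - m 0 0 = 0 := by nlinarith [sq_nonneg (m 1 1 - m 0 0), sq_nonneg (m 0 1 + m 1 0)]
  have hy : m 0 1 + m 1 0 = 0 := by nlinarith [sq_nonneg (m 1 1 - m 0 0), sq_nonneg (m 0 1 + m 1 0)]
  obtain ⟨c, hc, hs⟩ := exists_polar (m 0 0) (m 1 0)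
  rw [show m 0 0 ^ 2 + m 1 0 ^ 2 = 1 by linear_combination e00, Real.sqrt_one, one_mul] at hc hs
  refine ⟨c, ?_⟩
  ext i j
  fin_cases i <;> fin_cases j <;> simp [rotZ, h02, h12, h22, h20, h21] <;> linarith

/-- Every rotation has Euler angles. -/
theorem exists_euler (g : Matrix (Fin 3) (Fin 3) ℝ) (h1 : gᵀ * g = 1) (h2 : g.det = 1) :
    ∃ a b c : ℝ, g = rotZ a * (rotY b * rotZ c) := by
  have e22 : g 0 2 * g 0 2 + g 1 2 * g 1 2 + g 2 2 * g 2 2 = 1 := by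
    have : (gᵀ * g) 2 2 = 1 := by rw [h1]; simp
    simpa [Matrix.mul_apply, Fin.sum_univ_three] using this
  obtain ⟨a, ha, hb⟩ := exists_polar (g 0 2) (g 1 2)
  generalize hr : √(g 0 2 ^ 2 + g 1 2 ^ 2) = r at ha hb
  have hr2 : r ^ 2 = g 0 2 ^ 2 + g 1 2 ^ 2 := by
    rw [← hr, Real.sq_sqrt (by positivity)]
  obtain ⟨b, hc, hd⟩ := exists_polar (g 2 2) r
  rw [show g 2 2 ^ 2 + r ^ 2 = 1 by linear_combination hr2 + e22, Real.sqrt_one, one_mul] at hc hd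
  have sa := Real.cos_sq_add_sin_sq a
  have sb := Real.cos_sq_add_sin_sq b
  obtain ⟨c, hm⟩ := exists_rotZ ((rotY b)ᵀ * ((rotZ a)ᵀ * g)) (by
      simp only [Matrix.transpose_mul, Matrix.transpose_transpose, Matrix.mul_assoc]
      rw [← Matrix.mul_assoc (rotY b), (rotY_transpose_mul b).2, Matrix.one_mul,
        ← Matrix.mul_assoc (rotZ a), (rotZ_transpose_mul a).2, Matrix.one_mul, h1])
    (by simp [Matrix.det_mul, det_rotY, det_rotZ, h2])
    (by simp [rotY, rotZ, Matrix.mul_apply, Fin.sum_univ_three]; rw [ha, hb, hc]; grind)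
    (by simp [rotY, rotZ, Matrix.mul_apply, Fin.sum_univ_three]; rw [ha, hb]; grind)
    (by simp [rotY, rotZ, Matrix.mul_apply, Fin.sum_univ_three]; rw [ha, hb, hc]; grind)
  refine ⟨a, b, c, ?_⟩
  rw [← hm, ← Matrix.mul_assoc (rotY b), (rotY_transpose_mul b).2, Matrix.one_mul,
    ← Matrix.mul_assoc (rotZ a), (rotZ_transpose_mul a).2, Matrix.one_mul]

/-- Every rotation is implemented by a spin-1/2 unitary of determinant one. -/
theorem exists_implements (g : SO3) :
    ∃ h ∈ Matrix.specialUnitaryGroup (Fin 2) ℂ, Implements h g.1 := by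
  obtain ⟨ho, hd⟩ := Matrix.mem_specialOrthogonalGroup_iff.1 g.2
  obtain ⟨a, b, c, e⟩ := exists_euler g.1 ((Matrix.mem_orthogonalGroup_iff' _ _).1 ho) hd
  obtain ⟨ha, ha1, ha2⟩ := exists_implements_rotZ a
  obtain ⟨hb, hb1, hb2⟩ := exists_implements_rotY b
  obtain ⟨hc, hc1, hc2⟩ := exists_implements_rotZ c
  refine ⟨ha * (hb * hc), mul_mem ha1 (mul_mem hb1 hc1), ?_⟩
  rw [e]
  exact implements_mul ha2 (implements_mul hb2 hc2)

/-! Throughout, a spin `J` is given by the natural number `a = 2J`. -/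

/-- Index type of the standard basis of the spin-`a/2` space; the index `i` stands for the
eigenvector `|J, m⟩` of the `z` component of the angular momentum with `m = J - i`. -/
abbrev Spin (a : ℕ) : Type := Fin (a + 1)

/-- Index type of the computational basis of `n` qubits. The basis vectors `0` and `1` of a qubit
are the spin-1/2 states with `m = 1/2` and `m = -1/2`. -/
abbrev Qubits (n : ℕ) : Type := Fin n → Fin 2

/-- The isometry identifying the spin-`a/2` space with the symmetric subspace of `a` qubits: its
`i`-th column is the normalised sum of the computational basis vectors with `i` entries equal to
`1`. -/
def dicke (a : ℕ) : Matrix (Qubits a) (Spin a) ℂ :=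
  Matrix.of fun s i =>
    if ∑ k, (s k : ℕ) = (i : ℕ) then ((1 / √((a.choose i : ℕ) : ℝ) : ℝ) : ℂ) else 0

/-- The projector on the symmetric subspace of `a` qubits. -/
def symProj (a : ℕ) : Matrix (Qubits a) (Qubits a) ℂ := dicke a * (dicke a)ᴴ

/-- The tensor power `h ⊗ ⋯ ⊗ h` of a one-qubit operator. -/
def tensorPow (a : ℕ) (h : Matrix (Fin 2) (Fin 2) ℂ) : Matrix (Qubits a) (Qubits a) ℂ :=
  Matrix.of fun s t => ∏ k, h (s k) (t k)

/-- The spin-`a/2` irreducible representation of `SU(2)`, i.e. the restriction of `h ⊗ ⋯ ⊗ h` to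
the symmetric subspace, written in the basis `|J, m⟩`. -/
def spinRep (a : ℕ) (h : Matrix (Fin 2) (Fin 2) ℂ) : Matrix (Spin a) (Spin a) ℂ :=
  (dicke a)ᴴ * tensorPow a h * dicke a

/-- The unitary `U_{g,J}` representing the rotation `g` on a spin `J = a/2`. Of the two elements
`± h` of `SU(2)` implementing `g`, one is chosen; for half-integer `J` this fixes the sign of
`U_{g,J}`, which affects no density operator. -/
def rotation (a : ℕ) (g : SO3) : Matrix (Spin a) (Spin a) ℂ :=
  spinRep a (exists_implements g).choose

/-- The standard Bell state `|Φ_J⟩ = (2J+1)^{-1/2} ∑ₘ |J,m⟩ ⊗ |J,m⟩`. -/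
def bell (a : ℕ) : Spin a × Spin a → ℂ :=
  fun p => if p.1 = p.2 then ((1 / √(a + 1 : ℝ) : ℝ) : ℂ) else 0

/-- The rotated Bell state `|Φ_{g,J}⟩ = (U_{g,J} ⊗ I) |Φ_J⟩`. -/
def rotatedBell (a : ℕ) (g : SO3) : Spin a × Spin a → ℂ :=
  (rotation a g ⊗ₖ (1 : Matrix (Spin a) (Spin a) ℂ)) *ᵥ bell a

/-- The density operator `|Φ_{g,J}⟩⟨Φ_{g,J}|`. -/
def rotatedBellState (a : ℕ) (g : SO3) : Matrix (Spin a × Spin a) (Spin a × Spin a) ℂ :=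
  Matrix.vecMulVec (rotatedBell a g) (star (rotatedBell a g))

/-! ### Quantum channels and quantum operations -/

section Maps

variable {m n m' n' r : Type*}

/-- The map `Φ ⊗ id`. -/
def onFirst (r : Type*) (Φ : Matrix m m ℂ →ₗ[ℂ] Matrix n n ℂ) :
    Matrix (m × r) (m × r) ℂ →ₗ[ℂ] Matrix (n × r) (n × r) ℂ where
  toFun X := Matrix.of fun p q => Φ (Matrix.of fun i j => X (i, p.2) (j, q.2)) p.1 q.1
  map_add' X Y := by
    ext p q
    exact congrFun (congrFun (map_add Φ (Matrix.of fun i j => X (i, p.2) (j, q.2))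
      (Matrix.of fun i j => Y (i, p.2) (j, q.2))) p.1) q.1
  map_smul' c X := by
    ext p q
    exact congrFun (congrFun (map_smul Φ c (Matrix.of fun i j => X (i, p.2) (j, q.2))) p.1) q.1

/-- The map `id ⊗ Φ`. -/
def onSecond (r : Type*) (Φ : Matrix m m ℂ →ₗ[ℂ] Matrix n n ℂ) :
    Matrix (r × m) (r × m) ℂ →ₗ[ℂ] Matrix (r × n) (r × n) ℂ where
  toFun X := Matrix.of fun p q => Φ (Matrix.of fun i j => X (p.1, i) (q.1, j)) p.2 q.2
  map_add' X Y := by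
    ext p q
    exact congrFun (congrFun (map_add Φ (Matrix.of fun i j => X (p.1, i) (q.1, j))
      (Matrix.of fun i j => Y (p.1, i) (q.1, j))) p.2) q.2
  map_smul' c X := by
    ext p q
    exact congrFun (congrFun (map_smul Φ c (Matrix.of fun i j => X (p.1, i) (q.1, j))) p.2) q.2

/-- The tensor product `Φ ⊗ Ψ`, i.e. the two maps applied locally to the two parts. -/
def tensorMap (Φ : Matrix m m ℂ →ₗ[ℂ] Matrix n n ℂ) (Ψ : Matrix m' m' ℂ →ₗ[ℂ] Matrix n' n' ℂ) :
    Matrix (m × m') (m × m') ℂ →ₗ[ℂ] Matrix (n × n') (n × n') ℂ :=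
  onFirst n' Φ ∘ₗ onSecond m Ψ

/-- Complete positivity: `Φ ⊗ id` is positive for every finite-dimensional ancilla. -/
def IsCompletelyPositive (Φ : Matrix m m ℂ →ₗ[ℂ] Matrix n n ℂ) : Prop :=
  ∀ (d : ℕ) (X : Matrix (m × Fin d) (m × Fin d) ℂ), X.PosSemidef → (onFirst (Fin d) Φ X).PosSemidef

variable [Fintype m] [Fintype n]

/-- Quantum channels: completely positive trace-preserving maps. -/
def IsChannel (Φ : Matrix m m ℂ →ₗ[ℂ] Matrix n n ℂ) : Prop :=
  IsCompletelyPositive Φ ∧ ∀ X, (Φ X).trace = X.trace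

/-- Quantum operations: completely positive trace-non-increasing maps. -/
def IsQuantumOperation (Φ : Matrix m m ℂ →ₗ[ℂ] Matrix n n ℂ) : Prop :=
  IsCompletelyPositive Φ ∧ ∀ X, X.PosSemidef → (Φ X).trace.re ≤ X.trace.re

end Maps

/-! ### Fidelities -/

/-- Maps from operators on a pair of spins `a/2` to operators on a pair of spins `b/2`. -/
abbrev Converter (a b : ℕ) : Type :=
  Matrix (Spin a × Spin a) (Spin a × Spin a) ℂ →ₗ[ℂ] Matrix (Spin b × Spin b) (Spin b × Spin b) ℂ

/-- `⟨Φ_{g,K}| M(|Φ_{g,J}⟩⟨Φ_{g,J}|) |Φ_{g,K}⟩`, with `J = a/2` and `K = b/2`. -/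
def overlap (a b : ℕ) (M : Converter a b) (g : SO3) : ℝ :=
  (star (rotatedBell b g) ⬝ᵥ (M (rotatedBellState a g) *ᵥ rotatedBell b g)).re

variable [MeasurableSpace SO3]

/-- The average fidelity of a deterministic machine. -/
def detFidelity (μ : Measure SO3) (a b : ℕ) (C : Converter a b) : ℝ :=
  ∫ g, overlap a b C g ∂μ

/-- The total success probability of a probabilistic machine. -/
def successProb (μ : Measure SO3) (a b : ℕ) (M : Converter a b) : ℝ :=
  ∫ g, (M (rotatedBellState a g)).trace.re ∂μ

/-- The average fidelity of a probabilistic machine, conditionally on its success. -/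
def probFidelity (μ : Measure SO3) (a b : ℕ) (M : Converter a b) : ℝ :=
  (∫ g, overlap a b M g ∂μ) / successProb μ a b M

/-! ### Encoding, cloning or discarding, decoding -/

/-- The map `X ↦ A X Aᴴ`. -/
def conjMap {m n : Type*} [Fintype m] (A : Matrix n m ℂ) :
    Matrix m m ℂ →ₗ[ℂ] Matrix n n ℂ where
  toFun X := A * X * Aᴴ
  map_add' X Y := by rw [Matrix.mul_add, Matrix.add_mul]
  map_smul' c X := by simp

/-- The encoding of a spin `a/2` into the symmetric subspace of `a` qubits. -/
def encode (a : ℕ) : Matrix (Spin a) (Spin a) ℂ →ₗ[ℂ] Matrix (Qubits a) (Qubits a) ℂ :=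
  conjMap (dicke a)

/-- For `a ≤ b`, the map `ρ ↦ ρ ⊗ I` adjoining `b - a` qubits in the (unnormalised) maximally
mixed state. -/
def adjoin {a b : ℕ} (h : a ≤ b) :
    Matrix (Qubits a) (Qubits a) ℂ →ₗ[ℂ] Matrix (Qubits b) (Qubits b) ℂ where
  toFun X := Matrix.of fun s t =>
    if ∀ k : Fin b, a ≤ (k : ℕ) → s k = t k then X (s ∘ Fin.castLE h) (t ∘ Fin.castLE h) else 0
  map_add' X Y := by ext s t; simp only [Matrix.of_apply, Matrix.add_apply]; split <;> simp
  map_smul' c X := by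
    ext s t; simp only [Matrix.of_apply, Matrix.smul_apply, RingHom.id_apply]; split <;> simp

/-- For `b ≤ a`, the partial trace of `a` qubits over the last `a - b` ones. -/
def discard {a b : ℕ} (h : b ≤ a) :
    Matrix (Qubits a) (Qubits a) ℂ →ₗ[ℂ] Matrix (Qubits b) (Qubits b) ℂ where
  toFun X := Matrix.of fun s t => ∑ x, ∑ y,
    if x ∘ Fin.castLE h = s ∧ y ∘ Fin.castLE h = t ∧ ∀ k : Fin a, b ≤ (k : ℕ) → x k = y k
      then X x y else 0
  map_add' X Y := by
    ext s t
    simp only [Matrix.of_apply, Matrix.add_apply, ← Finset.sum_add_distrib]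
    refine Finset.sum_congr rfl fun x _ => Finset.sum_congr rfl fun y _ => ?_
    split <;> simp
  map_smul' c X := by
    ext s t
    simp only [Matrix.of_apply, Matrix.smul_apply, RingHom.id_apply, smul_eq_mul, Finset.mul_sum]
    refine Finset.sum_congr rfl fun x _ => Finset.sum_congr rfl fun y _ => ?_
    split <;> simp

/-- The map from `a` to `b` qubits that is, for `a ≤ b`, the universal cloning map
`ρ ↦ (a+1)/(b+1) P (ρ ⊗ I) P`, with `P` the projector on the symmetric subspace of `b` qubits, and,
for `a > b`, the partial trace over `a - b` qubits. -/
def cloneOrDiscard (a b : ℕ) :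
    Matrix (Qubits a) (Qubits a) ℂ →ₗ[ℂ] Matrix (Qubits b) (Qubits b) ℂ :=
  if h : a ≤ b then (((a : ℂ) + 1) / ((b : ℂ) + 1)) • (conjMap (symProj b) ∘ₗ adjoin h)
  else discard (Nat.le_of_not_le h)

/-- `D` is a channel that merges `b` qubits into a single spin `b/2`, undoing the encoding. -/
def IsDecoder (b : ℕ) (D : Matrix (Qubits b) (Qubits b) ℂ →ₗ[ℂ] Matrix (Spin b) (Spin b) ℂ) :
    Prop :=
  IsChannel D ∧ ∀ X, D (encode b X) = X

/-- The local operation converting one spin `a/2` into one spin `b/2`: encoding, then cloning or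
discarding, then decoding. -/
def localConversion (a b : ℕ)
    (D : Matrix (Qubits b) (Qubits b) ℂ →ₗ[ℂ] Matrix (Spin b) (Spin b) ℂ) :
    Matrix (Spin a) (Spin a) ℂ →ₗ[ℂ] Matrix (Spin b) (Spin b) ℂ :=
  D ∘ₗ cloneOrDiscard a b ∘ₗ encode a

end BellConversion

end

open BellConversion

/-! Write a = 2J and b = 2K.

Upper bound. Decompose a completely positive map into Kraus operators T. The amplitude
⟨Φ_{g,K}|T|Φ_{g,J}⟩ is, up to complex conjugation and the factor ((a+1)(b+1))^(-1/2), a linear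
functional of the matrix elements of U_{g,K} ⊗ conj(U_{g,J}), whose coefficients are the reshuffled
entries of T. By Clebsch–Gordan this representation is the multiplicity-free sum of the spins c/2
with c = a+b, a+b-2, ..., |a-b|. Schur orthogonality gives each block c the weight 1/(c+1) in the
averaged square, so the average is at most ‖T‖²/(|a-b|+1) in Hilbert–Schmidt norm
(`integral_norm_sq_pairRep_le`, `integral_kraus_overlap_le`). The Haar average of |Φ_{g,J}⟩⟨Φ_{g,J}|
is maximally mixed, so T contributes exactly ‖T‖²/(a+1)² to the success probability
(`integral_kraus_trace`). The quotient of the two is F, so the bound holds for every success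
probability at once (`integral_overlap_le`).

Attainment. Between the symmetric subspaces, cloning and discarding have Kraus operators T_u indexed
by computational basis states u of the n = |a-b| extra qubits. Rotations permute the T_u through a
unitary matrix, so the fidelity of the local channel does not depend on g. At the identity it is the
sum over u, v of |Tr(T_uᵀ T_v)|², divided by (a+1)(b+1). The traces vanish unless u and v have equal
weight, and a binomial identity makes every weight contribute the same amount
(`sum_norm_sq_spinSlot`, `overlap_tensorMap_localConversion`). Multiplying the channel by p gives an
optimal operation with success probability p.

The unitaries implementing g are chosen only up to sign, and the choice need not be continuous in g.
For this reason every integrand is built from products in which the signs cancel. -/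

namespace BellConversion

/-! ### Combinatorics of the symmetric subspace -/

/-- The number of entries equal to `1` of a computational basis vector. -/
def weight {a : ℕ} (s : Qubits a) : ℕ := ∑ k, (s k : ℕ)

theorem weight_le {a : ℕ} (s : Qubits a) : weight s ≤ a := by
  calc weight s ≤ ∑ _k : Fin a, 1 := Finset.sum_le_sum fun k _ => by have := (s k).2; omega
    _ = a := by simp

theorem weight_append {a n : ℕ} (s : Qubits a) (t : Qubits n) :
    weight (Fin.append s t : Qubits (a + n)) = weight s + weight t := by
  simp [weight, Fin.sum_univ_add]

theorem prod_comp_eq_pow_weight {R : Type*} [CommMonoid R] {a : ℕ} (s : Qubits a) (q : Fin 2 → R) :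
    ∏ k, q (s k) = q 0 ^ (a - weight s) * q 1 ^ weight s := by
  have h : ∀ j : Fin 2, q j = q 0 ^ (1 - (j : ℕ)) * q 1 ^ (j : ℕ) := by
    intro j; fin_cases j <;> simp
  have h2 : ∑ k, (1 - (s k : ℕ)) = a - weight s := by
    have : ∑ k, (1 - (s k : ℕ)) + weight s = a := by
      rw [weight, ← Finset.sum_add_distrib]
      calc ∑ k, (1 - (s k : ℕ) + (s k : ℕ)) = ∑ _k : Fin a, 1 :=
            Finset.sum_congr rfl fun k _ => by have := (s k).2; omega
        _ = a := by simp
    omega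
  rw [Finset.prod_congr rfl fun k _ => h (s k), Finset.prod_mul_distrib,
    Finset.prod_pow_eq_pow_sum, Finset.prod_pow_eq_pow_sum, h2, weight]

theorem sum_qubits_prod {R : Type*} [CommSemiring R] {a : ℕ} (f : Fin a → Fin 2 → R) :
    ∑ t : Qubits a, ∏ k, f k (t k) = ∏ k, (f k 0 + f k 1) := by
  have := Finset.prod_univ_sum (fun _ : Fin a => (Finset.univ : Finset (Fin 2))) f
  simp only [Fin.sum_univ_two, Fintype.piFinset_univ] at this
  exact this.symm

-- Generating function for the weight: attach a factor X to every entry equal to `1`, and expand the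
-- product over the qubits.
open Polynomial in
theorem sum_weight_eq {a : ℕ} (f : Fin a → Fin 2 → ℂ) (j : ℕ) :
    ∑ t : Qubits a, (if weight t = j then ∏ k, f k (t k) else 0)
      = (∏ k, (C (f k 0) + C (f k 1) * X)).coeff j := by
  have h := sum_qubits_prod fun (k : Fin a) (i : Fin 2) => C (f k i) * (X : ℂ[X]) ^ (i : ℕ)
  simp only [Fin.val_zero, pow_zero, mul_one, Fin.val_one, pow_one] at h
  rw [← h, finsetSum_coeff]
  refine Finset.sum_congr rfl fun t _ => ?_
  rw [Finset.prod_mul_distrib, Finset.prod_pow_eq_pow_sum, ← map_prod, coeff_C_mul, coeff_X_pow]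
  rw [show ∑ k, (t k : ℕ) = weight t from rfl]
  simp only [eq_comm (a := j)]
  split <;> simp

theorem card_weight_eq (a j : ℕ) :
    ∑ t : Qubits a, (if weight t = j then (1 : ℂ) else 0) = a.choose j := by
  have := sum_weight_eq (fun (_ : Fin a) _ => (1 : ℂ)) j
  simp only [Finset.prod_const_one] at this
  rw [this]
  simp only [map_one, one_mul, Finset.prod_const, Finset.card_univ, Fintype.card_fin,
    Polynomial.coeff_one_add_X_pow]

/-- Summation of a function of the weight. -/
theorem sum_comp_weight (a : ℕ) (f : ℕ → ℂ) :
    ∑ t : Qubits a, f (weight t) = ∑ j : Spin a, (a.choose j : ℂ) * f j := by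
  have : ∀ t : Qubits a, f (weight t) = ∑ j : Spin a, (if weight t = (j : ℕ) then 1 else 0) * f j := by
    intro t
    rw [Finset.sum_eq_single (⟨weight t, Nat.lt_succ_of_le (weight_le t)⟩ : Spin a)]
    · simp
    · intro j _ hj
      rw [if_neg (fun h => hj (Fin.ext h.symm)), zero_mul]
    · simp
  rw [Finset.sum_congr rfl fun t _ => this t, Finset.sum_comm]
  refine Finset.sum_congr rfl fun j _ => ?_
  rw [← Finset.sum_mul, card_weight_eq]

/-- The normalisation `√(choose a i)` of a symmetric basis vector. -/
noncomputable def rootChoose (a i : ℕ) : ℂ := ((√((a.choose i : ℕ) : ℝ) : ℝ) : ℂ)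

theorem rootChoose_sq (a i : ℕ) : rootChoose a i * rootChoose a i = a.choose i := by
  rw [rootChoose, ← Complex.ofReal_mul, Real.mul_self_sqrt (Nat.cast_nonneg _)]
  simp

theorem choose_ne_zero' {a : ℕ} (i : Spin a) : (a.choose i : ℂ) ≠ 0 := by
  exact_mod_cast (Nat.choose_pos (Nat.le_of_lt_succ i.2)).ne'

theorem rootChoose_ne_zero {a : ℕ} (i : Spin a) : rootChoose a i ≠ 0 := by
  intro h
  have := rootChoose_sq a i
  rw [h, mul_zero] at this
  exact choose_ne_zero' i this.symm

theorem star_rootChoose (a i : ℕ) : star (rootChoose a i) = rootChoose a i := by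
  simp [rootChoose]

theorem dicke_apply (a : ℕ) (s : Qubits a) (i : Spin a) :
    dicke a s i = if weight s = (i : ℕ) then (rootChoose a i)⁻¹ else 0 := by
  change (if weight s = (i : ℕ) then _ else _) = _
  simp [rootChoose]

theorem star_dicke_apply (a : ℕ) (s : Qubits a) (i : Spin a) : star (dicke a s i) = dicke a s i := by
  rw [dicke_apply]
  split
  · rw [star_inv₀, star_rootChoose]
  · simp

theorem dicke_conjTranspose_mul_dicke (a : ℕ) : (dicke a)ᴴ * dicke a = 1 := by
  ext i j
  simp only [Matrix.mul_apply, Matrix.conjTranspose_apply, star_dicke_apply]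
  simp only [dicke_apply]
  by_cases hij : i = j
  · subst hij
    rw [Matrix.one_apply_eq]
    have : ∀ s : Qubits a, ((if weight s = (i : ℕ) then (rootChoose a i)⁻¹ else 0) *
        if weight s = (i : ℕ) then (rootChoose a i)⁻¹ else 0)
        = (if weight s = (i : ℕ) then (1 : ℂ) else 0) * (a.choose i : ℂ)⁻¹ := by
      intro s
      rw [← rootChoose_sq, mul_inv]
      split <;> simp
    rw [Finset.sum_congr rfl fun s _ => this s, ← Finset.sum_mul, card_weight_eq,
      mul_inv_cancel₀ (choose_ne_zero' i)]
  · rw [Matrix.one_apply_ne hij]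
    refine Finset.sum_eq_zero fun s _ => ?_
    by_cases h : weight s = (i : ℕ)
    · rw [if_neg (c := weight s = (j : ℕ)) (fun h' => hij (Fin.ext (h.symm.trans h'))), mul_zero]
    · rw [if_neg h, zero_mul]

theorem symProj_apply (a : ℕ) (s t : Qubits a) :
    symProj a s t = if weight t = weight s then (a.choose (weight s) : ℂ)⁻¹ else 0 := by
  simp only [symProj, Matrix.mul_apply, Matrix.conjTranspose_apply, star_dicke_apply]
  simp only [dicke_apply]
  rw [Finset.sum_eq_single (⟨weight s, Nat.lt_succ_of_le (weight_le s)⟩ : Spin a)]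
  · simp only [if_true]
    split
    · rw [← mul_inv, rootChoose_sq]
    · simp
  · intro j _ hj
    rw [if_neg (fun h => hj (Fin.ext h.symm)), zero_mul]
  · simp

/-- The projector averages over all basis states of equal weight, so it fixes any vector whose
coefficients depend on the weight alone. -/
theorem symProj_mul_of_weight {a : ℕ} {κ : Type*} (v : Matrix (Qubits a) κ ℂ)
    (hv : ∀ s t k, weight s = weight t → v s k = v t k) : symProj a * v = v := by
  ext s k
  simp only [Matrix.mul_apply, symProj_apply]
  have : ∀ t : Qubits a, (if weight t = weight s then (a.choose (weight s) : ℂ)⁻¹ else 0) * v t k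
      = (if weight t = weight s then 1 else 0) * ((a.choose (weight s) : ℂ)⁻¹ * v s k) := by
    intro t
    split
    · rename_i h; rw [hv t s k h, one_mul]
    · simp
  rw [Finset.sum_congr rfl fun t _ => this t, ← Finset.sum_mul, card_weight_eq, ← mul_assoc,
    mul_inv_cancel₀ (choose_ne_zero' ⟨weight s, Nat.lt_succ_of_le (weight_le s)⟩), one_mul]

theorem symProj_conjTranspose (a : ℕ) : (symProj a)ᴴ = symProj a := by
  simp [symProj]

theorem symProj_mul_dicke (a : ℕ) : symProj a * dicke a = dicke a := by
  rw [symProj, Matrix.mul_assoc, dicke_conjTranspose_mul_dicke, Matrix.mul_one]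

theorem dicke_mul_symProj (a : ℕ) : (dicke a)ᴴ * symProj a = (dicke a)ᴴ := by
  rw [symProj, ← Matrix.mul_assoc, dicke_conjTranspose_mul_dicke, Matrix.one_mul]

/-! ### Tensor powers and spin representations -/

theorem tensorPow_mul (a : ℕ) (h k : Matrix (Fin 2) (Fin 2) ℂ) :
    tensorPow a h * tensorPow a k = tensorPow a (h * k) := by
  ext s t
  simp only [tensorPow, Matrix.mul_apply, Matrix.of_apply, ← Finset.prod_mul_distrib]
  rw [sum_qubits_prod fun l j => h (s l) j * k j (t l)]
  simp [Fin.sum_univ_two]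

theorem tensorPow_one (a : ℕ) : tensorPow a 1 = 1 := by
  ext s t
  simp [tensorPow, Matrix.one_apply, Finset.prod_boole, funext_iff]

theorem tensorPow_conjTranspose (a : ℕ) (h : Matrix (Fin 2) (Fin 2) ℂ) :
    (tensorPow a h)ᴴ = tensorPow a hᴴ := by
  ext s t
  simp [tensorPow, Matrix.conjTranspose_apply]

theorem tensorPow_append {a n : ℕ} (h : Matrix (Fin 2) (Fin 2) ℂ) (s t : Qubits a)
    (u v : Qubits n) : tensorPow (a + n) h (Fin.append s u) (Fin.append t v)
      = tensorPow a h s t * tensorPow n h u v := by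
  simp [tensorPow, Fin.prod_univ_add]

-- The sum over all basis states of weight j is a coefficient of a product of linear polynomials. It
-- depends on s only through its weight, which is why tensor powers preserve the symmetric subspace.
open Polynomial in
theorem tensorPow_mul_dicke_apply {a : ℕ} (h : Matrix (Fin 2) (Fin 2) ℂ) (s : Qubits a)
    (j : Spin a) : (tensorPow a h * dicke a) s j =
      ((C (h 0 0) + C (h 0 1) * X) ^ (a - weight s) *
        (C (h 1 0) + C (h 1 1) * X) ^ weight s : ℂ[X]).coeff j * (rootChoose a j)⁻¹ := by
  rw [← prod_comp_eq_pow_weight s fun i => C (h i 0) + C (h i 1) * X,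
    ← sum_weight_eq fun k i => h (s k) i, Finset.sum_mul, Matrix.mul_apply]
  refine Finset.sum_congr rfl fun t _ => ?_
  rw [dicke_apply, tensorPow, Matrix.of_apply]
  split <;> simp

theorem symProj_mul_tensorPow_mul_dicke (a : ℕ) (h : Matrix (Fin 2) (Fin 2) ℂ) :
    symProj a * (tensorPow a h * dicke a) = tensorPow a h * dicke a := by
  refine symProj_mul_of_weight _ fun s t k hst => ?_
  rw [tensorPow_mul_dicke_apply, tensorPow_mul_dicke_apply, hst]

/-- Invariance of the symmetric subspace: compressing h ⊗ ⋯ ⊗ h to it loses nothing. This makes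
`spinRep` multiplicative. -/
theorem dicke_mul_spinRep (a : ℕ) (h : Matrix (Fin 2) (Fin 2) ℂ) :
    dicke a * spinRep a h = tensorPow a h * dicke a := by
  have := symProj_mul_tensorPow_mul_dicke a h
  rw [symProj] at this
  rw [spinRep, ← this]
  simp only [Matrix.mul_assoc]

theorem spinRep_conjTranspose (a : ℕ) (h : Matrix (Fin 2) (Fin 2) ℂ) :
    (spinRep a h)ᴴ = spinRep a hᴴ := by
  simp [spinRep, ← tensorPow_conjTranspose, Matrix.mul_assoc]

theorem spinRep_mul_dicke (a : ℕ) (h : Matrix (Fin 2) (Fin 2) ℂ) :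
    spinRep a h * (dicke a)ᴴ = (dicke a)ᴴ * tensorPow a h := by
  have := congrArg Matrix.conjTranspose (dicke_mul_spinRep a hᴴ)
  simpa [← spinRep_conjTranspose, ← tensorPow_conjTranspose] using this

theorem spinRep_mul (a : ℕ) (h k : Matrix (Fin 2) (Fin 2) ℂ) :
    spinRep a h * spinRep a k = spinRep a (h * k) := by
  nth_rw 2 [spinRep]
  rw [← Matrix.mul_assoc, ← Matrix.mul_assoc, spinRep_mul_dicke, spinRep, ← tensorPow_mul,
    ← Matrix.mul_assoc]

theorem spinRep_one (a : ℕ) : spinRep a 1 = 1 := by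
  rw [spinRep, tensorPow_one, Matrix.mul_one, dicke_conjTranspose_mul_dicke]

theorem spinRep_neg (a : ℕ) (h : Matrix (Fin 2) (Fin 2) ℂ) :
    spinRep a (-h) = (-1) ^ a • spinRep a h := by
  have : tensorPow a (-h) = (-1 : ℂ) ^ a • tensorPow a h := by
    ext s t
    simp only [tensorPow, Matrix.of_apply, Matrix.smul_apply, Matrix.neg_apply, Finset.prod_neg]
    simp
  rw [spinRep, this, spinRep]
  ext i j
  simp only [Matrix.mul_smul, Matrix.smul_mul, Matrix.smul_apply]
  simp

-- This is the model of the spin a/2 on homogeneous polynomials of degree a, from which diagonal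
-- elements and the first row can be read off.
open Polynomial in
theorem spinRep_apply {a : ℕ} (h : Matrix (Fin 2) (Fin 2) ℂ) (i j : Spin a) :
    spinRep a h i j = rootChoose a i *
      ((C (h 0 0) + C (h 0 1) * X) ^ (a - (i : ℕ)) *
        (C (h 1 0) + C (h 1 1) * X) ^ (i : ℕ) : ℂ[X]).coeff j * (rootChoose a j)⁻¹ := by
  rw [spinRep, Matrix.mul_assoc, Matrix.mul_apply]
  have : ∀ s : Qubits a, (dicke a)ᴴ i s * (tensorPow a h * dicke a) s j
      = (if weight s = (i : ℕ) then 1 else 0) * ((rootChoose a i)⁻¹ *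
      (((C (h 0 0) + C (h 0 1) * X) ^ (a - (i : ℕ)) *
        (C (h 1 0) + C (h 1 1) * X) ^ (i : ℕ) : ℂ[X]).coeff j * (rootChoose a j)⁻¹)) := by
    intro s
    rw [Matrix.conjTranspose_apply, star_dicke_apply, dicke_apply, tensorPow_mul_dicke_apply]
    split
    · rename_i hs; rw [hs, one_mul]
    · simp
  rw [Finset.sum_congr rfl fun s _ => this s, ← Finset.sum_mul, card_weight_eq, ← rootChoose_sq]
  have := rootChoose_ne_zero i
  field_simp

/-- The first row consists of the coefficients of (h₀₀ + h₀₁X)^a, up to nonzero normalisations, and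
none of these vanishes. -/
theorem spinRep_zero_apply_ne_zero {a : ℕ} {h : Matrix (Fin 2) (Fin 2) ℂ} (h0 : h 0 0 ≠ 0)
    (h1 : h 0 1 ≠ 0) (j : Spin a) : spinRep a h 0 j ≠ 0 := by
  rw [spinRep_apply]
  refine mul_ne_zero (mul_ne_zero (rootChoose_ne_zero 0) ?_) (inv_ne_zero (rootChoose_ne_zero j))
  simp only [Fin.val_zero, pow_zero, mul_one, tsub_zero]
  have e : (Polynomial.C (h 0 0) + Polynomial.C (h 0 1) * Polynomial.X) ^ a
      = ((Polynomial.X + Polynomial.C (h 0 0)) ^ a).comp (Polynomial.C (h 0 1) * Polynomial.X) := by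
    simp [add_comm]
  rw [e, Polynomial.comp_C_mul_X_coeff, Polynomial.coeff_X_add_C_pow]
  exact mul_ne_zero (mul_ne_zero (pow_ne_zero _ h0) (choose_ne_zero' j)) (pow_ne_zero _ h1)

theorem spinRep_apply_zero_ne_zero {a : ℕ} {h : Matrix (Fin 2) (Fin 2) ℂ} (h0 : h 0 0 ≠ 0)
    (h1 : h 1 0 ≠ 0) (i : Spin a) : spinRep a h i 0 ≠ 0 := by
  have h2 : spinRep a h i 0 = star (spinRep a hᴴ 0 i) := by
    rw [← spinRep_conjTranspose, Matrix.conjTranspose_apply, star_star]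
  rw [h2, star_ne_zero]
  exact spinRep_zero_apply_ne_zero (by simpa using h0) (by simpa using h1) i

theorem spinRep_diagonal {a : ℕ} (z w : ℂ) :
    spinRep a !![z, 0; 0, w] = Matrix.diagonal fun i : Spin a => z ^ (a - (i : ℕ)) * w ^ (i : ℕ) := by
  ext i j
  rw [spinRep_apply]
  simp only [Matrix.of_apply, Matrix.cons_val', Matrix.cons_val_zero, Matrix.cons_val_one,
    map_zero, zero_mul, add_zero, zero_add, mul_pow, Matrix.cons_val_fin_one]
  rw [← map_pow, ← map_pow, ← mul_assoc, ← map_mul, Polynomial.coeff_C_mul_X_pow]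
  rw [Matrix.diagonal_apply]
  by_cases h : i = j
  · subst h
    have := rootChoose_ne_zero i
    simp only [if_true]
    field_simp
  · rw [if_neg h, if_neg (fun h' => h (Fin.ext h'.symm))]
    simp

theorem spinRep_conjTranspose_mul {a : ℕ} {h : Matrix (Fin 2) (Fin 2) ℂ}
    (hh : h ∈ Matrix.specialUnitaryGroup (Fin 2) ℂ) : (spinRep a h)ᴴ * spinRep a h = 1 := by
  rw [spinRep_conjTranspose, spinRep_mul]
  have := Matrix.mem_unitaryGroup_iff'.1 (Matrix.mem_specialUnitaryGroup_iff.1 hh).1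
  rw [Matrix.star_eq_conjTranspose] at this
  rw [this, spinRep_one]

theorem spinRep_mul_conjTranspose {a : ℕ} {h : Matrix (Fin 2) (Fin 2) ℂ}
    (hh : h ∈ Matrix.specialUnitaryGroup (Fin 2) ℂ) : spinRep a h * (spinRep a h)ᴴ = 1 :=
  mul_eq_one_comm.1 (spinRep_conjTranspose_mul hh)

/-! ### The double cover -/

/-- The spin-1/2 unitary chosen to implement a rotation. -/
noncomputable def lift (g : SO3) : Matrix (Fin 2) (Fin 2) ℂ := (exists_implements g).choose

theorem lift_mem (g : SO3) : lift g ∈ Matrix.specialUnitaryGroup (Fin 2) ℂ :=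
  (exists_implements g).choose_spec.1

theorem implements_lift (g : SO3) : Implements (lift g) g.1 :=
  (exists_implements g).choose_spec.2

theorem rotation_eq (a : ℕ) (g : SO3) : rotation a g = spinRep a (lift g) := rfl

theorem conjTranspose_mul_of_mem {h : Matrix (Fin 2) (Fin 2) ℂ}
    (hh : h ∈ Matrix.specialUnitaryGroup (Fin 2) ℂ) : hᴴ * h = 1 ∧ h * hᴴ = 1 := by
  have h1 := (Matrix.mem_specialUnitaryGroup_iff.1 hh).1
  exact ⟨Matrix.mem_unitaryGroup_iff'.1 h1, Matrix.mem_unitaryGroup_iff.1 h1⟩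

theorem eq_smul_one_of_commute_pauli {u : Matrix (Fin 2) (Fin 2) ℂ}
    (hu : ∀ k, u * pauli k = pauli k * u) : u = u 0 0 • (1 : Matrix (Fin 2) (Fin 2) ℂ) := by
  have hx := hu 0
  have hz := hu 2
  have e01 := congrFun (congrFun hz 0) 1
  have e10 := congrFun (congrFun hz 1) 0
  have e11 := congrFun (congrFun hx 0) 1
  simp [pauli, Matrix.mul_apply, Fin.sum_univ_two] at e01 e10 e11
  ext i j
  fin_cases i <;> fin_cases j <;> simp <;> grind

/-- Two spin-1/2 unitaries implementing the same rotation agree up to a sign. -/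
theorem eq_or_eq_neg_of_implements {h h' : Matrix (Fin 2) (Fin 2) ℂ}
    (hh : h ∈ Matrix.specialUnitaryGroup (Fin 2) ℂ) (hh' : h' ∈ Matrix.specialUnitaryGroup (Fin 2) ℂ)
    {g : Matrix (Fin 3) (Fin 3) ℝ} (H : Implements h g) (H' : Implements h' g) :
    h = h' ∨ h = -h' := by
  obtain ⟨a1, a2⟩ := conjTranspose_mul_of_mem hh
  obtain ⟨b1, b2⟩ := conjTranspose_mul_of_mem hh'
  have hu : ∀ k, (h'ᴴ * h) * pauli k = pauli k * (h'ᴴ * h) := by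
    intro k
    have e : h * pauli k * hᴴ = h' * pauli k * h'ᴴ := (H k).trans (H' k).symm
    calc (h'ᴴ * h) * pauli k = h'ᴴ * (h * pauli k * hᴴ) * h := by
          simp only [Matrix.mul_assoc]; rw [a1, Matrix.mul_one]
      _ = (h'ᴴ * h') * pauli k * (h'ᴴ * h) := by rw [e]; simp only [Matrix.mul_assoc]
      _ = pauli k * (h'ᴴ * h) := by rw [b1, Matrix.one_mul]
  have hs := eq_smul_one_of_commute_pauli hu
  set z := (h'ᴴ * h) 0 0
  -- The product h'ᴴh is the scalar matrix z, so its determinant is z²; this forces z = ±1.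
  have hd : (h'ᴴ * h).det = 1 := by
    rw [Matrix.det_mul, Matrix.det_conjTranspose, (Matrix.mem_specialUnitaryGroup_iff.1 hh).2,
      (Matrix.mem_specialUnitaryGroup_iff.1 hh').2]
    simp
  rw [hs, Matrix.det_smul] at hd
  simp only [Fintype.card_fin, Matrix.det_one, mul_one] at hd
  have e : h = z • h' := by
    calc h = h' * (h'ᴴ * h) := by rw [← Matrix.mul_assoc, b2, Matrix.one_mul]
      _ = z • h' := by rw [hs]; simp
  rcases (sq_eq_sq_iff_eq_or_eq_neg.1 (hd.trans (one_pow 2).symm)) with hz | hz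
  · left; rw [e, hz, one_smul]
  · right; rw [e, hz, neg_one_smul]

/-- For spins of equal parity, the sign ambiguity is immaterial. -/
theorem rotation_mul_star_rotation {c c' : ℕ} (hc : Even (c + c')) {g : SO3}
    {h : Matrix (Fin 2) (Fin 2) ℂ} (hh : h ∈ Matrix.specialUnitaryGroup (Fin 2) ℂ)
    (H : Implements h g.1) (i j : Spin c) (k l : Spin c') :
    rotation c g i j * star (rotation c' g k l) = spinRep c h i j * star (spinRep c' h k l) := by
  rw [rotation_eq, rotation_eq]
  rcases eq_or_eq_neg_of_implements (lift_mem g) hh (implements_lift g) H with e | e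
  · rw [e]
  · rw [e, spinRep_neg, spinRep_neg]
    have := hc.neg_one_pow (α := ℂ)
    rw [pow_add] at this
    simp only [Matrix.smul_apply]
    simp
    linear_combination (spinRep c h i j * (starRingEnd ℂ) (spinRep c' h k l)) * this

theorem rotation_conjTranspose_mul (c : ℕ) (g : SO3) : (rotation c g)ᴴ * rotation c g = 1 :=
  spinRep_conjTranspose_mul (lift_mem g)

theorem rotation_mul_conjTranspose (c : ℕ) (g : SO3) : rotation c g * (rotation c g)ᴴ = 1 :=
  spinRep_mul_conjTranspose (lift_mem g)

theorem norm_rotation_apply_le (c : ℕ) (g : SO3) (i j : Spin c) : ‖rotation c g i j‖ ≤ 1 :=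
  entry_norm_bound_of_unitary (Matrix.mem_unitaryGroup_iff.2 (rotation_mul_conjTranspose c g)) i j

/-! ### Continuity -/

theorem exists_eq_pauli (X : Matrix (Fin 2) (Fin 2) ℂ) :
    ∃ (x : ℂ) (y : Fin 3 → ℂ), X = x • (1 : Matrix (Fin 2) (Fin 2) ℂ) + ∑ k, y k • pauli k := by
  refine ⟨(X 0 0 + X 1 1) / 2, ![(X 0 1 + X 1 0) / 2, Complex.I * (X 0 1 - X 1 0) / 2,
    (X 0 0 - X 1 1) / 2], ?_⟩
  have := Complex.I_sq
  ext i j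
  fin_cases i <;> fin_cases j <;> simp [pauli, Fin.sum_univ_three] <;> grind

/-- The product is the (i, k) entry of h E h†, where E is the matrix unit at (j, l). Expanding E in
the identity and the Pauli matrices makes this entry affine in the matrix g. The sign of the lift
cancels, although the lift itself need not be continuous. -/
theorem continuous_lift_mul_star (i j k l : Fin 2) :
    Continuous fun g : SO3 => lift g i j * star (lift g k l) := by
  obtain ⟨x, y, hX⟩ := exists_eq_pauli (Matrix.single j l (1 : ℂ))
  have : ∀ g : SO3, lift g i j * star (lift g k l) =
      x * (1 : Matrix (Fin 2) (Fin 2) ℂ) i k + ∑ m, y m * ∑ n, ((g.1 n m : ℝ) : ℂ) * pauli n i k := by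
    intro g
    have e : (lift g * Matrix.single j l (1 : ℂ) * (lift g)ᴴ) i k = lift g i j * star (lift g k l) := by
      simp [Matrix.mul_apply, Matrix.single_apply, Fin.sum_univ_two]
      fin_cases j <;> fin_cases l <;> simp
    rw [← e, hX, Matrix.mul_add, Matrix.add_mul, Matrix.mul_sum, Matrix.sum_mul]
    simp only [Matrix.mul_smul, Matrix.smul_mul, Matrix.mul_one,
      (conjTranspose_mul_of_mem (lift_mem g)).2, implements_lift g _]
    simp [Matrix.sum_apply]
  simp only [this]
  have hc : ∀ n m, Continuous fun g : SO3 => (g.1 n m : ℝ) := fun n m =>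
    (continuous_subtype_val).matrix_elem n m
  have hc' : ∀ n m, Continuous fun g : SO3 => ((g.1 n m : ℝ) : ℂ) := fun n m =>
    Complex.continuous_ofReal.comp (hc n m)
  exact continuous_const.add (continuous_finsetSum _ fun m _ => continuous_const.mul
    (continuous_finsetSum _ fun n _ => (hc' n m).mul continuous_const))

/-- Both factors are homogeneous of degree c in the entries of the lift, so the entries can be
matched into c pairs of the form entry times conjugate entry. -/
theorem continuous_rotation_mul_star (c : ℕ) (i j k l : Spin c) :
    Continuous fun g : SO3 => rotation c g i j * star (rotation c g k l) := by
  have : ∀ g : SO3, rotation c g i j * star (rotation c g k l) =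
      ∑ t' : Qubits c, ∑ s' : Qubits c, ∑ t : Qubits c, ∑ s : Qubits c,
        (star (dicke c s i) * dicke c t j * star (star (dicke c s' k) * dicke c t' l)) *
          ∏ m, (lift g (s m) (t m) * star (lift g (s' m) (t' m))) := by
    intro g
    simp only [rotation_eq, spinRep, Matrix.mul_apply, Matrix.conjTranspose_apply, tensorPow,
      Matrix.of_apply, star_sum, star_mul', star_star, star_prod, Finset.sum_mul, Finset.mul_sum,
      Finset.prod_mul_distrib]
    refine Finset.sum_congr rfl fun t _ => Finset.sum_congr rfl fun s _ =>
      Finset.sum_congr rfl fun t' _ => Finset.sum_congr rfl fun s' _ => ?_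
    ring
  simp only [this]
  refine continuous_finsetSum _ fun _ _ => continuous_finsetSum _ fun _ _ =>
    continuous_finsetSum _ fun _ _ => continuous_finsetSum _ fun _ _ =>
    continuous_const.mul (continuous_finsetProd _ fun _ _ => continuous_lift_mul_star _ _ _ _)

theorem integrable_of_continuous_of_bound [MeasurableSpace SO3] [BorelSpace SO3]
    (μ : Measure SO3) [IsFiniteMeasure μ] {f : SO3 → ℂ} (hf : Continuous f) (C : ℝ)
    (hC : ∀ g, ‖f g‖ ≤ C) : Integrable f μ :=
  Integrable.of_bound hf.aestronglyMeasurable C (Filter.Eventually.of_forall hC)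

/-! ### Explicit rotations -/

/-- The rotation around the `z` axis, as an element of `SO(3)`. -/
noncomputable def rotZSO (t : ℝ) : SO3 :=
  ⟨rotZ t, Matrix.mem_specialOrthogonalGroup_iff.2
    ⟨(Matrix.mem_orthogonalGroup_iff _ _).2 (rotZ_transpose_mul t).2, det_rotZ t⟩⟩

/-- The rotation around the `y` axis, as an element of `SO(3)`. -/
noncomputable def rotYSO (t : ℝ) : SO3 :=
  ⟨rotY t, Matrix.mem_specialOrthogonalGroup_iff.2
    ⟨(Matrix.mem_orthogonalGroup_iff _ _).2 (rotY_transpose_mul t).2, det_rotY t⟩⟩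

/-- The diagonal exponential form makes `spinRep` diagonal, with the phases of the z component of
the angular momentum. -/
theorem implements_rotZ (t : ℝ) :
    !![Complex.exp (-(t / 2 * Complex.I)), 0; 0, Complex.exp (t / 2 * Complex.I)] ∈
        Matrix.specialUnitaryGroup (Fin 2) ℂ ∧
      Implements !![Complex.exp (-(t / 2 * Complex.I)), 0; 0, Complex.exp (t / 2 * Complex.I)]
        (rotZ t) := by
  have h1 : (Real.cos (t / 2) : ℂ) ^ 2 + (Real.sin (t / 2) : ℂ) ^ 2 = 1 := by
    exact_mod_cast Real.cos_sq_add_sin_sq (t / 2)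
  have hc : (Real.cos t : ℂ) = (Real.cos (t / 2) : ℂ) ^ 2 - (Real.sin (t / 2) : ℂ) ^ 2 := by
    have := Real.cos_two_mul' (t / 2)
    rw [mul_div_cancel₀ t two_ne_zero] at this
    exact_mod_cast this
  have hs : (Real.sin t : ℂ) = 2 * (Real.sin (t / 2) : ℂ) * (Real.cos (t / 2) : ℂ) := by
    have := Real.sin_two_mul (t / 2)
    rw [mul_div_cancel₀ t two_ne_zero] at this
    exact_mod_cast this
  have hI := Complex.I_sq
  have e1 : Complex.exp (t / 2 * Complex.I) =
      (Real.cos (t / 2) : ℂ) + (Real.sin (t / 2) : ℂ) * Complex.I := by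
    rw [Complex.exp_mul_I]; push_cast; rfl
  have e2 : Complex.exp (-(t / 2 * Complex.I)) =
      (Real.cos (t / 2) : ℂ) - (Real.sin (t / 2) : ℂ) * Complex.I := by
    rw [← neg_mul, Complex.exp_mul_I, Complex.cos_neg, Complex.sin_neg]; push_cast; ring
  rw [e1, e2]
  generalize Real.cos (t / 2) = c at *
  generalize Real.sin (t / 2) = s at *
  constructor
  · rw [Matrix.mem_specialUnitaryGroup_iff, Matrix.mem_unitaryGroup_iff]
    refine ⟨?_, ?_⟩
    · ext i j
      fin_cases i <;> fin_cases j <;>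
        simp [Matrix.mul_apply, Fin.sum_univ_two, Matrix.star_apply] <;> grind
    · rw [Matrix.det_fin_two_of]; grind
  · intro k
    ext i j
    fin_cases k <;> fin_cases i <;> fin_cases j <;>
      simp [pauli, rotZ, Matrix.mul_apply, Fin.sum_univ_two, Fin.sum_univ_three,
        -Complex.ofReal_cos, -Complex.ofReal_sin] <;> grind

/-- The quarter turn around the y axis has all entries of modulus 1/√2. Together with the rotations
around z, it is all that Schur's lemma needs below. -/
theorem exists_implements_entries_ne_zero : ∃ (g : SO3) (h : Matrix (Fin 2) (Fin 2) ℂ),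
    h ∈ Matrix.specialUnitaryGroup (Fin 2) ℂ ∧ Implements h g.1 ∧
      h 0 0 ≠ 0 ∧ h 0 1 ≠ 0 ∧ h 1 0 ≠ 0 := by
  obtain ⟨r, hr⟩ : ∃ r : ℂ, r ^ 2 = 1 / 2 ∧ star r = r := by
    refine ⟨((√(1 / 2) : ℝ) : ℂ), ?_, by simp⟩
    rw [← Complex.ofReal_pow, Real.sq_sqrt (by norm_num)]; norm_num
  have hr0 : r ≠ 0 := by rintro rfl; norm_num at hr
  have hr2 : (starRingEnd ℂ) r = r := hr.2
  have hr1 := hr.1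
  refine ⟨rotYSO (Real.pi / 2), !![r, -r; r, r], ?_, ?_, by simpa using hr0, by simpa using hr0,
    by simpa using hr0⟩
  · rw [Matrix.mem_specialUnitaryGroup_iff, Matrix.mem_unitaryGroup_iff]
    refine ⟨?_, ?_⟩
    · ext i j
      fin_cases i <;> fin_cases j <;>
        simp [Matrix.mul_apply, Fin.sum_univ_two, Matrix.star_apply, hr2] <;> grind
    · rw [Matrix.det_fin_two_of]; grind
  · have hI := Complex.I_sq
    intro k
    ext i j
    fin_cases k <;> fin_cases i <;> fin_cases j <;>
      simp [pauli, rotYSO, rotY, Matrix.mul_apply, Fin.sum_univ_two, Fin.sum_univ_three, hr2] <;>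
      grind

/-! ### Schur's lemma and orthogonality -/

section Schur

variable {c c' : ℕ} {Y : Matrix (Spin c) (Spin c') ℂ}

/-- Invariance is assumed for the chosen lifts. Since c + c' is even the sign of a lift is
immaterial, so the relation passes to any convenient explicit h. -/
theorem spinRep_mul_eq_of_invariant (hc : Even (c + c'))
    (hY : ∀ g, rotation c g * Y * (rotation c' g)ᴴ = Y) {g : SO3} {h : Matrix (Fin 2) (Fin 2) ℂ}
    (hh : h ∈ Matrix.specialUnitaryGroup (Fin 2) ℂ) (H : Implements h g.1) :
    spinRep c h * Y = Y * spinRep c' h := by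
  have e : spinRep c h * Y * (spinRep c' h)ᴴ = Y := by
    -- The net effect of these three rewrites is to expand `Y` on the right-hand side only.
    rw [← hY g]
    nth_rw 2 [← hY g]
    rw [hY g]
    ext i k
    simp only [Matrix.mul_apply, Matrix.conjTranspose_apply, Finset.sum_mul]
    refine Finset.sum_congr rfl fun l _ => Finset.sum_congr rfl fun j _ => ?_
    have := rotation_mul_star_rotation hc hh H i j k l
    linear_combination (-Y j l) * this
  calc spinRep c h * Y = spinRep c h * Y * ((spinRep c' h)ᴴ * spinRep c' h) := by
        rw [spinRep_conjTranspose_mul hh, Matrix.mul_one]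
    _ = Y * spinRep c' h := by rw [← Matrix.mul_assoc, e]

/-- Invariant operators preserve the `z` component of the angular momentum. -/
theorem apply_eq_zero_of_invariant (hc : Even (c + c'))
    (hY : ∀ g, rotation c g * Y * (rotation c' g)ᴴ = Y) (i : Spin c) (j : Spin c')
    (hij : c + 2 * (j : ℕ) ≠ c' + 2 * (i : ℕ)) : Y i j = 0 := by
  set d : ℝ := (c : ℝ) + 2 * (j : ℕ) - (c' + 2 * (i : ℕ)) with hd
  have hd0 : d ≠ 0 := by
    intro h
    apply hij
    have : (c : ℝ) + 2 * (j : ℕ) = c' + 2 * (i : ℕ) := by linarith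
    exact_mod_cast this
  -- With this angle the phases acting on the left and on the right of the entry differ by the
  -- factor exp(-iπ) = -1, so the entry must vanish.
  obtain ⟨hm, hi⟩ := implements_rotZ (2 * Real.pi / d)
  have e := spinRep_mul_eq_of_invariant hc hY (g := rotZSO (2 * Real.pi / d)) hm hi
  rw [spinRep_diagonal, spinRep_diagonal] at e
  have e := congrFun (congrFun e i) j
  rw [Matrix.diagonal_mul, Matrix.mul_diagonal] at e
  by_contra hne
  rw [mul_comm] at e
  have e := mul_left_cancel₀ hne e
  simp only [← Complex.exp_nat_mul, ← Complex.exp_add] at e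
  have hi' : (i : ℕ) ≤ c := Nat.le_of_lt_succ i.2
  have hj' : (j : ℕ) ≤ c' := Nat.le_of_lt_succ j.2
  rw [Complex.exp_eq_exp_iff_exp_sub_eq_one, Nat.cast_sub hi', Nat.cast_sub hj'] at e
  have hd' : (d : ℂ) ≠ 0 := by exact_mod_cast hd0
  have e2 : (((c : ℂ) - (i : ℕ)) * -(((2 * Real.pi / d : ℝ) : ℂ) / 2 * Complex.I)
      + (i : ℕ) * (((2 * Real.pi / d : ℝ) : ℂ) / 2 * Complex.I)
      - (((c' : ℂ) - (j : ℕ)) * -(((2 * Real.pi / d : ℝ) : ℂ) / 2 * Complex.I)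
      + (j : ℕ) * (((2 * Real.pi / d : ℝ) : ℂ) / 2 * Complex.I))) = -(Real.pi * Complex.I) := by
    have : (d : ℂ) = (c : ℂ) + 2 * (j : ℕ) - (c' + 2 * (i : ℕ)) := by rw [hd]; push_cast; ring
    push_cast
    field_simp
    rw [this]
    ring
  rw [e2, Complex.exp_neg, Complex.exp_pi_mul_I] at e
  norm_num at e

/-- Schur's lemma for distinct spins, by highest weights: the extreme vector of the larger spin has
no partner in the smaller one, so `Y` vanishes there, and one rotation with no zero in the
corresponding row or column carries this to all entries. -/
theorem eq_zero_of_invariant_of_ne (hc : Even (c + c')) (hne : c ≠ c')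
    (hY : ∀ g, rotation c g * Y * (rotation c' g)ᴴ = Y) : Y = 0 := by
  obtain ⟨g, h, hh, H, h00, h01, h10⟩ := exists_implements_entries_ne_zero
  have e := spinRep_mul_eq_of_invariant hc hY hh H
  have hz := apply_eq_zero_of_invariant hc hY
  ext i j
  by_cases hij : c + 2 * (j : ℕ) = c' + 2 * (i : ℕ)
  swap
  · exact hz i j hij
  rw [Matrix.zero_apply]
  rcases lt_or_gt_of_ne hne with hlt | hlt
  -- Column 0 of `Y` has m = c'/2, which exceeds every m of spin c/2 and so is zero. On the
  -- right-hand side only the index j survives in the sum.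
  · have e := congrFun (congrFun e i) 0
    rw [Matrix.mul_apply, Matrix.mul_apply, Finset.sum_eq_zero, Finset.sum_eq_single j] at e
    · exact (mul_eq_zero.1 e.symm).resolve_right (spinRep_apply_zero_ne_zero h00 h10 j)
    · intro k _ hk
      rw [hz i k, zero_mul]
      intro h; apply hk; ext; omega
    · simp
    · intro k _
      rw [hz k 0, mul_zero]
      rw [Fin.val_zero]; omega
  · have e := congrFun (congrFun e 0) j
    rw [Matrix.mul_apply, Matrix.mul_apply, Finset.sum_eq_single i, Finset.sum_eq_zero] at e
    · exact (mul_eq_zero.1 e).resolve_left (spinRep_zero_apply_ne_zero h00 h01 i)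
    · intro k _
      rw [hz 0 k, zero_mul]
      rw [Fin.val_zero]; omega
    · intro k _ hk
      rw [hz k j, mul_zero]
      intro h; apply hk; ext; omega
    · simp

end Schur

/-- Weights make `Y` diagonal. Comparing the entries (i, 0) of the intertwining relation, where
`spinRep` is nonzero, shows that all diagonal entries agree. -/
theorem eq_smul_one_of_invariant {c : ℕ} {Y : Matrix (Spin c) (Spin c) ℂ}
    (hY : ∀ g, rotation c g * Y * (rotation c g)ᴴ = Y) : Y = Y 0 0 • 1 := by
  obtain ⟨g, h, hh, H, h00, h01, h10⟩ := exists_implements_entries_ne_zero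
  have hc : Even (c + c) := ⟨c, rfl⟩
  have e := spinRep_mul_eq_of_invariant hc hY hh H
  have hz := apply_eq_zero_of_invariant hc hY
  have hz' : ∀ i j, i ≠ j → Y i j = 0 := fun i j hij => hz i j fun h => hij (Fin.ext (by omega))
  ext i j
  by_cases hij : i = j
  · subst hij
    have e := congrFun (congrFun e i) 0
    rw [Matrix.mul_apply, Matrix.mul_apply, Finset.sum_eq_single 0, Finset.sum_eq_single i] at e
    · rw [mul_comm] at e
      simp [mul_right_cancel₀ (spinRep_apply_zero_ne_zero h00 h10 i) e]
    · intro k _ hk; rw [hz' i k hk.symm, zero_mul]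
    · simp
    · intro k _ hk; rw [hz' k 0 hk, mul_zero]
    · simp
  · simp [hz' i j hij, hij]

section Orthogonality

variable [MeasurableSpace SO3] [BorelSpace SO3] (μ : Measure SO3)

/-- Left invariance of Haar measure makes the average of U_g E U'_g† an intertwiner. Integrability
is a hypothesis because for c ≠ c' it is obtained only later, from products of entries of `pairRep`.
-/
theorem integral_invariant [μ.IsHaarMeasure] {c c' : ℕ} (hc : Even (c + c'))
    (hI : ∀ i j k l, Integrable (fun g => rotation c g i j * star (rotation c' g k l)) μ)
    (j : Spin c) (l : Spin c') (g₀ : SO3) :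
    rotation c g₀ * (Matrix.of fun i k => ∫ g, rotation c g i j * star (rotation c' g k l) ∂μ) *
      (rotation c' g₀)ᴴ = Matrix.of fun i k => ∫ g, rotation c g i j * star (rotation c' g k l) ∂μ := by
  ext i k
  rw [Matrix.of_apply,
    ← integral_mul_left_eq_self (fun g => rotation c g i j * star (rotation c' g k l)) g₀]
  have e : ∀ g, rotation c (g₀ * g) i j * star (rotation c' (g₀ * g) k l) =
      ∑ q, ∑ p, (rotation c g₀ i p * star (rotation c' g₀ k q)) *
        (rotation c g p j * star (rotation c' g q l)) := by
    intro g
    rw [rotation_mul_star_rotation hc (mul_mem (lift_mem g₀) (lift_mem g))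
      (implements_mul (implements_lift g₀) (implements_lift g)), ← spinRep_mul, ← spinRep_mul,
      Matrix.mul_apply, Matrix.mul_apply, star_sum, Finset.mul_sum]
    refine Finset.sum_congr rfl fun q _ => ?_
    rw [Finset.sum_mul]
    refine Finset.sum_congr rfl fun p _ => ?_
    rw [star_mul', rotation_eq, rotation_eq, rotation_eq, rotation_eq]
    ring
  simp only [e]
  rw [integral_finsetSum _ fun q _ => integrable_finsetSum _ fun p _ => (hI p j q l).const_mul _,
    Matrix.mul_apply]
  refine Finset.sum_congr rfl fun q _ => ?_
  rw [integral_finsetSum _ fun p _ => (hI p j q l).const_mul _, Matrix.mul_apply, Finset.sum_mul]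
  refine Finset.sum_congr rfl fun p _ => ?_
  rw [integral_const_mul, Matrix.of_apply, Matrix.conjTranspose_apply]
  ring

theorem integral_rotation_of_ne [μ.IsHaarMeasure] {c c' : ℕ} (hc : Even (c + c')) (hne : c ≠ c')
    (hI : ∀ i j k l, Integrable (fun g => rotation c g i j * star (rotation c' g k l)) μ)
    (i j : Spin c) (k l : Spin c') :
    ∫ g, rotation c g i j * star (rotation c' g k l) ∂μ = 0 :=
  congrFun (congrFun (eq_zero_of_invariant_of_ne hc hne (integral_invariant μ hc hI j l)) i) k

theorem integrable_rotation [IsProbabilityMeasure μ] (c : ℕ) (i j k l : Spin c) :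
    Integrable (fun g => rotation c g i j * star (rotation c g k l)) μ := by
  refine integrable_of_continuous_of_bound μ (continuous_rotation_mul_star c i j k l) 1 fun g => ?_
  rw [norm_mul, norm_star]
  exact mul_le_one₀ (norm_rotation_apply_le c g i j) (norm_nonneg _) (norm_rotation_apply_le c g k l)

/-- By Schur's lemma the average is a scalar matrix. Its trace is the entry (l, j) of U†U = 1, and
dividing by the dimension gives the scalar. -/
theorem integral_rotation [μ.IsHaarMeasure] [IsProbabilityMeasure μ] (c : ℕ) (i j k l : Spin c) :
    ∫ g, rotation c g i j * star (rotation c g k l) ∂μ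
      = if i = k ∧ j = l then ((c : ℂ) + 1)⁻¹ else 0 := by
  have hY := eq_smul_one_of_invariant
    (integral_invariant μ ⟨c, rfl⟩ (integrable_rotation μ c) j l)
  set z := (Matrix.of fun i k => ∫ g, rotation c g i j * star (rotation c g k l) ∂μ) 0 0
  have hent : ∀ i k, ∫ g, rotation c g i j * star (rotation c g k l) ∂μ
      = z * (1 : Matrix (Spin c) (Spin c) ℂ) i k := fun i k => by
    simpa using congrFun (congrFun hY i) k
  have htr : ∑ i, ∫ g, rotation c g i j * star (rotation c g i l) ∂μ
      = (1 : Matrix (Spin c) (Spin c) ℂ) l j := by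
    rw [← integral_finsetSum _ fun i _ => integrable_rotation μ c i j i l]
    have : ∀ g, ∑ i, rotation c g i j * star (rotation c g i l)
        = (1 : Matrix (Spin c) (Spin c) ℂ) l j := by
      intro g
      rw [← rotation_conjTranspose_mul c g, Matrix.mul_apply]
      exact Finset.sum_congr rfl fun i _ => by rw [Matrix.conjTranspose_apply, mul_comm]
    rw [integral_congr_ae (Filter.Eventually.of_forall this)]
    simp
  simp only [hent, Matrix.one_apply_eq, mul_one, Finset.sum_const, Finset.card_univ,
    Fintype.card_fin, nsmul_eq_mul] at htr
  have hc : (c : ℂ) + 1 ≠ 0 := by exact_mod_cast Nat.succ_ne_zero c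
  rw [hent]
  push_cast at htr
  have hz : z = (1 : Matrix (Spin c) (Spin c) ℂ) l j * ((c : ℂ) + 1)⁻¹ := by
    rw [← htr]; field_simp
  rw [hz]
  simp only [Matrix.one_apply, eq_comm (a := l)]
  by_cases h1 : i = k <;> by_cases h2 : j = l <;> simp [h1, h2]

end Orthogonality

/-! ### Clebsch–Gordan decomposition -/

theorem sum_append {R : Type*} [AddCommMonoid R] (m n : ℕ) (f : Qubits (m + n) → R) :
    ∑ s, f s = ∑ u : Qubits m, ∑ v : Qubits n, f (Fin.append u v) := by
  rw [← Fintype.sum_prod_type' fun u v => f (Fin.append u v)]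
  exact ((Fin.appendEquiv m n).sum_comp f).symm

theorem exists_append {m n : ℕ} (s : Qubits (m + n)) :
    ∃ (u : Qubits m) (v : Qubits n), s = Fin.append u v :=
  ⟨_, _, (Fin.append_castAdd_natAdd (f := s)).symm⟩

/-- The two-qubit singlet, as a matrix. -/
noncomputable def singlet : Matrix (Fin 2) (Fin 2) ℂ := !![0, 1; -1, 0]

/-- For every 2 × 2 matrix, h ε hᵀ = (det h) ε, where ε denotes the singlet. -/
theorem mul_singlet_mul_transpose {h : Matrix (Fin 2) (Fin 2) ℂ} (hd : h.det = 1) :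
    h * singlet * hᵀ = singlet := by
  rw [Matrix.det_fin_two] at hd
  ext i j
  fin_cases i <;> fin_cases j <;>
    simp [singlet, Matrix.mul_apply, Fin.sum_univ_two] <;>
    first | ring1 | linear_combination hd | linear_combination -hd

/-- Adjoin `n` singlets, shared between the two parts of a bipartite system of `p + q` qubits. -/
noncomputable def adjoinSinglets (p q n : ℕ) : Matrix (Qubits (p + n) × Qubits (q + n)) (Qubits (p + q)) ℂ :=
  Matrix.of fun x r =>
    (1 : Matrix (Qubits p) (Qubits p) ℂ) (x.1 ∘ Fin.castAdd n) (r ∘ Fin.castAdd q) *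
    (1 : Matrix (Qubits q) (Qubits q) ℂ) (x.2 ∘ Fin.castAdd n) (r ∘ Fin.natAdd p) *
    tensorPow n singlet (x.1 ∘ Fin.natAdd p) (x.2 ∘ Fin.natAdd q)

theorem append_comp_castAdd {m n : ℕ} (u : Qubits m) (v : Qubits n) :
    Fin.append u v ∘ Fin.castAdd n = u := by ext; simp

theorem append_comp_natAdd {m n : ℕ} (u : Qubits m) (v : Qubits n) :
    Fin.append u v ∘ Fin.natAdd m = v := by ext; simp

theorem adjoinSinglets_append {p q n : ℕ} (s₁ r₁ : Qubits p) (t₁ r₂ : Qubits q) (s₂ t₂ : Qubits n) :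
    adjoinSinglets p q n (Fin.append s₁ s₂, Fin.append t₁ t₂) (Fin.append r₁ r₂) =
      (1 : Matrix (Qubits p) (Qubits p) ℂ) s₁ r₁ * (1 : Matrix (Qubits q) (Qubits q) ℂ) t₁ r₂ *
        tensorPow n singlet s₂ t₂ := by
  change (1 : Matrix (Qubits p) (Qubits p) ℂ) (Fin.append s₁ s₂ ∘ Fin.castAdd n)
      (Fin.append r₁ r₂ ∘ Fin.castAdd q) *
    (1 : Matrix (Qubits q) (Qubits q) ℂ) (Fin.append t₁ t₂ ∘ Fin.castAdd n)
      (Fin.append r₁ r₂ ∘ Fin.natAdd p) *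
    tensorPow n singlet (Fin.append s₁ s₂ ∘ Fin.natAdd p) (Fin.append t₁ t₂ ∘ Fin.natAdd q) = _
  rw [append_comp_castAdd, append_comp_castAdd, append_comp_castAdd, append_comp_natAdd, append_comp_natAdd,
    append_comp_natAdd]

/-- The n adjoined singlets are invariant under h ⊗ h, so only the p + q original qubits feel h. -/
theorem tensorPow_mul_adjoinSinglets (p q n : ℕ) {h : Matrix (Fin 2) (Fin 2) ℂ} (hd : h.det = 1) :
    (tensorPow (p + n) h ⊗ₖ tensorPow (q + n) h) * adjoinSinglets p q n =
      adjoinSinglets p q n * tensorPow (p + q) h := by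
  ext ⟨s, t⟩ r
  obtain ⟨s₁, s₂, rfl⟩ := exists_append s
  obtain ⟨t₁, t₂, rfl⟩ := exists_append t
  obtain ⟨r₁, r₂, rfl⟩ := exists_append r
  have hs : tensorPow n singlet s₂ t₂ =
      ∑ y, (∑ x, tensorPow n h s₂ x * tensorPow n singlet x y) * tensorPow n h t₂ y := by
    conv_lhs => rw [← mul_singlet_mul_transpose hd, ← tensorPow_mul, ← tensorPow_mul]
    rfl
  have hL : ((tensorPow (p + n) h ⊗ₖ tensorPow (q + n) h) * adjoinSinglets p q n)
      (Fin.append s₁ s₂, Fin.append t₁ t₂) (Fin.append r₁ r₂) =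
      tensorPow p h s₁ r₁ * tensorPow q h t₁ r₂ * tensorPow n singlet s₂ t₂ := by
    simp only [Matrix.mul_apply, Fintype.sum_prod_type, sum_append, Matrix.kroneckerMap_apply,
      adjoinSinglets_append, tensorPow_append]
    rw [Finset.sum_eq_single r₁]
    · have : ∀ x : Qubits n, (∑ t : Qubits q, ∑ y : Qubits n,
          tensorPow p h s₁ r₁ * tensorPow n h s₂ x * (tensorPow q h t₁ t * tensorPow n h t₂ y) *
          ((1 : Matrix (Qubits p) (Qubits p) ℂ) r₁ r₁ * (1 : Matrix (Qubits q) (Qubits q) ℂ) t r₂ *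
            tensorPow n singlet x y)) = ∑ y : Qubits n, tensorPow p h s₁ r₁ * tensorPow q h t₁ r₂ *
            (tensorPow n h s₂ x * tensorPow n singlet x y * tensorPow n h t₂ y) := by
        intro x
        rw [Finset.sum_eq_single r₂]
        · refine Finset.sum_congr rfl fun y _ => ?_
          rw [Matrix.one_apply_eq, Matrix.one_apply_eq]; ring
        · intro t _ ht
          simp [Matrix.one_apply_ne ht]
        · simp
      rw [Finset.sum_congr rfl fun x _ => this x, Finset.sum_comm, hs, Finset.mul_sum]
      refine Finset.sum_congr rfl fun y _ => ?_
      rw [Finset.sum_mul, Finset.mul_sum]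
    · intro x _ hx
      simp [Matrix.one_apply_ne hx]
    · simp
  rw [hL]
  simp only [Matrix.mul_apply, sum_append, adjoinSinglets_append, tensorPow_append]
  rw [Finset.sum_eq_single s₁, Finset.sum_eq_single t₁]
  · rw [Matrix.one_apply_eq, Matrix.one_apply_eq]; ring
  · intro x _ hx
    simp [Matrix.one_apply_ne hx.symm]
  · simp
  · intro x _ hx
    simp [Matrix.one_apply_ne hx.symm]
  · simp

/-- The (unnormalised) embedding of a spin `(p+q)/2` into the product of two spins. -/
noncomputable def coupling (p q n : ℕ) : Matrix (Spin (p + n) × Spin (q + n)) (Spin (p + q)) ℂ :=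
  ((dicke (p + n))ᴴ ⊗ₖ (dicke (q + n))ᴴ) * adjoinSinglets p q n * dicke (p + q)

theorem spinRep_mul_coupling (p q n : ℕ) {h : Matrix (Fin 2) (Fin 2) ℂ} (hd : h.det = 1) :
    (spinRep (p + n) h ⊗ₖ spinRep (q + n) h) * coupling p q n =
      coupling p q n * spinRep (p + q) h := by
  rw [coupling, Matrix.mul_assoc _ (dicke (p + q)), dicke_mul_spinRep, ← Matrix.mul_assoc,
    ← Matrix.mul_assoc, ← Matrix.mul_kronecker_mul, spinRep_mul_dicke, spinRep_mul_dicke,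
    Matrix.mul_kronecker_mul, Matrix.mul_assoc _ _ (adjoinSinglets p q n),
    tensorPow_mul_adjoinSinglets p q n hd, ← Matrix.mul_assoc, ← Matrix.mul_assoc]

theorem dicke_apply_zero {a : ℕ} (s : Qubits a) : dicke a s 0 = if s = 0 then 1 else 0 := by
  rw [dicke_apply]
  have h1 : rootChoose a ((0 : Spin a) : ℕ) = 1 := by simp [rootChoose]
  rw [h1, inv_one]
  refine if_congr ?_ rfl rfl
  rw [Fin.val_zero]
  constructor
  · intro h
    rw [weight, Finset.sum_eq_zero_iff] at h
    ext k
    simpa using h k (Finset.mem_univ k)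
  · rintro rfl
    simp [weight]

/-- Starting from the vector with all entries 0, and with the first spin projected on its extreme
vector, only the term 0 ⊗ 1 of each singlet survives. No cancellation can occur. -/
theorem coupling_apply_ne_zero (p q n : ℕ) :
    coupling p q n (0, ⟨n, by omega⟩) 0 ≠ 0 := by
  have h0 : ∀ m k : ℕ, (0 : Qubits (m + k)) = Fin.append (0 : Qubits m) (0 : Qubits k) := by
    intro m k
    ext j
    refine Fin.addCases (fun j => ?_) (fun j => ?_) j <;> simp
  have hs : ∀ t : Qubits n, tensorPow n singlet 0 t = if t = 1 then 1 else 0 := by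
    intro t
    simp only [tensorPow, Matrix.of_apply, Pi.zero_apply]
    have : ∀ j : Fin 2, singlet 0 j = if j = 1 then 1 else 0 := by
      intro j; fin_cases j <;> simp [singlet]
    simp only [this, Finset.prod_boole, funext_iff, Finset.mem_univ, forall_true_left, Pi.one_apply]
  have hw : weight (Fin.append (0 : Qubits q) (1 : Qubits n) : Qubits (q + n)) = n := by
    rw [weight_append]; simp [weight]
  have e : coupling p q n (0, ⟨n, by omega⟩) 0 = (rootChoose (q + n) n)⁻¹ := by
    rw [coupling, Matrix.mul_apply, Finset.sum_eq_single 0]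
    · rw [dicke_apply_zero, if_pos rfl, mul_one, Matrix.mul_apply, Fintype.sum_prod_type,
        Finset.sum_eq_single 0]
      · simp only [Matrix.kroneckerMap_apply, Matrix.conjTranspose_apply, star_dicke_apply]
        simp only [dicke_apply_zero, if_true, one_mul]
        rw [sum_append, Finset.sum_eq_single 0, Finset.sum_eq_single 1]
        · rw [h0 p n, h0 p q, adjoinSinglets_append, hs, dicke_apply, hw]
          simp
        · intro t _ ht
          rw [h0 p n, h0 p q, adjoinSinglets_append, hs, if_neg ht, mul_zero, mul_zero]
        · simp
        · intro t _ ht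
          refine Finset.sum_eq_zero fun t' _ => ?_
          rw [h0 p n, h0 p q, adjoinSinglets_append, Matrix.one_apply_ne ht]
          simp
        · simp
      · intro s _ hs
        refine Finset.sum_eq_zero fun t _ => ?_
        simp only [Matrix.kroneckerMap_apply, Matrix.conjTranspose_apply, star_dicke_apply]
        simp only [dicke_apply_zero, if_neg hs, zero_mul]
      · simp
    · intro s _ hs
      rw [dicke_apply_zero, if_neg hs, mul_zero]
    · simp
  rw [e]
  exact inv_ne_zero (rootChoose_ne_zero (⟨n, by omega⟩ : Spin (q + n)))

/-! ### Self-duality of the spin representations and intertwiners -/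

theorem singlet_mem : singlet ∈ Matrix.specialUnitaryGroup (Fin 2) ℂ := by
  rw [Matrix.mem_specialUnitaryGroup_iff, Matrix.mem_unitaryGroup_iff]
  refine ⟨?_, by simp [singlet, Matrix.det_fin_two]⟩
  ext i j
  fin_cases i <;> fin_cases j <;>
    simp [singlet, Matrix.mul_apply, Fin.sum_univ_two, Matrix.star_apply]

theorem spinRep_map_star {a : ℕ} (h : Matrix (Fin 2) (Fin 2) ℂ) :
    (spinRep a h).map star = spinRep a (h.map star) := by
  have hd : (dicke a).map star = dicke a := by ext s i; exact star_dicke_apply a s i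
  ext i j
  simp only [spinRep, Matrix.map_apply, Matrix.mul_apply, star_sum, star_mul',
    Matrix.conjTranspose_apply, star_dicke_apply, tensorPow, Matrix.of_apply, star_prod]

/-- The singlet matrix conjugates the defining representation of SU(2) into its complex conjugate.
This turns couplings of two spins into couplings of a spin with a conjugate spin. -/
theorem map_star_mul_singlet {h : Matrix (Fin 2) (Fin 2) ℂ}
    (hh : h ∈ Matrix.specialUnitaryGroup (Fin 2) ℂ) : h.map star * singlet = singlet * h := by
  have h1 := mul_singlet_mul_transpose (Matrix.mem_specialUnitaryGroup_iff.1 hh).2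
  have h2 : (hᴴ * h)ᵀ = 1 := by rw [(conjTranspose_mul_of_mem hh).1, Matrix.transpose_one]
  have h3 : hᵀ * h.map star = 1 := by
    rw [← h2, Matrix.transpose_mul]; rfl
  have h4 : h * singlet = singlet * h.map star := by
    calc h * singlet = h * singlet * (hᵀ * h.map star) := by rw [h3, Matrix.mul_one]
      _ = singlet * h.map star := by rw [← Matrix.mul_assoc, h1]
  have h5 : singlet * singlet = -1 := by
    ext i j; fin_cases i <;> fin_cases j <;> simp [singlet, Matrix.mul_apply, Fin.sum_univ_two]
  have h6 : singlet * (h * singlet) * singlet = singlet * (singlet * h.map star) * singlet := by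
    rw [h4]
  rw [← Matrix.mul_assoc singlet singlet, h5, Matrix.mul_assoc, Matrix.mul_assoc h, h5] at h6
  simpa using h6.symm

/-- The representation of `SU(2)` on a spin `b/2` and the conjugate of a spin `a/2`. -/
noncomputable def pairRep (b a : ℕ) (h : Matrix (Fin 2) (Fin 2) ℂ) :
    Matrix (Spin b × Spin a) (Spin b × Spin a) ℂ := spinRep b h ⊗ₖ (spinRep a h).map star

theorem pairRep_mul_conjTranspose (b a : ℕ) {h : Matrix (Fin 2) (Fin 2) ℂ}
    (hh : h ∈ Matrix.specialUnitaryGroup (Fin 2) ℂ) :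
    pairRep b a h * (pairRep b a h)ᴴ = 1 := by
  have : (spinRep a h).map star * ((spinRep a h).map star)ᴴ = 1 := by
    have e := congrArg (fun X => X.map star) (spinRep_mul_conjTranspose (a := a) hh)
    have e2 : ((spinRep a h * (spinRep a h)ᴴ).map star) =
        (spinRep a h).map star * ((spinRep a h).map star)ᴴ := by
      ext i j
      simp [Matrix.mul_apply]
    rw [← e2, e]
    ext i j
    simp [Matrix.one_apply, apply_ite]
  rw [pairRep, Matrix.conjTranspose_kronecker, ← Matrix.mul_kronecker_mul,
    spinRep_mul_conjTranspose hh, this, Matrix.one_kronecker_one]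

/-- Couple by singlets, then apply the spin representation of the singlet matrix to the second
factor to pass to the conjugate representation. That matrix is unitary, so the result stays nonzero.
-/
theorem exists_intertwiner_of_add (p q n : ℕ) :
    ∃ V : Matrix (Spin (p + n) × Spin (q + n)) (Spin (p + q)) ℂ,
      (∀ h ∈ Matrix.specialUnitaryGroup (Fin 2) ℂ,
        pairRep (p + n) (q + n) h * V = V * spinRep (p + q) h) ∧ V ≠ 0 := by
  have hS := spinRep_conjTranspose_mul (a := q + n) singlet_mem
  refine ⟨((1 : Matrix (Spin (p + n)) (Spin (p + n)) ℂ) ⊗ₖ spinRep (q + n) singlet) * coupling p q n, ?_, ?_⟩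
  · intro h hh
    rw [pairRep, spinRep_map_star, ← Matrix.mul_assoc, ← Matrix.mul_kronecker_mul, Matrix.mul_one,
      spinRep_mul, map_star_mul_singlet hh, ← spinRep_mul, Matrix.mul_assoc,
      ← spinRep_mul_coupling p q n (Matrix.mem_specialUnitaryGroup_iff.1 hh).2,
      ← Matrix.mul_assoc, ← Matrix.mul_kronecker_mul, Matrix.one_mul]
  · intro h0
    apply coupling_apply_ne_zero p q n
    have : coupling p q n = 0 := by
      calc coupling p q n = ((1 : Matrix (Spin (p + n)) (Spin (p + n)) ℂ) ⊗ₖ (spinRep (q + n) singlet)ᴴ) *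
            (((1 : Matrix (Spin (p + n)) (Spin (p + n)) ℂ) ⊗ₖ spinRep (q + n) singlet) * coupling p q n) := by
            rw [← Matrix.mul_assoc, ← Matrix.mul_kronecker_mul, hS, Matrix.one_mul,
              Matrix.one_kronecker_one, Matrix.one_mul]
        _ = 0 := by rw [h0, Matrix.mul_zero]
    rw [this]; rfl

section Intertwiners

variable {a b : ℕ}

/-- The product VᴴV' is an intertwiner between spins c'/2 and c/2. Schur's lemma then gives
normalisation for c = c' and orthogonality for c ≠ c' of equal parity. -/
theorem conjTranspose_mul_invariant {c c' : ℕ} {V : Matrix (Spin b × Spin a) (Spin c) ℂ}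
    {V' : Matrix (Spin b × Spin a) (Spin c') ℂ}
    (hV : ∀ h ∈ Matrix.specialUnitaryGroup (Fin 2) ℂ, pairRep b a h * V = V * spinRep c h)
    (hV' : ∀ h ∈ Matrix.specialUnitaryGroup (Fin 2) ℂ, pairRep b a h * V' = V' * spinRep c' h)
    (g : SO3) : rotation c g * (Vᴴ * V') * (rotation c' g)ᴴ = Vᴴ * V' := by
  have key : ∀ {d : ℕ} {X : Matrix (Spin b × Spin a) (Spin d) ℂ},
      (∀ h ∈ Matrix.specialUnitaryGroup (Fin 2) ℂ, pairRep b a h * X = X * spinRep d h) →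
      X * (rotation d g)ᴴ = (pairRep b a (lift g))ᴴ * X := by
    intro d X hX
    have h1 := mul_eq_one_comm.1 (pairRep_mul_conjTranspose b a (lift_mem g))
    calc X * (rotation d g)ᴴ = (pairRep b a (lift g))ᴴ * (pairRep b a (lift g) * X) *
          (rotation d g)ᴴ := by rw [← Matrix.mul_assoc, h1, Matrix.one_mul]
      _ = (pairRep b a (lift g))ᴴ * X * (rotation d g * (rotation d g)ᴴ) := by
          rw [hX _ (lift_mem g), rotation_eq]; simp only [Matrix.mul_assoc]
      _ = _ := by rw [rotation_mul_conjTranspose, Matrix.mul_one]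
  have h2 : rotation c g * Vᴴ = Vᴴ * pairRep b a (lift g) := by
    have := congrArg Matrix.conjTranspose (key hV)
    simpa using this
  calc rotation c g * (Vᴴ * V') * (rotation c' g)ᴴ
      = (rotation c g * Vᴴ) * (V' * (rotation c' g)ᴴ) := by simp only [Matrix.mul_assoc]
    _ = Vᴴ * (pairRep b a (lift g) * (pairRep b a (lift g))ᴴ) * V' := by
        rw [h2, key hV']; simp only [Matrix.mul_assoc]
    _ = Vᴴ * V' := by rw [pairRep_mul_conjTranspose b a (lift_mem g), Matrix.mul_one]

/-- By Schur's lemma VᴴV is a scalar. It is the squared norm of a column, hence nonnegative, and it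
is nonzero because V is, so V can be rescaled. -/
theorem exists_isometric_intertwiner {c n : ℕ} (hc : c + 2 * n = a + b) (ha : n ≤ a) (hb : n ≤ b) :
    ∃ V : Matrix (Spin b × Spin a) (Spin c) ℂ,
      (∀ h ∈ Matrix.specialUnitaryGroup (Fin 2) ℂ, pairRep b a h * V = V * spinRep c h) ∧
        Vᴴ * V = 1 := by
  obtain ⟨q, rfl⟩ := Nat.exists_eq_add_of_le' ha
  obtain ⟨p, rfl⟩ := Nat.exists_eq_add_of_le' hb
  obtain rfl : c = p + q := by omega
  obtain ⟨V, hV, hV0⟩ := exists_intertwiner_of_add p q n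
  have hz := eq_smul_one_of_invariant (conjTranspose_mul_invariant hV hV)
  set z := (Vᴴ * V) 0 0 with hzdef
  obtain ⟨r, hr0, hr⟩ : ∃ r : ℝ, 0 ≤ r ∧ z = (r : ℂ) := by
    refine ⟨∑ x, Complex.normSq (V x 0), Finset.sum_nonneg fun x _ => Complex.normSq_nonneg _, ?_⟩
    rw [hzdef, Matrix.mul_apply]
    push_cast
    refine Finset.sum_congr rfl fun x _ => ?_
    rw [Matrix.conjTranspose_apply, Complex.normSq_eq_conj_mul_self]; rfl
  have hz0 : z ≠ 0 := by
    intro h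
    rw [h, zero_smul] at hz
    exact hV0 (Matrix.conjTranspose_mul_self_eq_zero.1 hz)
  have hr1 : (r : ℂ) ≠ 0 := hr ▸ hz0
  refine ⟨(((√r)⁻¹ : ℝ) : ℂ) • V, fun h hh => by rw [Matrix.mul_smul, hV h hh, Matrix.smul_mul], ?_⟩
  rw [Matrix.conjTranspose_smul, Matrix.smul_mul, Matrix.mul_smul, hz, hr, smul_smul, smul_smul]
  have : star (((√r)⁻¹ : ℝ) : ℂ) * (((√r)⁻¹ : ℝ) : ℂ) * (r : ℂ) = 1 := by
    have e : (√r)⁻¹ * (√r)⁻¹ * r = 1 := by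
      have h1 : √r * √r = r := Real.mul_self_sqrt hr0
      have h2 : r ≠ 0 := by exact_mod_cast hr1
      have h3 : √r ≠ 0 := by intro h; rw [h] at h1; simp at h1; exact h2 h1.symm
      field_simp
      rw [sq, h1]
    rw [Complex.star_def, Complex.conj_ofReal]
    exact_mod_cast e
  rw [this, one_smul]

/-- Dimension count: the spins (a+b)/2 - n exhaust the product space. -/
theorem sum_clebschGordan (a b : ℕ) :
    ∑ n ∈ Finset.range (min a b + 1), (a + b - 2 * n + 1) = (b + 1) * (a + 1) := by
  -- Partial sums have a closed form, provable by induction, which becomes the product of dimensions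
  -- at m = min a b. Working over ℤ avoids truncated subtraction.
  have key : ∀ m ≤ min a b, (∑ n ∈ Finset.range (m + 1), ((a : ℤ) + b - 2 * n + 1))
      = (m + 1) * (a + b + 1 - m) := by
    intro m hm
    induction m with
    | zero => simp
    | succ m ih => rw [Finset.sum_range_succ, ih (by omega)]; push_cast; ring
  zify
  have : ∀ n ∈ Finset.range (min a b + 1), (((a + b - 2 * n : ℕ) : ℤ) + 1)
      = (a : ℤ) + b - 2 * n + 1 := by
    intro n hn
    rw [Finset.mem_range] at hn
    rw [Nat.cast_sub (by omega)]; push_cast; ring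
  rw [Finset.sum_congr rfl this, key _ le_rfl]
  rcases le_total a b with h | h
  · rw [min_eq_left h]; ring
  · rw [min_eq_right h]; ring

/-- The Clebsch–Gordan decomposition. -/
theorem exists_clebschGordan (a b : ℕ) :
    ∃ V : (n : Fin (min a b + 1)) → Matrix (Spin b × Spin a) (Spin (a + b - 2 * n)) ℂ,
      (∀ n, ∀ h ∈ Matrix.specialUnitaryGroup (Fin 2) ℂ,
        pairRep b a h * V n = V n * spinRep (a + b - 2 * n) h) ∧
      (∀ n, (V n)ᴴ * V n = 1) ∧ (∀ n m, n ≠ m → (V n)ᴴ * V m = 0) ∧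
      ∑ n, V n * (V n)ᴴ = 1 := by
  have hex : ∀ n : Fin (min a b + 1), ∃ V : Matrix (Spin b × Spin a) (Spin (a + b - 2 * n)) ℂ,
      (∀ h ∈ Matrix.specialUnitaryGroup (Fin 2) ℂ,
        pairRep b a h * V = V * spinRep (a + b - 2 * n) h) ∧ Vᴴ * V = 1 := fun n =>
    exists_isometric_intertwiner (n := n) (by omega) (by omega) (by omega)
  choose V hV hV1 using hex
  have hV0 : ∀ n m, n ≠ m → (V n)ᴴ * V m = 0 := by
    intro n m hnm
    refine eq_zero_of_invariant_of_ne ?_ ?_ (conjTranspose_mul_invariant (hV n) (hV m))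
    · exact ⟨a + b - n - m, by omega⟩
    · intro h; apply hnm; ext; omega
  refine ⟨V, hV, hV1, hV0, ?_⟩
  -- Collect the columns of all the isometries in one matrix. Its columns are orthonormal and, by
  -- the dimension count, as many as its rows, so its rows are orthonormal too; this is
  -- completeness.
  let B : Matrix (Spin b × Spin a) ((n : Fin (min a b + 1)) × Spin (a + b - 2 * n)) ℂ :=
    Matrix.of fun x y => V y.1 x y.2
  have h1 : Bᴴ * B = 1 := by
    ext ⟨n, i⟩ ⟨m, j⟩
    have e : (Bᴴ * B) ⟨n, i⟩ ⟨m, j⟩ = ((V n)ᴴ * V m) i j := rfl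
    rw [e]
    by_cases hnm : n = m
    · subst hnm
      rw [hV1]
      by_cases hij : i = j
      · subst hij; simp
      · rw [Matrix.one_apply_ne hij, Matrix.one_apply_ne (by simpa using hij)]
    · rw [hV0 n m hnm, Matrix.one_apply_ne (by rintro h; exact hnm (congrArg Sigma.fst h))]; rfl
  have h2 : B * Bᴴ = 1 := by
    refine (Matrix.mul_eq_one_comm_of_card_eq _ _ _ ?_).1 h1
    simp only [Fintype.card_sigma, Fintype.card_prod, Fintype.card_fin]
    rw [← sum_clebschGordan, Finset.sum_range]
  rw [← h2]
  ext x y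
  rw [Matrix.sum_apply, Matrix.mul_apply, Fintype.sum_sigma]
  rfl

end Intertwiners

/-! ### Averages of squared matrix elements -/

section Average

theorem ofReal_norm_sq_sum {ι : Type*} [Fintype ι] (β u : ι → ℂ) :
    ((‖∑ x, β x * u x‖ ^ 2 : ℝ) : ℂ) =
      ∑ x, ∑ y, β x * star (β y) * (u x * star (u y)) := by
  rw [← Complex.normSq_eq_norm_sq, Complex.normSq_eq_conj_mul_self, mul_comm,
    ← Complex.star_def, star_sum, Finset.sum_mul]
  refine Finset.sum_congr rfl fun x _ => ?_
  rw [Finset.mul_sum]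
  refine Finset.sum_congr rfl fun y _ => ?_
  rw [star_mul']
  ring

section

variable [MeasurableSpace SO3] (μ : Measure SO3)

/-- Pythagoras in L² for an orthogonal family u with squared norms w. -/
theorem integral_norm_sq_sum {ι : Type*} [Fintype ι] [DecidableEq ι] (β : ι → ℂ)
    (u : ι → SO3 → ℂ) (w : ι → ℝ) (hI : ∀ x y, Integrable (fun g => u x g * star (u y g)) μ)
    (hu : ∀ x y, ∫ g, u x g * star (u y g) ∂μ = if x = y then (w x : ℂ) else 0) :
    Integrable (fun g => ‖∑ x, β x * u x g‖ ^ 2) μ ∧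
      ∫ g, ‖∑ x, β x * u x g‖ ^ 2 ∂μ = ∑ x, ‖β x‖ ^ 2 * w x := by
  have hi : Integrable (fun g => ((‖∑ x, β x * u x g‖ ^ 2 : ℝ) : ℂ)) μ := by
    simp only [ofReal_norm_sq_sum]
    exact integrable_finsetSum _ fun x _ => integrable_finsetSum _ fun y _ => (hI x y).const_mul _
  refine ⟨by simpa only [RCLike.ofReal_re, RCLike.re_to_complex, Complex.ofReal_re] using hi.re, ?_⟩
  apply Complex.ofReal_injective
  rw [← integral_complex_ofReal]
  simp only [ofReal_norm_sq_sum]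
  rw [integral_finsetSum _ fun x _ => integrable_finsetSum _ fun y _ => (hI x y).const_mul _]
  push_cast
  refine Finset.sum_congr rfl fun x _ => ?_
  rw [integral_finsetSum _ fun y _ => (hI x y).const_mul _]
  simp only [integral_const_mul, hu]
  rw [Finset.sum_eq_single x]
  · rw [if_pos rfl, Complex.star_def, Complex.mul_conj, Complex.normSq_eq_norm_sq]
    push_cast
    rfl
  · intro y _ hy
    rw [if_neg hy.symm, mul_zero]
  · simp

end

theorem parseval {ι κ : Type*} [Fintype ι] [Fintype κ] [DecidableEq κ] {σ : ι → Type*}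
    [∀ n, Fintype (σ n)] (V : (n : ι) → Matrix κ (σ n) ℂ) (hV : ∑ n, V n * (V n)ᴴ = 1)
    (x : κ → ℂ) : ∑ n, ∑ i, ‖∑ p, x p * V n p i‖ ^ 2 = ∑ p, ‖x p‖ ^ 2 := by
  apply Complex.ofReal_injective
  push_cast
  have h1 : ∀ n i, (((‖∑ p, x p * V n p i‖ : ℝ) : ℂ)) ^ 2 =
      ∑ p, ∑ q, x p * star (x q) * (V n p i * star (V n q i)) := by
    intro n i
    rw [← ofReal_norm_sq_sum]; push_cast; rfl
  have h2 : ∑ n, ∑ i, ∑ p, ∑ q, x p * star (x q) * (V n p i * star (V n q i)) =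
      ∑ p, ∑ q, x p * star (x q) * (∑ n, V n * (V n)ᴴ) p q := by
    simp only [Matrix.sum_apply, Matrix.mul_apply, Matrix.conjTranspose_apply, Finset.mul_sum]
    have : ∀ n, ∑ i, ∑ p, ∑ q, x p * star (x q) * (V n p i * star (V n q i)) =
        ∑ p, ∑ q, ∑ i, x p * star (x q) * (V n p i * star (V n q i)) := by
      intro n
      rw [Finset.sum_comm]
      exact Finset.sum_congr rfl fun p _ => Finset.sum_comm
    simp only [this]
    rw [Finset.sum_comm]
    exact Finset.sum_congr rfl fun p _ => Finset.sum_comm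
  simp only [h1]
  rw [h2, hV]
  refine Finset.sum_congr rfl fun p _ => ?_
  rw [Finset.sum_eq_single p]
  · rw [Matrix.one_apply_eq, mul_one, Complex.star_def, Complex.mul_conj, Complex.normSq_eq_norm_sq]
    push_cast; rfl
  · intro q _ hq
    rw [Matrix.one_apply_ne hq.symm, mul_zero]
  · simp

/-- Completeness of V preserves the norm of A when its two indices are transformed separately. The
left-hand side keeps only the blocks with the same n on both sides; an inequality results from
dropping the others. -/
theorem bessel {ι κ : Type*} [Fintype ι] [Fintype κ] [DecidableEq κ] {σ : ι → Type*}
    [∀ n, Fintype (σ n)] (V : (n : ι) → Matrix κ (σ n) ℂ) (hV : ∑ n, V n * (V n)ᴴ = 1)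
    (A : κ → κ → ℂ) :
    ∑ n, ∑ i, ∑ j, ‖∑ p, ∑ q, A p q * (V n p i * star (V n q j))‖ ^ 2 ≤
      ∑ p, ∑ q, ‖A p q‖ ^ 2 := by
  have hstar : ∀ p, ∑ n, ∑ j, ‖∑ q, A p q * star (V n q j)‖ ^ 2 = ∑ q, ‖A p q‖ ^ 2 := by
    intro p
    have := parseval V hV fun q => star (A p q)
    simp only [norm_star] at this
    rw [← this]
    refine Finset.sum_congr rfl fun n _ => Finset.sum_congr rfl fun j _ => ?_
    rw [← norm_star, star_sum]
    simp
  calc ∑ n, ∑ i, ∑ j, ‖∑ p, ∑ q, A p q * (V n p i * star (V n q j))‖ ^ 2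
      ≤ ∑ n, ∑ j, ∑ p, ‖∑ q, A p q * star (V n q j)‖ ^ 2 := by
        refine Finset.sum_le_sum fun n _ => ?_
        rw [Finset.sum_comm]
        refine Finset.sum_le_sum fun j _ => ?_
        rw [← parseval V hV fun p => ∑ q, A p q * star (V n q j)]
        refine le_trans (le_of_eq ?_) (Finset.single_le_sum
          (f := fun m => ∑ i, ‖∑ p, (∑ q, A p q * star (V n q j)) * V m p i‖ ^ 2)
          (fun m _ => Finset.sum_nonneg fun i _ => sq_nonneg _) (Finset.mem_univ n))
        refine Finset.sum_congr rfl fun i _ => ?_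
        congr 2
        refine Finset.sum_congr rfl fun p _ => ?_
        rw [Finset.sum_mul]
        exact Finset.sum_congr rfl fun q _ => by ring
    _ = ∑ p, ∑ q, ‖A p q‖ ^ 2 := by
        rw [Finset.sum_congr rfl fun n _ => Finset.sum_comm, Finset.sum_comm]
        exact Finset.sum_congr rfl fun p _ => hstar p

variable [MeasurableSpace SO3] [BorelSpace SO3] (μ : Measure SO3)

/-- The four factors regroup into two products, each of an entry and a conjugate entry of the same
spin. These are continuous and bounded. -/
theorem integrable_pairRep_mul_star [IsFiniteMeasure μ] (a b : ℕ) (p q p' q' : Spin b × Spin a) :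
    Integrable (fun g => pairRep b a (lift g) p q * star (pairRep b a (lift g) p' q')) μ := by
  have e : ∀ g, pairRep b a (lift g) p q * star (pairRep b a (lift g) p' q') =
      (rotation b g p.1 q.1 * star (rotation b g p'.1 q'.1)) *
        (rotation a g p'.2 q'.2 * star (rotation a g p.2 q.2)) := by
    intro g
    simp only [pairRep, Matrix.kroneckerMap_apply, Matrix.map_apply, rotation_eq, star_mul',
      star_star]
    ring
  simp only [e]
  refine integrable_of_continuous_of_bound μ ((continuous_rotation_mul_star b _ _ _ _).mul
    (continuous_rotation_mul_star a _ _ _ _)) 1 fun g => ?_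
  rw [norm_mul, norm_mul, norm_mul, norm_star, norm_star]
  have := norm_rotation_apply_le
  exact mul_le_one₀ (mul_le_one₀ (this _ _ _ _) (norm_nonneg _) (this _ _ _ _)) (by positivity)
    (mul_le_one₀ (this _ _ _ _) (norm_nonneg _) (this _ _ _ _))

/-- The heart of the upper bound. In the Clebsch–Gordan basis the matrix elements are orthogonal
functions of squared norm 1/(c+1), and the smallest c that occurs is |a-b|. -/
theorem integral_norm_sq_pairRep_le [μ.IsHaarMeasure] [IsProbabilityMeasure μ] (a b : ℕ)
    (A : Spin b × Spin a → Spin b × Spin a → ℂ) :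
    Integrable (fun g => ‖∑ p, ∑ q, A p q * pairRep b a (lift g) p q‖ ^ 2) μ ∧
    ∫ g, ‖∑ p, ∑ q, A p q * pairRep b a (lift g) p q‖ ^ 2 ∂μ ≤
      (∑ p, ∑ q, ‖A p q‖ ^ 2) / (|(a : ℝ) - b| + 1) := by
  obtain ⟨V, hV, hV1, -, hVs⟩ := exists_clebschGordan a b
  set c : Fin (min a b + 1) → ℕ := fun n => a + b - 2 * n with hc
  have hU : ∀ n g, rotation (c n) g = (V n)ᴴ * pairRep b a (lift g) * V n := by
    intro n g
    rw [Matrix.mul_assoc, hV n _ (lift_mem g), ← Matrix.mul_assoc, hV1, Matrix.one_mul, rotation_eq]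
  have hW : ∀ g, pairRep b a (lift g) = ∑ n, V n * rotation (c n) g * (V n)ᴴ := by
    intro g
    calc pairRep b a (lift g) = pairRep b a (lift g) * ∑ n, V n * (V n)ᴴ := by
          rw [hVs, Matrix.mul_one]
      _ = _ := by
          rw [Matrix.mul_sum]
          refine Finset.sum_congr rfl fun n _ => ?_
          rw [← Matrix.mul_assoc, hV n _ (lift_mem g), rotation_eq]
  -- Matrix elements of each block are linear combinations of entries of `pairRep` at the same lift,
  -- which gives integrability also across different blocks.
  have hI : ∀ (n m) (i j : Spin (c n)) (k l : Spin (c m)),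
      Integrable (fun g => rotation (c n) g i j * star (rotation (c m) g k l)) μ := by
    intro n m i j k l
    have hent : ∀ n (i j : Spin (c n)) g, rotation (c n) g i j =
        ∑ q, ∑ p, star (V n p i) * V n q j * pairRep b a (lift g) p q := by
      intro n i j g
      rw [hU, Matrix.mul_apply]
      refine Finset.sum_congr rfl fun q _ => ?_
      rw [Matrix.mul_apply, Finset.sum_mul]
      refine Finset.sum_congr rfl fun p _ => ?_
      rw [Matrix.conjTranspose_apply]
      ring
    have e : ∀ g, rotation (c n) g i j * star (rotation (c m) g k l) =
        ∑ q, ∑ p, ∑ q', ∑ p', star (V n p i) * V n q j * star (star (V m p' k) * V m q' l) *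
          (pairRep b a (lift g) p q * star (pairRep b a (lift g) p' q')) := by
      intro g
      rw [hent n, hent m, Finset.sum_mul]
      refine Finset.sum_congr rfl fun q _ => ?_
      rw [Finset.sum_mul]
      refine Finset.sum_congr rfl fun p _ => ?_
      rw [star_sum, Finset.mul_sum]
      refine Finset.sum_congr rfl fun q' _ => ?_
      rw [star_sum, Finset.mul_sum]
      refine Finset.sum_congr rfl fun p' _ => ?_
      rw [star_mul']
      ring
    simp only [e]
    exact integrable_finsetSum _ fun _ _ => integrable_finsetSum _ fun _ _ =>
      integrable_finsetSum _ fun _ _ => integrable_finsetSum _ fun _ _ =>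
      (integrable_pairRep_mul_star μ a b _ _ _ _).const_mul _
  have hf : ∀ g, ∑ p, ∑ q, A p q * pairRep b a (lift g) p q =
      ∑ x : (n : Fin (min a b + 1)) × Spin (c n) × Spin (c n),
        (∑ p, ∑ q, A p q * (V x.1 p x.2.1 * star (V x.1 q x.2.2))) *
          rotation (c x.1) g x.2.1 x.2.2 := by
    intro g
    have hW' : ∀ p q, pairRep b a (lift g) p q =
        ∑ x : (n : Fin (min a b + 1)) × Spin (c n) × Spin (c n),
          V x.1 p x.2.1 * star (V x.1 q x.2.2) * rotation (c x.1) g x.2.1 x.2.2 := by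
      intro p q
      rw [Fintype.sum_sigma, hW g, Matrix.sum_apply]
      refine Finset.sum_congr rfl fun n _ => ?_
      rw [Fintype.sum_prod_type, Finset.sum_comm, Matrix.mul_apply]
      refine Finset.sum_congr rfl fun j _ => ?_
      rw [Matrix.mul_apply, Finset.sum_mul]
      refine Finset.sum_congr rfl fun i _ => ?_
      rw [Matrix.conjTranspose_apply]
      ring
    simp only [Finset.sum_mul]
    conv_rhs => rw [Finset.sum_comm]
    refine Finset.sum_congr rfl fun p _ => ?_
    conv_rhs => rw [Finset.sum_comm]
    refine Finset.sum_congr rfl fun q _ => ?_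
    rw [hW', Finset.mul_sum]
    refine Finset.sum_congr rfl fun x _ => ?_
    ring
  simp only [hf]
  obtain ⟨h1, h2⟩ := integral_norm_sq_sum μ
    (fun x : (n : Fin (min a b + 1)) × Spin (c n) × Spin (c n) =>
      ∑ p, ∑ q, A p q * (V x.1 p x.2.1 * star (V x.1 q x.2.2)))
    (fun x g => rotation (c x.1) g x.2.1 x.2.2) (fun x => ((c x.1 : ℝ) + 1)⁻¹)
    (fun x y => hI _ _ _ _ _ _) (by
      rintro ⟨n, i, j⟩ ⟨m, k, l⟩
      by_cases hnm : n = m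
      · subst hnm
        simp only [integral_rotation]
        by_cases h : i = k ∧ j = l
        · obtain ⟨rfl, rfl⟩ := h
          simp
        · rw [if_neg h, if_neg]
          intro h'
          apply h
          simpa using h'
      · rw [if_neg fun h => hnm (congrArg Sigma.fst h)]
        refine integral_rotation_of_ne μ ⟨a + b - n - m, by simp only [hc]; omega⟩ ?_
          (hI n m) _ _ _ _
        intro h
        apply hnm
        ext
        simp only [hc] at h
        omega)
  refine ⟨h1, h2.le.trans ?_⟩
  have hpos : (0 : ℝ) < |(a : ℝ) - b| + 1 := by positivity
  have hb := bessel V hVs A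
  rw [div_eq_mul_inv]
  refine le_trans ?_ (mul_le_mul_of_nonneg_right hb (inv_nonneg.2 hpos.le))
  rw [Fintype.sum_sigma, Finset.sum_mul]
  refine Finset.sum_le_sum fun n _ => ?_
  rw [Fintype.sum_prod_type, Finset.sum_mul]
  refine Finset.sum_le_sum fun i _ => ?_
  rw [Finset.sum_mul]
  refine Finset.sum_le_sum fun j _ => ?_
  refine mul_le_mul_of_nonneg_left (inv_anti₀ hpos ?_) (sq_nonneg _)
  have hn : (n : ℕ) ≤ min a b := by omega
  have : |(a : ℝ) - b| ≤ (c n : ℝ) := by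
    rw [abs_le]
    have h1 : b ≤ a + c n := by simp only [hc]; omega
    have h2 : a ≤ b + c n := by simp only [hc]; omega
    have h1' : (b : ℝ) ≤ a + c n := by exact_mod_cast h1
    have h2' : (a : ℝ) ≤ b + c n := by exact_mod_cast h2
    constructor <;> linarith
  linarith

end Average

/-! ### Kraus decompositions -/

section Kraus

variable {m n : Type*} [Fintype m]

theorem exists_kraus [DecidableEq m] [Fintype n] [DecidableEq n]
    {Φ : Matrix m m ℂ →ₗ[ℂ] Matrix n n ℂ}
    (hΦ : IsCompletelyPositive Φ) : ∃ (d : ℕ) (K : Fin d → Matrix n m ℂ),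
      ∀ X, Φ X = ∑ k, K k * X * (K k)ᴴ := by
  let e := Fintype.equivFin m
  -- The unnormalised maximally entangled vector: its image is the Choi matrix, and a rank-one
  -- decomposition of that matrix yields the Kraus operators.
  let v : m × Fin (Fintype.card m) → ℂ := fun x => if x.1 = e.symm x.2 then 1 else 0
  have hpos := hΦ _ _ (Matrix.posSemidef_vecMulVec_self_star v)
  obtain ⟨d, B, hB⟩ := Matrix.posSemidef_iff_eq_sum_vecMulVec.1 hpos
  refine ⟨d, fun k => Matrix.of fun p i => B k (p, e i), ?_⟩
  have hE : ∀ i j p q, Φ (Matrix.single i j 1) p q =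
      ∑ k, B k (p, e i) * star (B k (q, e j)) := by
    intro i j p q
    have h1 := congrFun (congrFun hB (p, e i)) (q, e j)
    rw [Matrix.sum_apply] at h1
    refine Eq.trans ?_ h1
    have : (Matrix.of fun i' j' => Matrix.vecMulVec v (star v) (i', e i) (j', e j))
        = Matrix.single i j (1 : ℂ) := by
      ext i' j'
      simp [v, Matrix.vecMulVec_apply, Matrix.single_apply, eq_comm (a := i), eq_comm (a := j)]
      split <;> simp_all
    rw [← this]
    rfl
  intro X
  ext p q
  have h1 : ∀ i j, Φ (Matrix.single i j (X i j)) p q =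
      ∑ k, X i j * (B k (p, e i) * star (B k (q, e j))) := by
    intro i j
    rw [← Finset.mul_sum, ← hE, ← smul_eq_mul, ← Matrix.smul_apply, ← map_smul, Matrix.smul_single,
      smul_eq_mul, mul_one]
  conv_lhs => rw [Matrix.matrix_eq_sum_single X]
  simp only [map_sum, Matrix.sum_apply, Matrix.mul_apply, Matrix.conjTranspose_apply,
    Matrix.of_apply, h1, Finset.sum_mul]
  rw [Finset.sum_comm, Finset.sum_comm (γ := Fin d)]
  refine Finset.sum_congr rfl fun j _ => ?_
  rw [Finset.sum_comm]
  refine Finset.sum_congr rfl fun k _ => Finset.sum_congr rfl fun i _ => ?_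
  ring

theorem dotProduct_kraus (K : Matrix n m ℂ) [Fintype n] (φ : m → ℂ) (ψ : n → ℂ) :
    star ψ ⬝ᵥ ((K * Matrix.vecMulVec φ (star φ) * Kᴴ) *ᵥ ψ) =
      ((‖star ψ ⬝ᵥ (K *ᵥ φ)‖ ^ 2 : ℝ) : ℂ) := by
  have h1 : (K * Matrix.vecMulVec φ (star φ) * Kᴴ) = Matrix.vecMulVec (K *ᵥ φ) (star (K *ᵥ φ)) := by
    rw [Matrix.mul_vecMulVec, Matrix.vecMulVec_mul, Matrix.star_mulVec]
  rw [h1, Matrix.vecMulVec_mulVec, dotProduct_smul, ← Complex.normSq_eq_norm_sq,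
    ← Complex.mul_conj, ← Complex.star_def, ← Matrix.star_dotProduct]
  simp

theorem trace_kraus (K : Matrix n m ℂ) [Fintype n] (φ : m → ℂ) :
    (K * Matrix.vecMulVec φ (star φ) * Kᴴ).trace = ((∑ p, ‖(K *ᵥ φ) p‖ ^ 2 : ℝ) : ℂ) := by
  have h1 : (K * Matrix.vecMulVec φ (star φ) * Kᴴ) = Matrix.vecMulVec (K *ᵥ φ) (star (K *ᵥ φ)) := by
    rw [Matrix.mul_vecMulVec, Matrix.vecMulVec_mul, Matrix.star_mulVec]
  rw [h1, Matrix.trace]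
  push_cast
  refine Finset.sum_congr rfl fun p _ => ?_
  rw [Matrix.diag_apply, Matrix.vecMulVec_apply, Pi.star_apply, Complex.star_def, Complex.mul_conj,
    Complex.normSq_eq_norm_sq]
  push_cast; rfl

end Kraus

/-! ### The upper bound -/

/-- The amplitudes of the rotated Bell state are the matrix elements of the rotation, so averages
over g become instances of Schur orthogonality. -/
theorem rotatedBell_apply (a : ℕ) (g : SO3) (p : Spin a × Spin a) :
    rotatedBell a g p = rotation a g p.1 p.2 * ((1 / √(a + 1 : ℝ) : ℝ) : ℂ) := by
  rw [rotatedBell, Matrix.mulVec, dotProduct, Finset.sum_eq_single (p.2, p.2)]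
  · simp [bell]
  · rintro ⟨i, j⟩ _ h
    rw [Matrix.kroneckerMap_apply, bell]
    by_cases hj : p.2 = j
    · rw [if_neg, mul_zero]
      rintro h'
      apply h
      simp only at h'
      rw [h', hj]
    · rw [Matrix.one_apply_ne hj, mul_zero, zero_mul]
  · simp

section Bound

variable [MeasurableSpace SO3] [BorelSpace SO3] (μ : Measure SO3) [μ.IsHaarMeasure]
  [IsProbabilityMeasure μ] {a b : ℕ}

/-- The amplitude is the conjugate of a functional of `pairRep` whose coefficients are the
conjugated entries of `K`, regrouped from (output, input) pairs into row and column indices.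
Regrouping does not change the sum of squares. -/
theorem integral_kraus_overlap_le (K : Matrix (Spin b × Spin b) (Spin a × Spin a) ℂ) :
    Integrable (fun g => ‖star (rotatedBell b g) ⬝ᵥ (K *ᵥ rotatedBell a g)‖ ^ 2) μ ∧
    ∫ g, ‖star (rotatedBell b g) ⬝ᵥ (K *ᵥ rotatedBell a g)‖ ^ 2 ∂μ ≤
      (∑ p, ∑ i, ‖K p i‖ ^ 2) / (((a : ℝ) + 1) * (b + 1) * (|(a : ℝ) - b| + 1)) := by
  have e : ∀ g, ‖star (rotatedBell b g) ⬝ᵥ (K *ᵥ rotatedBell a g)‖ ^ 2 =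
      (((a : ℝ) + 1) * (b + 1))⁻¹ * ‖∑ p : Spin b × Spin a, ∑ q : Spin b × Spin a,
        star (K (p.1, q.1) (p.2, q.2)) * pairRep b a (lift g) p q‖ ^ 2 := by
    intro g
    have h1 : star (rotatedBell b g) ⬝ᵥ (K *ᵥ rotatedBell a g) =
        ((1 / √(a + 1 : ℝ) : ℝ) : ℂ) * ((1 / √(b + 1 : ℝ) : ℝ) : ℂ) *
        star (∑ p : Spin b × Spin a, ∑ q : Spin b × Spin a,
          star (K (p.1, q.1) (p.2, q.2)) * pairRep b a (lift g) p q) := by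
      simp only [dotProduct, Matrix.mulVec, Pi.star_apply, rotatedBell_apply, star_mul', star_sum,
        star_star, pairRep, Matrix.kroneckerMap_apply, Matrix.map_apply, Fintype.sum_prod_type,
        Finset.mul_sum, rotation_eq]
      refine Finset.sum_congr rfl fun p₁ _ => ?_
      conv_rhs => rw [Finset.sum_comm]
      refine Finset.sum_congr rfl fun p₂ _ => Finset.sum_congr rfl fun i₁ _ =>
        Finset.sum_congr rfl fun i₂ _ => ?_
      rw [Complex.star_def, Complex.conj_ofReal]
      ring
    rw [h1, norm_mul, norm_mul, norm_star, mul_pow, mul_pow, Complex.norm_real, Complex.norm_real,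
      Real.norm_eq_abs, Real.norm_eq_abs, sq_abs, sq_abs, div_pow, div_pow, Real.sq_sqrt (by positivity),
      Real.sq_sqrt (by positivity), mul_inv]
    ring
  simp only [e]
  obtain ⟨h1, h2⟩ := integral_norm_sq_pairRep_le μ a b
    fun p q => star (K (p.1, q.1) (p.2, q.2))
  refine ⟨h1.const_mul _, ?_⟩
  rw [integral_const_mul]
  refine (mul_le_mul_of_nonneg_left h2 (by positivity)).trans (le_of_eq ?_)
  have : ∑ p : Spin b × Spin a, ∑ q : Spin b × Spin a, ‖star (K (p.1, q.1) (p.2, q.2))‖ ^ 2 =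
      ∑ p, ∑ i, ‖K p i‖ ^ 2 := by
    simp only [norm_star, Fintype.sum_prod_type]
    exact Finset.sum_congr rfl fun p₁ _ => Finset.sum_comm
  rw [this, div_eq_mul_inv, div_eq_mul_inv, mul_inv (((a : ℝ) + 1) * (b + 1))]
  ring

/-- The Haar average of the input states is the maximally mixed state on a space of dimension
(a+1)². -/
theorem integral_kraus_trace (K : Matrix (Spin b × Spin b) (Spin a × Spin a) ℂ) :
    Integrable (fun g => ∑ p, ‖(K *ᵥ rotatedBell a g) p‖ ^ 2) μ ∧
    ∫ g, ∑ p, ‖(K *ᵥ rotatedBell a g) p‖ ^ 2 ∂μ = (∑ p, ∑ i, ‖K p i‖ ^ 2) / ((a : ℝ) + 1) ^ 2 := by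
  have hφ : ∀ x y g, rotatedBell a g x * star (rotatedBell a g y) =
      ((((a : ℝ) + 1)⁻¹ : ℝ) : ℂ) * (rotation a g x.1 x.2 * star (rotation a g y.1 y.2)) := by
    intro x y g
    have : ((1 / √(a + 1 : ℝ) : ℝ) : ℂ) * ((1 / √(a + 1 : ℝ) : ℝ) : ℂ) =
        ((((a : ℝ) + 1)⁻¹ : ℝ) : ℂ) := by
      rw [← Complex.ofReal_mul, div_mul_div_comm, Real.mul_self_sqrt (by positivity), one_mul,
        one_div]
    rw [rotatedBell_apply, rotatedBell_apply, star_mul', ← this, Complex.star_def,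
      Complex.conj_ofReal]
    ring
  have h := fun p => integral_norm_sq_sum μ (K p) (fun x g => rotatedBell a g x)
    (fun _ => ((a : ℝ) + 1)⁻¹ * ((a : ℝ) + 1)⁻¹)
    (fun x y => by
      simp only [hφ]
      exact (integrable_rotation μ a _ _ _ _).const_mul _)
    (fun x y => by
      simp only [hφ, integral_const_mul, integral_rotation, Prod.ext_iff]
      push_cast
      split <;> simp)
  refine ⟨integrable_finsetSum _ fun p _ => (h p).1, ?_⟩
  refine (integral_finsetSum _ fun p _ => (h p).1).trans ?_
  rw [Finset.sum_div]
  refine Finset.sum_congr rfl fun p _ => ?_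
  rw [Finset.sum_div]
  refine (h p).2.trans (Finset.sum_congr rfl fun i _ => ?_)
  rw [div_eq_mul_inv, ← mul_inv, ← sq]

/-- For each Kraus operator, both sides are proportional to its squared Hilbert–Schmidt norm, which
cancels from the comparison. -/
theorem integral_overlap_le {M : Converter a b} (hM : IsCompletelyPositive M) :
    ∫ g, overlap a b M g ∂μ ≤
      ((a : ℝ) + 1) / ((b + 1) * (|(a : ℝ) - b| + 1)) * successProb μ a b M := by
  obtain ⟨d, K, hK⟩ := exists_kraus hM
  have ho : ∀ g, overlap a b M g =
      ∑ k, ‖star (rotatedBell b g) ⬝ᵥ (K k *ᵥ rotatedBell a g)‖ ^ 2 := by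
    intro g
    rw [overlap, hK, rotatedBellState, Matrix.sum_mulVec, dotProduct_sum]
    simp only [dotProduct_kraus]
    rw [← Complex.ofReal_sum, Complex.ofReal_re]
  have ht : ∀ g, (M (rotatedBellState a g)).trace.re =
      ∑ k, ∑ p, ‖(K k *ᵥ rotatedBell a g) p‖ ^ 2 := by
    intro g
    rw [hK, rotatedBellState, Matrix.trace_sum]
    simp only [trace_kraus]
    rw [← Complex.ofReal_sum, Complex.ofReal_re]
  rw [successProb]
  simp only [ho, ht]
  rw [integral_finsetSum _ fun k _ => (integral_kraus_overlap_le μ (K k)).1,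
    integral_finsetSum _ fun k _ => (integral_kraus_trace μ (K k)).1, Finset.mul_sum]
  refine Finset.sum_le_sum fun k _ => (integral_kraus_overlap_le μ (K k)).2.trans (le_of_eq ?_)
  rw [(integral_kraus_trace μ (K k)).2]
  have : (0 : ℝ) < |(a : ℝ) - b| + 1 := by positivity
  field_simp

end Bound

/-! ### Completely positive maps given by Kraus operators -/

section Kraus

variable {m n : Type*} [Fintype m]

theorem conjMap_apply (K : Matrix n m ℂ) (X : Matrix m m ℂ) : conjMap K X = K * X * Kᴴ := rfl

theorem isCompletelyPositive_of_kraus [Fintype n] {ι : Type*} [Fintype ι]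
    {Φ : Matrix m m ℂ →ₗ[ℂ] Matrix n n ℂ} (K : ι → Matrix n m ℂ)
    (hK : ∀ X, Φ X = ∑ k, K k * X * (K k)ᴴ) : IsCompletelyPositive Φ := by
  intro d X hX
  have e : onFirst (Fin d) Φ X = ∑ k, (K k ⊗ₖ (1 : Matrix (Fin d) (Fin d) ℂ)) * X *
      (K k ⊗ₖ (1 : Matrix (Fin d) (Fin d) ℂ))ᴴ := by
    ext ⟨p, x⟩ ⟨q, y⟩
    change Φ (Matrix.of fun i j => X (i, x) (j, y)) p q = _
    rw [hK, Matrix.sum_apply, Matrix.sum_apply]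
    refine Finset.sum_congr rfl fun k _ => ?_
    rw [Matrix.mul_apply, Matrix.mul_apply, Fintype.sum_prod_type]
    refine Finset.sum_congr rfl fun j _ => ?_
    rw [Finset.sum_eq_single y]
    · rw [Matrix.mul_apply, Matrix.mul_apply, Fintype.sum_prod_type]
      congr 1
      · refine Finset.sum_congr rfl fun i _ => ?_
        rw [Finset.sum_eq_single x]
        · simp
        · intro z _ hz
          simp [Matrix.one_apply_ne hz.symm]
        · simp
      · simp
    · intro z _ hz
      simp [Matrix.one_apply_ne hz.symm]
    · simp
  rw [e]
  exact Matrix.posSemidef_sum _ fun k _ => hX.mul_mul_conjTranspose_same _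

theorem trace_sum_kraus [Fintype n] {ι : Type*} [Fintype ι] (K : ι → Matrix n m ℂ) (X : Matrix m m ℂ) :
    (∑ k, K k * X * (K k)ᴴ).trace = ((∑ k, (K k)ᴴ * K k) * X).trace := by
  rw [Matrix.trace_sum, Matrix.sum_mul, Matrix.trace_sum]
  refine Finset.sum_congr rfl fun k _ => ?_
  rw [Matrix.mul_assoc, Matrix.trace_mul_comm, Matrix.mul_assoc, Matrix.trace_mul_comm]

variable {m' n' : Type*} [Fintype m']

theorem tensorMap_kraus {ι ι' : Type*} [Fintype ι] [Fintype ι']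
    {Φ : Matrix m m ℂ →ₗ[ℂ] Matrix n n ℂ} {Ψ : Matrix m' m' ℂ →ₗ[ℂ] Matrix n' n' ℂ}
    (K : ι → Matrix n m ℂ) (hK : ∀ X, Φ X = ∑ k, K k * X * (K k)ᴴ)
    (L : ι' → Matrix n' m' ℂ) (hL : ∀ X, Ψ X = ∑ l, L l * X * (L l)ᴴ)
    (X : Matrix (m × m') (m × m') ℂ) :
    tensorMap Φ Ψ X = ∑ x : ι × ι', (K x.1 ⊗ₖ L x.2) * X * (K x.1 ⊗ₖ L x.2)ᴴ := by
  ext ⟨p, x⟩ ⟨q, y⟩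
  change Φ (Matrix.of fun i j => Ψ (Matrix.of fun i' j' => X (i, i') (j, j')) x y) p q = _
  rw [hK, Fintype.sum_prod_type, Matrix.sum_apply, Matrix.sum_apply]
  refine Finset.sum_congr rfl fun k _ => ?_
  rw [Matrix.sum_apply]
  simp only [hL, Matrix.mul_apply, Matrix.of_apply, Matrix.sum_apply, Fintype.sum_prod_type,
    Matrix.kroneckerMap_apply, Matrix.conjTranspose_apply, star_mul', Finset.mul_sum,
    Finset.sum_mul]
  conv_rhs => rw [Finset.sum_comm]
  refine Finset.sum_congr rfl fun j _ => ?_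
  have h1 : ∀ i, ∑ l, ∑ j', ∑ i', K k p i * (L l x i' * X (i, i') (j, j') * star (L l y j')) *
      star (K k q j) = ∑ l, ∑ j', ∑ i', K k p i * L l x i' * X (i, i') (j, j') *
        (star (K k q j) * star (L l y j')) := by
    intro i
    refine Finset.sum_congr rfl fun l _ => Finset.sum_congr rfl fun j' _ =>
      Finset.sum_congr rfl fun i' _ => ?_
    ring
  simp only [h1]
  rw [Finset.sum_comm]
  refine Finset.sum_congr rfl fun l _ => ?_
  rw [Finset.sum_comm]

theorem trace_tensorMap [Fintype n] [Fintype n'] {Φ : Matrix m m ℂ →ₗ[ℂ] Matrix n n ℂ}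
    {Ψ : Matrix m' m' ℂ →ₗ[ℂ] Matrix n' n' ℂ} (hΦ : ∀ X, (Φ X).trace = X.trace)
    (hΨ : ∀ X, (Ψ X).trace = X.trace) (X : Matrix (m × m') (m × m') ℂ) :
    (tensorMap Φ Ψ X).trace = X.trace := by
  have h1 : ∀ Y, (onFirst n' Φ Y).trace = Y.trace := by
    intro Y
    simp only [Matrix.trace, Matrix.diag_apply, Fintype.sum_prod_type]
    rw [Finset.sum_comm]
    conv_rhs => rw [Finset.sum_comm]
    exact Finset.sum_congr rfl fun r _ => hΦ (Matrix.of fun i j => Y (i, r) (j, r))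
  have h2 : (onSecond m Ψ X).trace = X.trace := by
    simp only [Matrix.trace, Matrix.diag_apply, Fintype.sum_prod_type]
    exact Finset.sum_congr rfl fun r _ => hΨ (Matrix.of fun i j => X (r, i) (r, j))
  rw [← h2, ← h1]
  rfl

end Kraus

/-! ### A binomial identity -/

/-- Compare coefficients in (1-X)^(-m-1) (1-X)^(-l-1) = (1-X)^(-m-l-2). -/
theorem sum_choose_mul_choose (m l a : ℕ) :
    ∑ x ∈ Finset.HasAntidiagonal.antidiagonal a, (m + x.1).choose m * (l + x.2).choose l =
      (m + l + 1 + a).choose (m + l + 1) := by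
  have h := PowerSeries.mk_one_pow_eq_mk_choose_add ℤ
  have e : (PowerSeries.mk 1 : PowerSeries ℤ) ^ (m + 1) * PowerSeries.mk 1 ^ (l + 1) =
      PowerSeries.mk 1 ^ (m + l + 1 + 1) := by
    rw [← pow_add]; congr 1; ring
  rw [h, h, h] at e
  have e := congrArg (PowerSeries.coeff a) e
  rw [PowerSeries.coeff_mul] at e
  simp only [PowerSeries.coeff_mk] at e
  exact_mod_cast e

theorem choose_mul_choose_div (i j m l : ℕ) :
    ((m + l).choose m : ℝ) * ((i + j).choose i / ((i + j + (m + l)).choose (i + m))) =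
      ((m + i).choose m * (l + j).choose l : ℝ) / (m + l + (i + j)).choose (m + l) := by
  have e1 : i + j + (m + l) = (i + m) + (j + l) := by ring
  rw [e1, Nat.cast_add_choose ℝ, Nat.cast_add_choose ℝ, Nat.cast_add_choose ℝ,
    Nat.cast_add_choose ℝ, Nat.cast_add_choose ℝ, Nat.cast_add_choose ℝ,
    show i + m + (j + l) = m + l + (i + j) by ring, show i + m = m + i by ring,
    show j + l = l + j by ring]
  have := fun k : ℕ => (Nat.cast_ne_zero (R := ℝ)).2 (Nat.factorial_ne_zero k)
  have h1 := this (m + l)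
  have h2 := this (i + j)
  have h3 := this (m + i)
  have h4 := this (l + j)
  have h5 := this (m + l + (i + j))
  have := this i
  have := (Nat.cast_ne_zero (R := ℝ)).2 (Nat.factorial_ne_zero j)
  have := (Nat.cast_ne_zero (R := ℝ)).2 (Nat.factorial_ne_zero m)
  have := (Nat.cast_ne_zero (R := ℝ)).2 (Nat.factorial_ne_zero l)
  field_simp

/-- The value does not depend on m. This gives both the trace preservation of cloning and the equal
contribution of all weights to the fidelity. -/
theorem choose_mul_sum_choose_div {n m : ℕ} (hm : m ≤ n) (a : ℕ) :
    (n.choose m : ℝ) * ∑ i : Spin a, ((a.choose i : ℝ) / (a + n).choose (i + m)) =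
      (a + n + 1) / (n + 1) := by
  obtain ⟨l, rfl⟩ := Nat.exists_eq_add_of_le hm
  rw [Fin.sum_univ_eq_sum_range fun i => (a.choose i : ℝ) / (a + (m + l)).choose (i + m),
    ← Finset.Nat.sum_antidiagonal_eq_sum_range_succ_mk
      (fun x : ℕ × ℕ => (a.choose x.1 : ℝ) / (a + (m + l)).choose (x.1 + m)), Finset.mul_sum]
  have : ∀ x ∈ Finset.HasAntidiagonal.antidiagonal a, ((m + l).choose m : ℝ) *
      ((a.choose x.1 : ℝ) / (a + (m + l)).choose (x.1 + m)) =
      (((m + x.1).choose m * (l + x.2).choose l : ℕ) : ℝ) / (m + l + a).choose (m + l) := by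
    rintro ⟨i, j⟩ hx
    rw [Finset.HasAntidiagonal.mem_antidiagonal] at hx
    subst hx
    rw [choose_mul_choose_div]
    push_cast
    rfl
  rw [Finset.sum_congr rfl this, ← Finset.sum_div, ← Nat.cast_sum, sum_choose_mul_choose]
  have h := Nat.add_one_mul_choose_eq (m + l + a) (m + l)
  rw [show m + l + a + 1 = m + l + 1 + a by ring] at h
  have h' : ((m + l + 1 + a : ℕ) : ℝ) * ((m + l + a).choose (m + l) : ℕ) =
      ((m + l + 1 + a).choose (m + l + 1) : ℕ) * ((m + l + 1 : ℕ) : ℝ) := by exact_mod_cast h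
  have h0 : (((m + l + a).choose (m + l) : ℕ) : ℝ) ≠ 0 :=
    Nat.cast_ne_zero.2 (Nat.choose_pos (by omega)).ne'
  push_cast at h' ⊢
  rw [div_eq_div_iff h0 (by positivity)]
  linarith

/-! ### Adjoining and discarding qubits -/

/-- The operator adjoining `n` qubits in the computational basis state `u`. -/
noncomputable def slot (a : ℕ) {n : ℕ} (u : Qubits n) : Matrix (Qubits (a + n)) (Qubits a) ℂ :=
  Matrix.of fun s t => if s = Fin.append t u then 1 else 0

theorem append_inj {a n : ℕ} {s t : Qubits a} {u v : Qubits n} :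
    (Fin.append s u : Qubits (a + n)) = Fin.append t v ↔ s = t ∧ u = v := by
  have := (Fin.appendEquiv a n (α := Fin 2)).injective.eq_iff (a := (s, u)) (b := (t, v))
  simpa [Fin.appendEquiv] using this

theorem append_agree_iff {a n : ℕ} (s t : Qubits a) (u v : Qubits n) :
    (∀ k : Fin (a + n), a ≤ (k : ℕ) → Fin.append s u k = Fin.append t v k) ↔ u = v := by
  constructor
  · intro h
    ext k
    have := h (Fin.natAdd a k) (by simp)
    simp only [Fin.append_right] at this
    rw [this]
  · rintro rfl k hk
    obtain ⟨j, rfl⟩ : ∃ j : Fin n, k = Fin.natAdd a j :=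
      ⟨⟨k - a, by omega⟩, Fin.ext (by simp; omega)⟩
    simp

theorem slot_conjTranspose_mul {a n : ℕ} {κ : Type*} (u : Qubits n)
    (X : Matrix (Qubits (a + n)) κ ℂ) (s : Qubits a) (k : κ) :
    ((slot a u)ᴴ * X) s k = X (Fin.append s u) k := by
  simp [Matrix.mul_apply, slot, apply_ite]

theorem mul_slot {a n : ℕ} {κ : Type*} (u : Qubits n) (X : Matrix κ (Qubits (a + n)) ℂ)
    (k : κ) (t : Qubits a) : (X * slot a u) k t = X k (Fin.append t u) := by
  simp [Matrix.mul_apply, slot]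

theorem slot_mul {a n : ℕ} {κ : Type*} (u v : Qubits n) (X : Matrix (Qubits a) κ ℂ)
    (s : Qubits a) (k : κ) :
    (slot a u * X) (Fin.append s v) k = if v = u then X s k else 0 := by
  simp only [Matrix.mul_apply, slot, Matrix.of_apply, append_inj]
  by_cases h : v = u <;> simp [h]

theorem mul_slot_conjTranspose {a n : ℕ} {κ : Type*} (u v : Qubits n) (X : Matrix κ (Qubits a) ℂ)
    (k : κ) (t : Qubits a) :
    (X * (slot a u)ᴴ) k (Fin.append t v) = if v = u then X k t else 0 := by
  simp only [Matrix.mul_apply, slot, Matrix.conjTranspose_apply, Matrix.of_apply, append_inj]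
  by_cases h : v = u <;> simp [h, apply_ite]

theorem adjoin_eq (a n : ℕ) (X : Matrix (Qubits a) (Qubits a) ℂ) :
    adjoin (Nat.le_add_right a n) X = ∑ u : Qubits n, slot a u * X * (slot a u)ᴴ := by
  ext s t
  obtain ⟨s, u, rfl⟩ := exists_append s
  obtain ⟨t, v, rfl⟩ := exists_append t
  rw [Matrix.sum_apply]
  simp only [mul_slot_conjTranspose, slot_mul]
  change (if ∀ k : Fin (a + n), a ≤ (k : ℕ) → Fin.append s u k = Fin.append t v k then
    X (Fin.append s u ∘ Fin.castAdd n) (Fin.append t v ∘ Fin.castAdd n) else 0) = _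
  rw [append_comp_castAdd, append_comp_castAdd, if_congr (append_agree_iff s t u v) rfl rfl]
  by_cases h : u = v
  · subst h; simp
  · simp [h]

theorem discard_eq (b n : ℕ) (X : Matrix (Qubits (b + n)) (Qubits (b + n)) ℂ) :
    discard (Nat.le_add_right b n) X = ∑ u : Qubits n, (slot b u)ᴴ * X * slot b u := by
  ext s t
  rw [Matrix.sum_apply]
  simp only [mul_slot, slot_conjTranspose_mul]
  change (∑ x : Qubits (b + n), ∑ y : Qubits (b + n), if x ∘ Fin.castAdd n = s ∧
    y ∘ Fin.castAdd n = t ∧ ∀ k : Fin (b + n), b ≤ (k : ℕ) → x k = y k then X x y else 0) = _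
  rw [sum_append, Finset.sum_comm]
  refine Finset.sum_congr rfl fun u _ => ?_
  rw [Finset.sum_eq_single s]
  · rw [sum_append, Finset.sum_eq_single t, Finset.sum_eq_single u]
    · rw [if_pos ⟨append_comp_castAdd _ _, append_comp_castAdd _ _, fun k hk =>
        (append_agree_iff s t u u).2 rfl k hk⟩]
    · intro v _ hv
      rw [if_neg]
      rintro ⟨-, -, h⟩
      exact hv ((append_agree_iff s t u v).1 h).symm
    · simp
    · intro x _ hx
      refine Finset.sum_eq_zero fun v _ => if_neg ?_
      rintro ⟨-, h, -⟩
      rw [append_comp_castAdd] at h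
      exact hx h
    · simp
  · intro x _ hx
    refine Finset.sum_eq_zero fun v _ => if_neg ?_
    rintro ⟨h, -, -⟩
    rw [append_comp_castAdd] at h
    exact hx h
  · simp

theorem sum_slot_mul_conjTranspose (a n : ℕ) :
    ∑ u : Qubits n, slot a u * (slot a u)ᴴ = 1 := by
  ext s t
  obtain ⟨s, u, rfl⟩ := exists_append s
  obtain ⟨t, v, rfl⟩ := exists_append t
  rw [Matrix.sum_apply]
  simp only [mul_slot_conjTranspose]
  have : ∀ w, (slot a w) (Fin.append s u) t = if s = t ∧ u = w then (1 : ℂ) else 0 := by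
    intro w
    simp [slot, append_inj]
  simp only [this, Matrix.one_apply, append_inj]
  by_cases h : u = v
  · subst h; simp
  · simp [h, eq_comm (a := v)]

/-- Rotating before adjoining u equals rotating everything after adjoining the back-rotated u,
expanded in the computational basis. This is the covariance of cloning. -/
theorem slot_mul_tensorPow {a n : ℕ} {h : Matrix (Fin 2) (Fin 2) ℂ}
    (hh : h * hᴴ = 1) (u : Qubits n) :
    slot a u * tensorPow a h =
      ∑ v : Qubits n, (tensorPow n h)ᴴ v u • (tensorPow (a + n) h * slot a v) := by
  ext s t
  obtain ⟨s, w, rfl⟩ := exists_append s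
  rw [slot_mul, Matrix.sum_apply]
  simp only [Matrix.smul_apply, mul_slot, tensorPow_append, smul_eq_mul]
  have : ∑ v, (tensorPow n h)ᴴ v u * (tensorPow a h s t * tensorPow n h w v) =
      tensorPow a h s t * (tensorPow n h * (tensorPow n h)ᴴ) w u := by
    rw [Matrix.mul_apply, Finset.mul_sum]
    exact Finset.sum_congr rfl fun v _ => by ring
  rw [this, tensorPow_conjTranspose, tensorPow_mul, hh, tensorPow_one, Matrix.one_apply]
  split <;> simp

theorem slot_conjTranspose_mul_tensorPow {b n : ℕ} (h : Matrix (Fin 2) (Fin 2) ℂ) (u : Qubits n) :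
    (slot b u)ᴴ * tensorPow (b + n) h =
      ∑ v : Qubits n, (tensorPow n h)ᵀ v u • (tensorPow b h * (slot b v)ᴴ) := by
  ext s t
  obtain ⟨t, w, rfl⟩ := exists_append t
  rw [slot_conjTranspose_mul, Matrix.sum_apply]
  simp only [Matrix.smul_apply, mul_slot_conjTranspose, tensorPow_append, smul_eq_mul,
    Matrix.transpose_apply]
  simp [mul_comm]

/-! ### The operators inserting a number state into a symmetric state -/

/-- The operator `slot` between symmetric subspaces. -/
noncomputable def spinSlot (a : ℕ) {n : ℕ} (u : Qubits n) : Matrix (Spin (a + n)) (Spin a) ℂ :=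
  (dicke (a + n))ᴴ * slot a u * dicke a

theorem spinSlot_apply {a n : ℕ} (u : Qubits n) (k : Spin (a + n)) (i : Spin a) :
    spinSlot a u k i =
      if (i : ℕ) + weight u = k then rootChoose a i * (rootChoose (a + n) k)⁻¹ else 0 := by
  rw [spinSlot, Matrix.mul_apply]
  simp only [mul_slot, Matrix.conjTranspose_apply, star_dicke_apply]
  have : ∀ t : Qubits a, dicke (a + n) (Fin.append t u) k * dicke a t i =
      (if weight t = (i : ℕ) then 1 else 0) *
      (if (i : ℕ) + weight u = k then (rootChoose (a + n) k)⁻¹ * (rootChoose a i)⁻¹ else 0) := by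
    intro t
    rw [dicke_apply, dicke_apply, weight_append]
    by_cases h : weight t = (i : ℕ)
    · rw [h, if_pos rfl, if_pos rfl, one_mul]
      split <;> simp
    · rw [if_neg h, if_neg h, mul_zero, zero_mul]
  rw [Finset.sum_congr rfl fun t _ => this t, ← Finset.sum_mul, card_weight_eq, ← rootChoose_sq]
  have h1 := rootChoose_ne_zero i
  split
  · field_simp
  · simp

theorem star_spinSlot_apply {a n : ℕ} (u : Qubits n) (k : Spin (a + n)) (i : Spin a) :
    star (spinSlot a u k i) = spinSlot a u k i := by
  rw [spinSlot_apply]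
  split
  · rw [star_mul', star_inv₀, star_rootChoose, star_rootChoose]
  · simp

theorem sum_spinSlot_mul {a n : ℕ} (u v : Qubits n) (i j : Spin a) :
    ∑ k, spinSlot a u k i * spinSlot a v k j =
      if (i : ℕ) + weight u = j + weight v then
        rootChoose a i * rootChoose a j * ((a + n).choose (i + weight u) : ℂ)⁻¹ else 0 := by
  have hk : (i : ℕ) + weight u < a + n + 1 := by have := weight_le u; omega
  rw [Finset.sum_eq_single (⟨(i : ℕ) + weight u, hk⟩ : Spin (a + n))]
  · rw [spinSlot_apply, spinSlot_apply, if_pos rfl]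
    simp only [eq_comm (a := (j : ℕ) + weight v)]
    split
    · rw [← rootChoose_sq, mul_inv]; ring
    · simp
  · intro k _ hk'
    rw [spinSlot_apply, if_neg, zero_mul]
    intro h
    exact hk' (Fin.ext h.symm)
  · simp

theorem sum_sum_spinSlot {a n : ℕ} (u v : Qubits n) :
    ∑ i, ∑ k, spinSlot a u k i * spinSlot a v k i =
      ((if weight u = weight v then
        ∑ i : Spin a, ((a.choose i : ℝ) / (a + n).choose (i + weight u)) else 0 : ℝ) : ℂ) := by
  simp only [sum_spinSlot_mul, Nat.add_left_cancel_iff, rootChoose_sq]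
  split
  · push_cast
    rfl
  · simp

/-- Let S(m) be the trace for two states of equal weight m; unequal weights give zero. There are (n
choose m)² pairs of weight m, and (n choose m) S(m) = (a+n+1)/(n+1), so the n + 1 weights contribute
equally. -/
theorem sum_norm_sq_spinSlot (a n : ℕ) :
    ∑ u : Qubits n, ∑ v : Qubits n, ‖∑ i, ∑ k, spinSlot a u k i * spinSlot a v k i‖ ^ 2 =
      ((a : ℝ) + n + 1) ^ 2 / (n + 1) := by
  set S : ℕ → ℝ := fun m => ∑ i : Spin a, ((a.choose i : ℝ) / (a + n).choose (i + m)) with hS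
  have h1 : ∀ u v : Qubits n, ‖∑ i, ∑ k, spinSlot a u k i * spinSlot a v k i‖ ^ 2 =
      (if weight v = weight u then 1 else 0) * S (weight u) ^ 2 := by
    intro u v
    rw [sum_sum_spinSlot, Complex.norm_real, Real.norm_eq_abs, sq_abs]
    simp only [eq_comm (a := weight u)]
    split <;> simp [hS]
  have hc : ∀ j, ∑ t : Qubits n, (if weight t = j then (1 : ℝ) else 0) = n.choose j := by
    intro j
    have := card_weight_eq n j
    apply Complex.ofReal_injective
    push_cast
    rw [← this]
    exact Finset.sum_congr rfl fun t _ => by split <;> simp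
  have h2 : ∑ u : Qubits n, (n.choose (weight u) : ℝ) * S (weight u) ^ 2 =
      ∑ j : Spin n, (n.choose j : ℝ) * ((n.choose j : ℝ) * S j ^ 2) := by
    apply Complex.ofReal_injective
    have := sum_comp_weight n fun j => (((n.choose j : ℝ) * S j ^ 2 : ℝ) : ℂ)
    push_cast at this ⊢
    exact this
  simp only [h1, ← Finset.sum_mul, hc]
  rw [h2]
  have h3 : ∀ j : Spin n, (n.choose j : ℝ) * ((n.choose j : ℝ) * S j ^ 2) =
      (((a : ℝ) + n + 1) / (n + 1)) ^ 2 := by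
    intro j
    rw [← choose_mul_sum_choose_div (Nat.le_of_lt_succ j.2) a]
    ring
  rw [Finset.sum_congr rfl fun j _ => h3 j]
  simp only [Finset.sum_const, Finset.card_univ, Fintype.card_fin, nsmul_eq_mul]
  push_cast
  have : (n : ℝ) + 1 ≠ 0 := by positivity
  field_simp

/-- The same binomial identity with the roles of a and n exchanged. The scalar is the inverse of the
normalisation factor of the cloning map. -/
theorem sum_spinSlot_conjTranspose_mul (a n : ℕ) :
    ∑ u : Qubits n, (spinSlot a u)ᴴ * spinSlot a u =
      (((a : ℂ) + n + 1) / (a + 1)) • (1 : Matrix (Spin a) (Spin a) ℂ) := by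
  ext i j
  rw [Matrix.sum_apply]
  simp only [Matrix.mul_apply, Matrix.conjTranspose_apply, star_spinSlot_apply, sum_spinSlot_mul,
    Nat.add_right_cancel_iff]
  rw [Matrix.smul_apply]
  by_cases hij : i = j
  · subst hij
    simp only [if_true, rootChoose_sq, Matrix.one_apply_eq]
    rw [sum_comp_weight n fun m => (a.choose i : ℂ) * ((a + n).choose (i + m) : ℂ)⁻¹]
    have h := choose_mul_sum_choose_div (Nat.le_of_lt_succ i.2) n
    rw [Finset.mul_sum] at h
    have h := congrArg (fun x : ℝ => (x : ℂ)) h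
    push_cast at h
    rw [smul_eq_mul, mul_one, add_comm (a : ℂ), ← h]
    refine Finset.sum_congr rfl fun m _ => ?_
    rw [add_comm n a, add_comm (m : ℕ) (i : ℕ)]
    ring
  · simp [hij, Fin.val_inj]

/-! ### Cloning and discarding -/

theorem cloneOrDiscard_add (a n : ℕ) (X : Matrix (Qubits a) (Qubits a) ℂ) :
    cloneOrDiscard a (a + n) X = (((a : ℂ) + 1) / ((a : ℂ) + n + 1)) • (symProj (a + n) *
      (∑ u : Qubits n, slot a u * X * (slot a u)ᴴ) * symProj (a + n)) := by
  rw [cloneOrDiscard, dif_pos (Nat.le_add_right a n), LinearMap.smul_apply, LinearMap.comp_apply,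
    adjoin_eq, conjMap_apply, symProj_conjTranspose]
  push_cast
  rfl

/-- For n = 0 the definition takes the cloning branch, hence the hypothesis. -/
theorem cloneOrDiscard_of_lt {b n : ℕ} (hn : n ≠ 0)
    (X : Matrix (Qubits (b + n)) (Qubits (b + n)) ℂ) :
    cloneOrDiscard (b + n) b X = ∑ u : Qubits n, (slot b u)ᴴ * X * slot b u := by
  rw [cloneOrDiscard, dif_neg (by omega), discard_eq]

/-- A square root of the normalisation of the cloning map. -/
noncomputable def cloneNorm (a n : ℕ) : ℂ := ((√(((a : ℝ) + 1) / ((a : ℝ) + n + 1)) : ℝ) : ℂ)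

theorem cloneNorm_mul_self (a n : ℕ) :
    cloneNorm a n * cloneNorm a n = ((a : ℂ) + 1) / ((a : ℂ) + n + 1) := by
  rw [cloneNorm, ← Complex.ofReal_mul, Real.mul_self_sqrt (by positivity)]
  push_cast; rfl

theorem star_cloneNorm (a n : ℕ) : star (cloneNorm a n) = cloneNorm a n := by
  simp [cloneNorm]

theorem smul_mul_mul_conjTranspose_smul {m n : Type*} [Fintype m] (a k : ℕ) (K : Matrix n m ℂ)
    (X : Matrix m m ℂ) : (cloneNorm a k • K) * X * (cloneNorm a k • K)ᴴ =
      (((a : ℂ) + 1) / ((a : ℂ) + k + 1)) • (K * X * Kᴴ) := by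
  rw [Matrix.conjTranspose_smul, star_cloneNorm, Matrix.smul_mul, Matrix.smul_mul,
    Matrix.mul_smul, smul_smul, cloneNorm_mul_self]

theorem isCompletelyPositive_cloneOrDiscard (a b : ℕ) :
    IsCompletelyPositive (cloneOrDiscard a b) := by
  rcases le_or_gt a b with h | h
  · obtain ⟨n, rfl⟩ := Nat.exists_eq_add_of_le h
    refine isCompletelyPositive_of_kraus
      (fun u : Qubits n => cloneNorm a n • (symProj (a + n) * slot a u)) fun X => ?_
    rw [cloneOrDiscard_add, Matrix.mul_sum, Matrix.sum_mul, Finset.smul_sum]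
    refine Finset.sum_congr rfl fun u _ => ?_
    rw [smul_mul_mul_conjTranspose_smul, Matrix.conjTranspose_mul, symProj_conjTranspose]
    simp only [Matrix.mul_assoc]
  · obtain ⟨n, rfl⟩ := Nat.exists_eq_add_of_le h.le
    refine isCompletelyPositive_of_kraus (fun u : Qubits n => (slot b u)ᴴ) fun X => ?_
    rw [cloneOrDiscard_of_lt (by omega)]
    simp only [Matrix.conjTranspose_conjTranspose]

theorem symProj_mul_self (a : ℕ) : symProj a * symProj a = symProj a := by
  nth_rw 2 [symProj]
  rw [← Matrix.mul_assoc, symProj_mul_dicke, symProj]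

theorem symProj_mul_slot_conjTranspose_mul_dicke {b n : ℕ} (u : Qubits n) :
    symProj b * ((slot b u)ᴴ * dicke (b + n)) = (slot b u)ᴴ * dicke (b + n) := by
  refine symProj_mul_of_weight _ fun s t k hst => ?_
  rw [slot_conjTranspose_mul, slot_conjTranspose_mul, dicke_apply, dicke_apply, weight_append,
    weight_append, hst]

theorem eq_dicke_conj {a : ℕ} {X : Matrix (Qubits a) (Qubits a) ℂ}
    (hX : symProj a * X * symProj a = X) : X = dicke a * ((dicke a)ᴴ * X * dicke a) * (dicke a)ᴴ := by
  conv_lhs => rw [← hX]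
  simp only [symProj, Matrix.mul_assoc]

theorem cloneOrDiscard_dicke_conj_add (a n : ℕ) (Z : Matrix (Spin a) (Spin a) ℂ) :
    cloneOrDiscard a (a + n) (dicke a * Z * (dicke a)ᴴ) =
      dicke (a + n) * (∑ u : Qubits n, (cloneNorm a n • spinSlot a u) * Z *
        (cloneNorm a n • spinSlot a u)ᴴ) * (dicke (a + n))ᴴ := by
  simp only [smul_mul_mul_conjTranspose_smul]
  rw [cloneOrDiscard_add, ← Finset.smul_sum, Matrix.mul_smul, Matrix.smul_mul, Matrix.mul_sum,
    Matrix.mul_sum, Matrix.sum_mul, Matrix.sum_mul]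
  congr 1
  refine Finset.sum_congr rfl fun u _ => ?_
  simp only [symProj, spinSlot, Matrix.conjTranspose_mul, Matrix.conjTranspose_conjTranspose,
    Matrix.mul_assoc]

theorem cloneOrDiscard_dicke_conj_of_lt {b n : ℕ} (hn : n ≠ 0)
    (Z : Matrix (Spin (b + n)) (Spin (b + n)) ℂ) :
    cloneOrDiscard (b + n) b (dicke (b + n) * Z * (dicke (b + n))ᴴ) =
      dicke b * (∑ u : Qubits n, (spinSlot b u)ᴴ * Z * ((spinSlot b u)ᴴ)ᴴ) * (dicke b)ᴴ := by
  rw [cloneOrDiscard_of_lt hn, Matrix.mul_sum, Matrix.sum_mul]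
  refine Finset.sum_congr rfl fun u _ => ?_
  have h1 : dicke b * (spinSlot b u)ᴴ = (slot b u)ᴴ * dicke (b + n) := by
    rw [← symProj_mul_slot_conjTranspose_mul_dicke]
    simp only [symProj, spinSlot, Matrix.conjTranspose_mul, Matrix.conjTranspose_conjTranspose,
      Matrix.mul_assoc]
  have h2 := congrArg Matrix.conjTranspose h1
  simp only [Matrix.conjTranspose_mul, Matrix.conjTranspose_conjTranspose] at h2
  calc (slot b u)ᴴ * (dicke (b + n) * Z * (dicke (b + n))ᴴ) * slot b u
      = ((slot b u)ᴴ * dicke (b + n)) * Z * ((dicke (b + n))ᴴ * slot b u) := by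
        simp only [Matrix.mul_assoc]
    _ = _ := by rw [← h1, ← h2, Matrix.conjTranspose_conjTranspose]; simp only [Matrix.mul_assoc]

/-- On the symmetric subspace, cloning and discarding are given by explicit Kraus operators between
spins. -/
theorem exists_kraus_cloneOrDiscard (a b : ℕ) :
    ∃ (n : ℕ) (K : Qubits n → Matrix (Spin b) (Spin a) ℂ),
      (∀ Z : Matrix (Spin a) (Spin a) ℂ, cloneOrDiscard a b (dicke a * Z * (dicke a)ᴴ) =
        dicke b * (∑ u, K u * Z * (K u)ᴴ) * (dicke b)ᴴ) ∧
      ∑ u, (K u)ᴴ * K u = 1 ∧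
      (∀ h ∈ Matrix.specialUnitaryGroup (Fin 2) ℂ, ∃ w : Matrix (Qubits n) (Qubits n) ℂ,
        w * wᴴ = 1 ∧ ∀ u, K u * spinRep a h = ∑ v, w v u • (spinRep b h * K v)) ∧
      ∑ u, ∑ v, ‖∑ i, ∑ p, K u p i * K v p i‖ ^ 2 = ((a : ℝ) + 1) ^ 2 / (|(a : ℝ) - b| + 1) := by
  rcases le_or_gt a b with h | h
  · obtain ⟨n, rfl⟩ := Nat.exists_eq_add_of_le h
    -- Cloning inserts a basis state u of the new qubits and projects on the symmetric subspace.
    refine ⟨n, fun u => cloneNorm a n • spinSlot a u, cloneOrDiscard_dicke_conj_add a n, ?_, ?_, ?_⟩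
    · simp only [Matrix.conjTranspose_smul, star_cloneNorm, Matrix.smul_mul, Matrix.mul_smul,
        smul_smul, cloneNorm_mul_self]
      rw [← Finset.smul_sum, sum_spinSlot_conjTranspose_mul, smul_smul]
      have h1 : (a : ℂ) + 1 ≠ 0 := by exact_mod_cast Nat.succ_ne_zero a
      have h2 : (a : ℂ) + n + 1 ≠ 0 := by exact_mod_cast Nat.succ_ne_zero (a + n)
      rw [div_mul_div_comm, mul_comm, div_self (mul_ne_zero h2 h1), one_smul]
    · intro h hh
      have h1 := conjTranspose_mul_of_mem hh
      refine ⟨(tensorPow n h)ᴴ, ?_, fun u => ?_⟩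
      · rw [Matrix.conjTranspose_conjTranspose, tensorPow_conjTranspose, tensorPow_mul, h1.1,
          tensorPow_one]
      · rw [Matrix.smul_mul, spinSlot, Matrix.mul_assoc, dicke_mul_spinRep, ← Matrix.mul_assoc,
          Matrix.mul_assoc _ (slot a u), slot_mul_tensorPow h1.2, Matrix.mul_sum, Matrix.sum_mul,
          Finset.smul_sum]
        refine Finset.sum_congr rfl fun v _ => ?_
        rw [Matrix.mul_smul, Matrix.smul_mul, Matrix.mul_smul, smul_comm, spinSlot,
          ← Matrix.mul_assoc, ← spinRep_mul_dicke]
        simp only [Matrix.mul_assoc]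
    · have h1 : ∀ u v : Qubits n, ‖∑ i, ∑ p, (cloneNorm a n • spinSlot a u) p i *
          (cloneNorm a n • spinSlot a v) p i‖ ^ 2 = (((a : ℝ) + 1) / ((a : ℝ) + n + 1)) ^ 2 *
          ‖∑ i, ∑ p, spinSlot a u p i * spinSlot a v p i‖ ^ 2 := by
        intro u v
        have : ∑ i, ∑ p, (cloneNorm a n • spinSlot a u) p i * (cloneNorm a n • spinSlot a v) p i =
            ((((a : ℝ) + 1) / ((a : ℝ) + n + 1) : ℝ) : ℂ) *
              ∑ i, ∑ p, spinSlot a u p i * spinSlot a v p i := by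
          push_cast
          rw [← cloneNorm_mul_self]
          simp only [Finset.mul_sum, Matrix.smul_apply, smul_eq_mul]
          refine Finset.sum_congr rfl fun i _ => Finset.sum_congr rfl fun p _ => ?_
          ring
        rw [this, norm_mul, Complex.norm_real, mul_pow, Real.norm_eq_abs, sq_abs]
      simp only [h1, ← Finset.mul_sum]
      rw [sum_norm_sq_spinSlot]
      push_cast
      rw [show (a : ℝ) - (a + n) = -n by ring, abs_neg, Nat.abs_cast]
      field_simp
  · obtain ⟨n, rfl⟩ := Nat.exists_eq_add_of_le h.le
    have hn : n ≠ 0 := by omega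
    -- Up to normalisation, discarding has the adjoints of the Kraus operators of cloning, so the
    -- same sum of squared traces serves both cases.
    refine ⟨n, fun u => (spinSlot b u)ᴴ, cloneOrDiscard_dicke_conj_of_lt hn, ?_, ?_, ?_⟩
    · have e : ∀ u : Qubits n, ((spinSlot b u)ᴴ)ᴴ * (spinSlot b u)ᴴ =
          (dicke (b + n))ᴴ * (slot b u * (slot b u)ᴴ) * dicke (b + n) := by
        intro u
        rw [Matrix.mul_assoc (dicke (b + n))ᴴ, Matrix.mul_assoc (slot b u),
          ← symProj_mul_slot_conjTranspose_mul_dicke]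
        simp only [symProj, spinSlot, Matrix.conjTranspose_mul, Matrix.conjTranspose_conjTranspose,
          Matrix.mul_assoc]
      simp only [e]
      rw [← Matrix.sum_mul, ← Matrix.mul_sum, sum_slot_mul_conjTranspose, Matrix.mul_one,
        dicke_conjTranspose_mul_dicke]
    · intro h hh
      have h1 := conjTranspose_mul_of_mem hh
      refine ⟨(tensorPow n h)ᵀ, ?_, fun u => ?_⟩
      · have h2 : ((tensorPow n h)ᴴ * tensorPow n h)ᵀ = 1 := by
          rw [tensorPow_conjTranspose, tensorPow_mul, h1.1, tensorPow_one, Matrix.transpose_one]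
        rw [Matrix.transpose_mul] at h2
        exact h2
      · have e : ∀ u : Qubits n, (spinSlot b u)ᴴ = (dicke b)ᴴ * ((slot b u)ᴴ * dicke (b + n)) := by
          intro u
          simp [spinSlot]
        simp only
        rw [e, Matrix.mul_assoc, Matrix.mul_assoc, dicke_mul_spinRep, ← Matrix.mul_assoc (slot b u)ᴴ,
          slot_conjTranspose_mul_tensorPow, Matrix.sum_mul, Matrix.mul_sum]
        refine Finset.sum_congr rfl fun v _ => ?_
        rw [Matrix.smul_mul, Matrix.mul_smul, e, ← Matrix.mul_assoc (spinRep b h),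
          spinRep_mul_dicke]
        simp only [Matrix.mul_assoc]
    · have h1 : ∀ u v : Qubits n, ∑ i, ∑ p, (spinSlot b u)ᴴ p i * (spinSlot b v)ᴴ p i =
          ∑ i, ∑ p, spinSlot b u p i * spinSlot b v p i := by
        intro u v
        simp only [Matrix.conjTranspose_apply, star_spinSlot_apply]
        exact Finset.sum_comm
      simp only [h1]
      rw [sum_norm_sq_spinSlot]
      push_cast
      rw [show (b : ℝ) + n - b = n by ring, Nat.abs_cast]

theorem trace_cloneOrDiscard {a b : ℕ} {X : Matrix (Qubits a) (Qubits a) ℂ}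
    (hX : symProj a * X * symProj a = X) : (cloneOrDiscard a b X).trace = X.trace := by
  obtain ⟨n, K, hK, hK1, -, -⟩ := exists_kraus_cloneOrDiscard a b
  have ht : ∀ (c : ℕ) (Z : Matrix (Spin c) (Spin c) ℂ),
      (dicke c * Z * (dicke c)ᴴ).trace = Z.trace := by
    intro c Z
    rw [Matrix.mul_assoc, Matrix.trace_mul_comm, Matrix.mul_assoc, dicke_conjTranspose_mul_dicke,
      Matrix.mul_one]
  rw [eq_dicke_conj hX, hK, ht, ht, trace_sum_kraus, hK1, Matrix.one_mul]

theorem symProj_dicke_conj (a : ℕ) (Z : Matrix (Spin a) (Spin a) ℂ) :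
    symProj a * (dicke a * Z * (dicke a)ᴴ) * symProj a = dicke a * Z * (dicke a)ᴴ := by
  rw [← Matrix.mul_assoc, ← Matrix.mul_assoc, symProj_mul_dicke, Matrix.mul_assoc,
    dicke_mul_symProj]

theorem symProj_cloneOrDiscard {a b : ℕ} {X : Matrix (Qubits a) (Qubits a) ℂ}
    (hX : symProj a * X * symProj a = X) :
    symProj b * cloneOrDiscard a b X * symProj b = cloneOrDiscard a b X := by
  obtain ⟨n, K, hK, -, -, -⟩ := exists_kraus_cloneOrDiscard a b
  rw [eq_dicke_conj hX, hK, symProj_dicke_conj]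

/-! ### Encoding and decoding -/

theorem isChannel_encode (a : ℕ) : IsChannel (encode a) := by
  refine ⟨isCompletelyPositive_of_kraus (fun _ : Unit => dicke a) fun X => by
    simp [encode, conjMap_apply], fun X => ?_⟩
  rw [encode, conjMap_apply, Matrix.mul_assoc, Matrix.trace_mul_comm, Matrix.mul_assoc,
    dicke_conjTranspose_mul_dicke, Matrix.mul_one]

/-- Invert the encoding on the symmetric subspace, and send everything orthogonal to it to the basis
vector 0 by the operators |0⟩⟨s|(1 - P), which restores trace preservation. -/
theorem exists_isDecoder (b : ℕ) : ∃ D, IsDecoder b D := by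
  let E : Qubits b → Matrix (Spin b) (Qubits b) ℂ := fun s =>
    Matrix.of fun i t => if i = 0 then (1 - symProj b) s t else 0
  let K : Option (Qubits b) → Matrix (Spin b) (Qubits b) ℂ := fun o => o.elim (dicke b)ᴴ E
  have hK : ∀ X, (∑ o, conjMap (K o)) X = ∑ o, K o * X * (K o)ᴴ := fun X => by
    rw [LinearMap.sum_apply]; rfl
  have hE : ∑ s, (E s)ᴴ * E s = 1 - symProj b := by
    have h1 : (1 - symProj b)ᴴ * (1 - symProj b) = 1 - symProj b := by
      rw [Matrix.conjTranspose_sub, Matrix.conjTranspose_one, symProj_conjTranspose, Matrix.mul_sub,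
        Matrix.sub_mul, Matrix.sub_mul, symProj_mul_self]
      simp
    conv_rhs => rw [← h1]
    ext t t'
    rw [Matrix.sum_apply, Matrix.mul_apply]
    refine Finset.sum_congr rfl fun s _ => ?_
    rw [Matrix.mul_apply, Finset.sum_eq_single 0]
    · simp [E]
    · intro i _ hi
      simp [E, hi]
    · simp
  refine ⟨∑ o, conjMap (K o), ⟨isCompletelyPositive_of_kraus K hK, fun X => ?_⟩, fun X => ?_⟩
  · rw [hK, trace_sum_kraus, Fintype.sum_option]
    have : (K none)ᴴ * K none + ∑ s, (K (some s))ᴴ * K (some s) = 1 := by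
      change ((dicke b)ᴴ)ᴴ * (dicke b)ᴴ + ∑ s, (E s)ᴴ * E s = 1
      rw [hE, Matrix.conjTranspose_conjTranspose, symProj]
      simp
    rw [this, Matrix.one_mul]
  · rw [hK, Fintype.sum_option, Finset.sum_eq_zero, add_zero]
    · change (dicke b)ᴴ * (dicke b * X * (dicke b)ᴴ) * ((dicke b)ᴴ)ᴴ = X
      rw [Matrix.conjTranspose_conjTranspose, Matrix.mul_assoc (dicke b), ← Matrix.mul_assoc,
        dicke_conjTranspose_mul_dicke, Matrix.one_mul, Matrix.mul_assoc,
        dicke_conjTranspose_mul_dicke, Matrix.mul_one]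
    · intro s _
      change E s * (dicke b * X * (dicke b)ᴴ) * (E s)ᴴ = 0
      have : E s * dicke b = 0 := by
        have h0 : (1 - symProj b) * dicke b = 0 := by
          rw [Matrix.sub_mul, Matrix.one_mul, symProj_mul_dicke, sub_self]
        ext i j
        rw [Matrix.mul_apply]
        by_cases hi : i = 0
        · have := congrFun (congrFun h0 s) j
          rw [Matrix.mul_apply] at this
          simpa [E, hi] using this
        · simp [E, hi]
      rw [Matrix.mul_assoc (dicke b), ← Matrix.mul_assoc (E s), this, Matrix.zero_mul,
        Matrix.zero_mul]

/-! ### The local conversion -/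

theorem localConversion_apply {a b : ℕ}
    {D : Matrix (Qubits b) (Qubits b) ℂ →ₗ[ℂ] Matrix (Spin b) (Spin b) ℂ} (hD : IsDecoder b D)
    {ι : Type*} [Fintype ι] {K : ι → Matrix (Spin b) (Spin a) ℂ}
    (hK : ∀ Z : Matrix (Spin a) (Spin a) ℂ, cloneOrDiscard a b (dicke a * Z * (dicke a)ᴴ) =
        dicke b * (∑ u, K u * Z * (K u)ᴴ) * (dicke b)ᴴ) (X : Matrix (Spin a) (Spin a) ℂ) :
    localConversion a b D X = ∑ u, K u * X * (K u)ᴴ := by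
  change D (cloneOrDiscard a b (dicke a * X * (dicke a)ᴴ)) = _
  rw [hK]
  exact hD.2 _

theorem isChannel_localConversion {a b : ℕ}
    {D : Matrix (Qubits b) (Qubits b) ℂ →ₗ[ℂ] Matrix (Spin b) (Spin b) ℂ} (hD : IsDecoder b D) :
    IsChannel (localConversion a b D) := by
  obtain ⟨n, K, hK, hK1, -, -⟩ := exists_kraus_cloneOrDiscard a b
  have h := localConversion_apply hD hK
  refine ⟨isCompletelyPositive_of_kraus K h, fun X => ?_⟩
  rw [h, trace_sum_kraus, hK1, Matrix.one_mul]

theorem isChannel_tensorMap_localConversion {a b : ℕ}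
    {D : Matrix (Qubits b) (Qubits b) ℂ →ₗ[ℂ] Matrix (Spin b) (Spin b) ℂ} (hD : IsDecoder b D) :
    IsChannel (tensorMap (localConversion a b D) (localConversion a b D)) := by
  obtain ⟨n, K, hK, hK1, -, -⟩ := exists_kraus_cloneOrDiscard a b
  have h := localConversion_apply hD hK
  have hc := isChannel_localConversion (a := a) hD
  exact ⟨isCompletelyPositive_of_kraus _ (tensorMap_kraus K h K h), trace_tensorMap hc.2 hc.2⟩

/-- Between maximally entangled vectors the amplitude of K ⊗ L is, up to normalisation, the trace of
KᵀL. -/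
theorem bell_dotProduct_kronecker (a b : ℕ) (K L : Matrix (Spin b) (Spin a) ℂ) :
    star (bell b) ⬝ᵥ ((K ⊗ₖ L) *ᵥ bell a) =
      (((1 / √(b + 1 : ℝ)) * (1 / √(a + 1 : ℝ)) : ℝ) : ℂ) * ∑ i, ∑ p, K p i * L p i := by
  have h1 : ∀ p : Spin b × Spin b, ((K ⊗ₖ L) *ᵥ bell a) p =
      ∑ i, K p.1 i * L p.2 i * ((1 / √(a + 1 : ℝ) : ℝ) : ℂ) := by
    intro p
    simp only [Matrix.mulVec, dotProduct, Fintype.sum_prod_type, bell, Matrix.kroneckerMap_apply]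
    simp
  have h2 : ∀ y : Spin b × Spin b → ℂ, star (bell b) ⬝ᵥ y =
      ∑ p, ((1 / √(b + 1 : ℝ) : ℝ) : ℂ) * y (p, p) := by
    intro y
    simp only [dotProduct, Fintype.sum_prod_type, bell, Pi.star_apply, apply_ite star,
      Complex.star_def, Complex.conj_ofReal]
    simp
  rw [h2, Finset.sum_comm, Finset.mul_sum]
  refine Finset.sum_congr rfl fun p _ => ?_
  rw [h1, Finset.mul_sum, Finset.mul_sum]
  refine Finset.sum_congr rfl fun i _ => ?_
  push_cast
  ring

/-- The rotation acts on the first factor only; by covariance it can be moved through K_u at the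
price of a unitary mixing of the index u, which does not change the sum of squares. The value is
thus independent of g. -/
theorem overlap_tensorMap_localConversion (a b : ℕ)
    {D : Matrix (Qubits b) (Qubits b) ℂ →ₗ[ℂ] Matrix (Spin b) (Spin b) ℂ} (hD : IsDecoder b D)
    (g : SO3) : overlap a b (tensorMap (localConversion a b D) (localConversion a b D)) g =
      ((a : ℝ) + 1) / ((b + 1) * (|(a : ℝ) - b| + 1)) := by
  obtain ⟨n, K, hK, -, hcov, hsum⟩ := exists_kraus_cloneOrDiscard a b
  have h := localConversion_apply hD hK
  obtain ⟨w, hw, hKw⟩ := hcov (lift g) (lift_mem g)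
  set z : Qubits n → Qubits n → ℂ := fun u v => star (bell b) ⬝ᵥ ((K u ⊗ₖ K v) *ᵥ bell a) with hz
  have hval : ∀ u v, star (rotatedBell b g) ⬝ᵥ ((K u ⊗ₖ K v) *ᵥ rotatedBell a g) =
      ∑ u', z u' v * w u' u := by
    intro u v
    have h1 : (K u ⊗ₖ K v) * (rotation a g ⊗ₖ (1 : Matrix (Spin a) (Spin a) ℂ)) =
        ∑ u', w u' u • ((rotation b g ⊗ₖ (1 : Matrix (Spin b) (Spin b) ℂ)) * (K u' ⊗ₖ K v)) := by
      rw [← Matrix.mul_kronecker_mul, rotation_eq, hKw u, Matrix.mul_one]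
      simp only [← Matrix.mul_kronecker_mul, Matrix.one_mul, rotation_eq]
      ext x y
      simp [Matrix.sum_apply, Finset.sum_mul, mul_assoc]
    have h2 : (rotation b g ⊗ₖ (1 : Matrix (Spin b) (Spin b) ℂ))ᴴ *
        (rotation b g ⊗ₖ (1 : Matrix (Spin b) (Spin b) ℂ)) = 1 := by
      rw [Matrix.conjTranspose_kronecker, ← Matrix.mul_kronecker_mul, rotation_conjTranspose_mul,
        Matrix.conjTranspose_one, Matrix.one_mul, Matrix.one_kronecker_one]
    rw [rotatedBell, rotatedBell, Matrix.mulVec_mulVec, h1, Matrix.sum_mulVec, dotProduct_sum]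
    refine Finset.sum_congr rfl fun u' _ => ?_
    rw [Matrix.smul_mulVec, dotProduct_smul, Matrix.star_mulVec, ← Matrix.dotProduct_mulVec,
      Matrix.mulVec_mulVec, ← Matrix.mul_assoc, h2, Matrix.one_mul, smul_eq_mul, mul_comm]
  -- Parseval for the single unitary w, that is, for a family with one block.
  have hpars : ∀ v, ∑ u, ‖∑ u', z u' v * w u' u‖ ^ 2 = ∑ u, ‖z u v‖ ^ 2 := by
    intro v
    have := parseval (fun _ : Unit => w) (by simpa using hw) fun u => z u v
    simpa using this
  have hnorm : ∀ u v, ‖z u v‖ ^ 2 = (((a : ℝ) + 1) * (b + 1))⁻¹ *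
      ‖∑ i, ∑ p, K u p i * K v p i‖ ^ 2 := by
    intro u v
    rw [hz]
    simp only [bell_dotProduct_kronecker]
    rw [norm_mul, Complex.norm_real, mul_pow, Real.norm_eq_abs, sq_abs, mul_pow, div_pow, div_pow,
      Real.sq_sqrt (by positivity), Real.sq_sqrt (by positivity), mul_inv]
    ring
  rw [overlap, tensorMap_kraus K h K h, rotatedBellState, Matrix.sum_mulVec, dotProduct_sum]
  simp only [dotProduct_kraus, hval]
  rw [← Complex.ofReal_sum, Complex.ofReal_re, Fintype.sum_prod_type, Finset.sum_comm]
  simp only [hpars]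
  rw [Finset.sum_comm]
  simp only [hnorm, ← Finset.mul_sum]
  rw [hsum]
  have : (0 : ℝ) < |(a : ℝ) - b| + 1 := by positivity
  field_simp

theorem trace_rotatedBellState (a : ℕ) (g : SO3) : (rotatedBellState a g).trace = 1 := by
  have h1 : ∑ i, ∑ j, rotation a g i j * star (rotation a g i j) = (a : ℂ) + 1 := by
    have : ∀ i, ∑ j, rotation a g i j * star (rotation a g i j) = 1 := by
      intro i
      have := congrFun (congrFun (rotation_mul_conjTranspose a g) i) i
      rwa [Matrix.mul_apply, Matrix.one_apply_eq] at this
    rw [Finset.sum_congr rfl fun i _ => this i]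
    simp
  have h2 : (a : ℂ) + 1 ≠ 0 := by exact_mod_cast Nat.succ_ne_zero a
  have h3 : ((1 / √(a + 1 : ℝ) : ℝ) : ℂ) * ((1 / √(a + 1 : ℝ) : ℝ) : ℂ) = ((a : ℂ) + 1)⁻¹ := by
    rw [← Complex.ofReal_mul, div_mul_div_comm, Real.mul_self_sqrt (by positivity)]
    push_cast; simp
  simp only [rotatedBellState, Matrix.trace, Matrix.diag_apply, Matrix.vecMulVec_apply,
    Pi.star_apply, rotatedBell_apply, star_mul', Complex.star_def, Complex.conj_ofReal,
    Fintype.sum_prod_type]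
  rw [← mul_inv_cancel₀ h2, ← h3, ← h1, Finset.sum_mul]
  refine Finset.sum_congr rfl fun i _ => ?_
  rw [Finset.sum_mul]
  refine Finset.sum_congr rfl fun j _ => ?_
  rw [Complex.star_def]
  ring

theorem successProb_of_trace_eq [MeasurableSpace SO3] (μ : Measure SO3) [IsProbabilityMeasure μ]
    {a b : ℕ} {M : Converter a b} {p : ℝ}
    (hM : ∀ X, (M X).trace = (p : ℂ) * X.trace) : successProb μ a b M = p := by
  simp [successProb, hM, trace_rotatedBellState]

theorem isQuantumOperation_smul {a b : ℕ} {C : Converter a b} (hC : IsChannel C) {p : ℝ} (h0 : 0 ≤ p)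
    (h1 : p ≤ 1) : IsQuantumOperation ((p : ℂ) • C) := by
  refine ⟨fun d X hX => ?_, fun X hX => ?_⟩
  · have : onFirst (Fin d) ((p : ℂ) • C) X = (p : ℂ) • onFirst (Fin d) C X := rfl
    rw [this]
    exact (hC.1 d X hX).smul (by exact_mod_cast h0)
  · rw [LinearMap.smul_apply, Matrix.trace_smul, hC.2, smul_eq_mul, Complex.re_ofReal_mul]
    have : 0 ≤ X.trace.re := (Complex.le_def.1 hX.trace_nonneg).1
    nlinarith

/-! ### The optimal fidelity -/

/-- The optimal fidelity, in terms of `a = 2J` and `b = 2K`. -/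
noncomputable def optimalFidelity (a b : ℕ) : ℝ :=
  ((a : ℝ) + 1) / ((b + 1) * (|(a : ℝ) - b| + 1))

theorem optimalFidelity_le {a b : ℕ} (hab : a ≠ b) (hb : b ≠ 0) :
    optimalFidelity a b ≤ 3 / 4 := by
  rw [optimalFidelity]
  have hb' : (1 : ℝ) ≤ b := by exact_mod_cast Nat.one_le_iff_ne_zero.2 hb
  have hpos : (0 : ℝ) < (b + 1) * (|(a : ℝ) - b| + 1) := by positivity
  rw [div_le_iff₀ hpos]
  rcases lt_or_gt_of_ne hab with h | h
  · have h' : (a : ℝ) + 1 ≤ b := by exact_mod_cast h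
    rw [abs_of_nonpos (by linarith)]
    have ha : (0 : ℝ) ≤ a := Nat.cast_nonneg a
    nlinarith
  · have h' : (b : ℝ) + 1 ≤ a := by exact_mod_cast h
    rw [abs_of_nonneg (by linarith)]
    -- With b = 1 + x and a - b = 1 + y the claim reads 0 ≤ 2x + 2y + 3xy. Equality at x = y = 0 is
    -- the case J = 1, K = 1/2.
    nlinarith [mul_nonneg (sub_nonneg.2 hb') (sub_nonneg.2 h')]

/-- The predicate P treats together the constraint of positive success probability and that of a
prescribed one. Multiplying the optimal channel by p scales overlap and success probability alike,
so the conditional fidelity is unchanged. -/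
theorem isGreatest_probFidelity [MeasurableSpace SO3] [BorelSpace SO3] (μ : Measure SO3)
    [μ.IsHaarMeasure] [IsProbabilityMeasure μ] (a b : ℕ) (P : ℝ → Prop)
    (hP : ∃ p, 0 < p ∧ p ≤ 1 ∧ P p) (hpos : ∀ p, P p → 0 < p) :
    IsGreatest {f | ∃ M : Converter a b, IsQuantumOperation M ∧ P (successProb μ a b M) ∧
      f = probFidelity μ a b M} (optimalFidelity a b) := by
  constructor
  · obtain ⟨p, h0, h1, hp⟩ := hP
    obtain ⟨D, hD⟩ := exists_isDecoder b
    set C := tensorMap (localConversion a b D) (localConversion a b D) with hC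
    have hch : IsChannel C := isChannel_tensorMap_localConversion hD
    have hs : successProb μ a b ((p : ℂ) • C) = p := successProb_of_trace_eq μ fun X => by
      rw [LinearMap.smul_apply, Matrix.trace_smul, hch.2, smul_eq_mul]
    refine ⟨(p : ℂ) • C, isQuantumOperation_smul hch h0.le h1, by rwa [hs], ?_⟩
    have ho : ∀ g, overlap a b ((p : ℂ) • C) g = p * optimalFidelity a b := by
      intro g
      rw [optimalFidelity, ← overlap_tensorMap_localConversion a b hD g, ← hC, overlap, overlap,
        LinearMap.smul_apply, Matrix.smul_mulVec, dotProduct_smul, smul_eq_mul,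
        Complex.re_ofReal_mul]
    rw [probFidelity, hs]
    simp only [ho, integral_const, probReal_univ, one_smul]
    field_simp
  · rintro f ⟨M, hM, hp, rfl⟩
    rw [probFidelity, div_le_iff₀ (hpos _ hp)]
    exact integral_overlap_le μ hM.1

end BellConversion

/-! ### The main theorem -/

theorem mainTheorem8 [MeasurableSpace SO3] [BorelSpace SO3]
    (μ : MeasureTheory.Measure SO3) [μ.IsHaarMeasure] [MeasureTheory.IsProbabilityMeasure μ]
    (a b : ℕ) (J K F : ℝ) (hJ : J = a / 2) (hK : K = b / 2)
    (hF : F = (2 * J + 1) / ((2 * K + 1) * (2 * |J - K| + 1))) :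
    -- the optimal deterministic fidelity
    IsGreatest {f | ∃ C : Converter a b, IsChannel C ∧ f = detFidelity μ a b C} F ∧
    -- the optimal probabilistic fidelity
    IsGreatest {f | ∃ M : Converter a b, IsQuantumOperation M ∧ 0 < successProb μ a b M ∧
      f = probFidelity μ a b M} F ∧
    -- the optimal probabilistic fidelity with an arbitrary given success probability
    (∀ p : ℝ, 0 < p → p ≤ 1 →
      IsGreatest {f | ∃ M : Converter a b, IsQuantumOperation M ∧ successProb μ a b M = p ∧
        f = probFidelity μ a b M} F) ∧
    -- the optimum is attained by local encoding, cloning or discarding, and decoding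
    (IsChannel (encode a) ∧
      (IsCompletelyPositive (cloneOrDiscard a b) ∧
        ∀ X, symProj a * X * symProj a = X →
          symProj b * cloneOrDiscard a b X * symProj b = cloneOrDiscard a b X ∧
          (cloneOrDiscard a b X).trace = X.trace) ∧
      (∃ D, IsDecoder b D) ∧
      ∀ D, IsDecoder b D →
        IsChannel (localConversion a b D) ∧
        IsChannel (tensorMap (localConversion a b D) (localConversion a b D)) ∧
        detFidelity μ a b (tensorMap (localConversion a b D) (localConversion a b D)) = F) ∧
    -- the values of the optimal fidelity
    (J ≠ K → K ≠ 0 → F ≤ 3 / 4) ∧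
    (J = K ∨ K = 0 → F = 1) ∧
    (J = 1 → K = 1 / 2 → F = 3 / 4) := by
  have hF' : F = optimalFidelity a b := by
    have e : 2 * |(a : ℝ) / 2 - b / 2| = |(a : ℝ) - b| := by
      rw [← abs_two, ← abs_mul, abs_two]
      congr 1
      ring
    rw [hF, hJ, hK, e, optimalFidelity]
    congr 1
    · ring
    · ring
  have hab : J = K ↔ a = b := by
    rw [hJ, hK, div_left_inj' two_ne_zero, Nat.cast_inj]
  have hb : K = 0 ↔ b = 0 := by
    rw [hK, div_eq_zero_iff, or_iff_left two_ne_zero, Nat.cast_eq_zero]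
  have hdet : ∀ D, IsDecoder b D →
      detFidelity μ a b (tensorMap (localConversion a b D) (localConversion a b D)) = F := by
    intro D hD
    rw [detFidelity]
    simp only [overlap_tensorMap_localConversion a b hD, integral_const, probReal_univ, one_smul]
    exact hF'.symm
  refine ⟨⟨?_, ?_⟩, ?_, ?_, ⟨isChannel_encode a, ⟨isCompletelyPositive_cloneOrDiscard a b,
    fun X hX => ⟨symProj_cloneOrDiscard hX, trace_cloneOrDiscard hX⟩⟩, exists_isDecoder b,
    fun D hD => ⟨isChannel_localConversion hD, isChannel_tensorMap_localConversion hD,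
      hdet D hD⟩⟩, ?_, ?_, ?_⟩
  · obtain ⟨D, hD⟩ := exists_isDecoder b
    exact ⟨_, isChannel_tensorMap_localConversion hD, (hdet D hD).symm⟩
  · rintro f ⟨C, hC, rfl⟩
    have h := integral_overlap_le μ hC.1
    -- A channel succeeds with probability 1, so the general bound specialises to the deterministic
    -- one.
    rw [successProb_of_trace_eq μ (p := 1) fun X => by rw [hC.2, Complex.ofReal_one, one_mul],
      mul_one] at h
    rw [hF']
    exact h
  · rw [hF']
    exact isGreatest_probFidelity μ a b (fun p => 0 < p) ⟨1, one_pos, le_rfl, one_pos⟩ fun _ h => h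
  · intro p h0 h1
    rw [hF']
    exact isGreatest_probFidelity μ a b (fun q => q = p) ⟨p, h0, h1, rfl⟩ fun _ h => h ▸ h0
  · intro h1 h2
    rw [hF']
    exact optimalFidelity_le (fun h => h1 (hab.2 h)) fun h => h2 (hb.2 h)
  · have ha : (a : ℝ) + 1 ≠ 0 := by positivity
    rw [hab, hb, hF', optimalFidelity]
    rintro (rfl | rfl)
    · simp [ha]
    · rw [Nat.cast_zero, sub_zero, Nat.abs_cast]
      simp [ha]
  · intro h1 h2
    rw [hF, h1, h2]
    norm_num [abs_of_pos]
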